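/- For a real number $u$, let $\mu^{*u}$ be the unique tempered distribution on $\mathbb R$ whose Fourier transform (defined by $\langle\widehat T,\varphi\rangle=\langle T,\widehat\varphi\rangle$, $\widehat\varphi(\lambda)=\int_{\mathbb R}e^{-i\lambda x}\varphi(x)\,dx$ for Schwartz functions $\varphi$) is the bounded function $\lambda\mapsto e^{-2iu\arctan(2\lambda)}$. Assume $u\in\mathbb R\setminus\mathbb Z$. For $x\ne0$ put $$\Phi_u(x)=e^{-|x|/2}\left(-\frac{u\sin(\pi u)}{\pi}\sum_{k=0}^{\infty}\frac{(1-u\,\mathrm{sgn}(x))_k\,|x|^k}{k!\,(k+1)!}\left[\frac{\Gamma'}{\Gamma}(1+k-u\,\mathrm{sgn}(x))-\frac{\Gamma'}{\Gamma}(1+k)-\frac{\Gamma'}{\Gamma}(2+k)+\log|x|\right]+\frac{\sin(\pi u)}{\pi x}\right)-\frac{\sin(\pi u)}{\pi x},$$ where $(a)_k=a(a+1)\cdots(a+k-1)$ is the Pochhammer symbol and $\Gamma'/\Gamma$ is the logarithmic derivative of the Euler gamma function. Then the series converges absolutely for every $x\neq 0$, $\Phi_u\in L^2(\mathbb R)$,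 and $$\mu^{*u}=\cos(\pi u)\,\delta_0+\frac{\sin(\pi u)}{\pi}\,\mathrm{pv}(1/x)+\Phi_u$$ as tempered distributions, where $\langle\mathrm{pv}(1/x),\varphi\rangle=\lim_{\varepsilon\to0^+}\int_{|x|>\varepsilon}\frac{\varphi(x)}{x}\,dx$. Moreover $\nu=\mu^{*u}$ satisfies, in the sense of distributions, $$x\,\nu''+2\,\nu'+\left(u-\frac{x}{4}\right)\nu=0.$$ -/

import Mathlib

open MeasureTheory Filter Topology
open scoped SchwartzMap FourierTransform ENNReal

noncomputable section

namespace JeulinYor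

/-! ### Fourier transform with the kernel `exp (-i λ x)` -/

/-- The dilation `x ↦ x / (2π)` of the real line. -/
def dilation : ℝ ≃L[ℝ] ℝ :=
  ContinuousLinearEquiv.unitsEquivAut ℝ (Units.mk0 (2 * Real.pi)⁻¹ (by positivity))

theorem dilation_apply (x : ℝ) : dilation x = x * (2 * Real.pi)⁻¹ := rfl

/-- The Fourier transform `φ ↦ (λ ↦ ∫ exp (-i λ x) φ x dx)` on Schwartz functions. -/
def schwartzFourier : 𝓢(ℝ, ℂ) →L[ℂ] 𝓢(ℝ, ℂ) :=
  SchwartzMap.compCLMOfContinuousLinearEquiv ℂ dilation ∘L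
    FourierTransform.fourierCLM ℂ 𝓢(ℝ, ℂ)

/-- The inverse of `schwartzFourier`. -/
def schwartzFourierInv : 𝓢(ℝ, ℂ) →L[ℂ] 𝓢(ℝ, ℂ) :=
  FourierTransform.fourierInvCLM ℂ 𝓢(ℝ, ℂ) ∘L
    SchwartzMap.compCLMOfContinuousLinearEquiv ℂ dilation.symm

theorem schwartzFourier_apply (φ : 𝓢(ℝ, ℂ)) (l : ℝ) :
    schwartzFourier φ l = ∫ x : ℝ, Complex.exp (-Complex.I * l * x) * φ x := by
  change (𝓕 φ : 𝓢(ℝ, ℂ)) (dilation l) = _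
  rw [SchwartzMap.fourier_coe, Real.fourier_real_eq_integral_exp_smul]
  refine integral_congr_ae (Eventually.of_forall fun x => ?_)
  simp only [smul_eq_mul]
  congr 2
  rw [dilation_apply]
  have : (Real.pi : ℂ) ≠ 0 := by exact_mod_cast Real.pi_ne_zero
  push_cast
  field_simp

theorem schwartzFourier_inv (φ : 𝓢(ℝ, ℂ)) : schwartzFourier (schwartzFourierInv φ) = φ := by
  ext x
  change (𝓕 (𝓕⁻ (SchwartzMap.compCLMOfContinuousLinearEquiv ℂ dilation.symm φ)) : 𝓢(ℝ, ℂ))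
    (dilation x) = _
  rw [FourierTransform.fourier_fourierInv_eq]
  simp

theorem schwartzFourierInv_fourier (φ : 𝓢(ℝ, ℂ)) :
    schwartzFourierInv (schwartzFourier φ) = φ := by
  have h : SchwartzMap.compCLMOfContinuousLinearEquiv ℂ dilation.symm (schwartzFourier φ)
      = 𝓕 φ := by
    ext x
    change (𝓕 φ : 𝓢(ℝ, ℂ)) (dilation (dilation.symm x)) = _
    simp
  change 𝓕⁻ (SchwartzMap.compCLMOfContinuousLinearEquiv ℂ dilation.symm (schwartzFourier φ)) = φ
  rw [h, FourierTransform.fourierInv_fourier_eq]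

/-- The Fourier transform of a tempered distribution: `⟨T̂, φ⟩ = ⟨T, φ̂⟩`. -/
def distFourier : 𝓢'(ℝ, ℂ) →L[ℂ] 𝓢'(ℝ, ℂ) :=
  PointwiseConvergenceCLM.precomp ℂ schwartzFourier

theorem distFourier_apply (T : 𝓢'(ℝ, ℂ)) (φ : 𝓢(ℝ, ℂ)) :
    distFourier T φ = T (schwartzFourier φ) := rfl

/-- The inverse Fourier transform on tempered distributions. -/
def distFourierInv : 𝓢'(ℝ, ℂ) →L[ℂ] 𝓢'(ℝ, ℂ) :=
  PointwiseConvergenceCLM.precomp ℂ schwartzFourierInv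

theorem distFourier_injective : Function.Injective distFourier := by
  intro S T h
  ext φ
  have := congrArg (fun R : 𝓢'(ℝ, ℂ) => R (schwartzFourierInv φ)) h
  simpa [distFourier_apply, schwartzFourier_inv] using this

theorem distFourier_distFourierInv (T : 𝓢'(ℝ, ℂ)) : distFourier (distFourierInv T) = T := by
  ext φ
  change T (schwartzFourierInv (schwartzFourier φ)) = T φ
  rw [schwartzFourierInv_fourier]

/-! ### The distributions `μ^{*u}` -/

/-- The function `λ ↦ exp (-2 i u Arctg (2 λ))`. -/
def symbol (u l : ℝ) : ℂ :=
  Complex.exp (-2 * Complex.I * u * Real.arctan (2 * l))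

theorem symbol_memLp (u : ℝ) : MemLp (symbol u) ∞ (volume : Measure ℝ) := by
  have hc : Continuous (symbol u) := by unfold symbol; fun_prop
  refine memLp_top_of_bound hc.aestronglyMeasurable 1 (Eventually.of_forall fun l => ?_)
  rw [symbol, show (-2 * Complex.I * u * Real.arctan (2 * l) : ℂ)
    = ((-2 * u * Real.arctan (2 * l) : ℝ) : ℂ) * Complex.I by push_cast; ring]
  exact (Complex.norm_exp_ofReal_mul_I _).le

/-- The tempered distribution given by the bounded function `symbol u`. -/
def symbolDist (u : ℝ) : 𝓢'(ℝ, ℂ) :=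
  Lp.toTemperedDistribution ((symbol_memLp u).toLp (symbol u))

theorem symbolDist_apply (u : ℝ) (φ : 𝓢(ℝ, ℂ)) :
    symbolDist u φ = ∫ l : ℝ, φ l * symbol u l := by
  rw [symbolDist, Lp.toTemperedDistribution_apply]
  refine integral_congr_ae ?_
  filter_upwards [(symbol_memLp u).coeFn_toLp] with l hl
  rw [hl, smul_eq_mul]

/-- `μ^{*u}`, the tempered distribution with Fourier transform `λ ↦ exp (-2 i u Arctg (2 λ))`. -/
def muPow (u : ℝ) : 𝓢'(ℝ, ℂ) := distFourierInv (symbolDist u)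

/-- The characterization of `μ^{*u}` by its Fourier transform. -/
theorem eq_muPow_iff (u : ℝ) (T : 𝓢'(ℝ, ℂ)) : T = muPow u ↔ distFourier T = symbolDist u := by
  rw [← distFourier_injective.eq_iff, muPow, distFourier_distFourierInv]

/-! ### The principal value of `1 / x` -/

theorem pv_bound (φ : 𝓢(ℝ, ℂ)) {x : ℝ} (hx : 0 < x) :
    ‖(φ x - φ (-x)) / x‖ ≤
      8 * (({(0, 1), (1, 0)} : Finset (ℕ × ℕ)).sup (schwartzSeminormFamily ℂ ℝ ℂ)) φ
        * (1 + x ^ 2)⁻¹ := by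
  set M := (({(0, 1), (1, 0)} : Finset (ℕ × ℕ)).sup (schwartzSeminormFamily ℂ ℝ ℂ)) φ with hM
  have hM0 : 0 ≤ M := apply_nonneg _ _
  have h01 : SchwartzMap.seminorm ℂ 0 1 φ ≤ M :=
    Seminorm.le_def.1 (Finset.le_sup (f := schwartzSeminormFamily ℂ ℝ ℂ)
      (by simp : ((0, 1) : ℕ × ℕ) ∈ ({(0, 1), (1, 0)} : Finset (ℕ × ℕ)))) φ
  have h10 : SchwartzMap.seminorm ℂ 1 0 φ ≤ M :=
    Seminorm.le_def.1 (Finset.le_sup (f := schwartzSeminormFamily ℂ ℝ ℂ)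
      (by simp : ((1, 0) : ℕ × ℕ) ∈ ({(0, 1), (1, 0)} : Finset (ℕ × ℕ)))) φ
  have hd : ∀ y, ‖deriv φ y‖ ≤ M := fun y => by
    have := SchwartzMap.le_seminorm' ℂ 0 1 φ y
    simp only [pow_zero, one_mul, iteratedDeriv_one] at this
    exact this.trans h01
  have hv : ∀ y, |y| * ‖φ y‖ ≤ M := fun y => by
    have := SchwartzMap.le_seminorm' ℂ 1 0 φ y
    simp only [pow_one, iteratedDeriv_zero] at this
    exact this.trans h10
  rw [norm_div, Complex.norm_real, Real.norm_eq_abs, abs_of_pos hx, ← div_eq_mul_inv,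
    div_le_div_iff₀ hx (by positivity)]
  rcases le_total x 1 with h1 | h1
  · have h2 : ‖φ x - φ (-x)‖ ≤ M * ‖x - -x‖ :=
      Convex.norm_image_sub_le_of_norm_deriv_le (s := Set.univ)
        (fun y _ => φ.differentiableAt) (fun y _ => hd y) convex_univ trivial trivial
    rw [Real.norm_eq_abs, show x - -x = 2 * x by ring, abs_of_pos (by positivity)] at h2
    have h3 : ‖φ x - φ (-x)‖ * (1 + x ^ 2) ≤ M * (2 * x) * 2 :=
      mul_le_mul h2 (by nlinarith) (by positivity) (by positivity)
    nlinarith [mul_nonneg hM0 hx.le]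
  · have h2 := hv x
    have h3 := hv (-x)
    rw [abs_neg, abs_of_pos hx] at h3
    rw [abs_of_pos hx] at h2
    have h4 := norm_sub_le (φ x) (φ (-x))
    have h5 : x * ‖φ x - φ (-x)‖ ≤ 2 * M := by nlinarith
    nlinarith [mul_nonneg hM0 hx.le, norm_nonneg (φ x - φ (-x))]

theorem pv_integrable (φ : 𝓢(ℝ, ℂ)) :
    IntegrableOn (fun x : ℝ => (φ x - φ (-x)) / x) (Set.Ioi 0) := by
  refine Integrable.mono' ((integrable_inv_one_add_sq.const_mul
    (8 * (({(0, 1), (1, 0)} : Finset (ℕ × ℕ)).sup (schwartzSeminormFamily ℂ ℝ ℂ)) φ)).integrableOn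
      (s := Set.Ioi 0)) ?_ ?_
  · refine Measurable.aestronglyMeasurable ?_
    have := φ.continuous.measurable
    fun_prop
  · filter_upwards [ae_restrict_mem measurableSet_Ioi] with x hx
    exact pv_bound φ hx

/-- The linear form `φ ↦ ∫_0^∞ (φ x - φ (-x)) / x dx`. -/
def pvForm : 𝓢(ℝ, ℂ) →L[ℂ] ℂ :=
  SchwartzMap.mkCLMtoNormedSpace (fun φ => ∫ x in Set.Ioi (0 : ℝ), (φ x - φ (-x)) / x)
    (fun φ ψ => by
      rw [← integral_add (pv_integrable φ) (pv_integrable ψ)]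
      refine integral_congr_ae (Eventually.of_forall fun x => ?_)
      simp only [add_apply]
      ring)
    (fun a φ => by
      rw [RingHom.id_apply, smul_eq_mul, ← integral_const_mul]
      refine integral_congr_ae (Eventually.of_forall fun x => ?_)
      simp only [smul_apply, smul_eq_mul]
      ring)
    ⟨{(0, 1), (1, 0)}, 8 * ∫ x in Set.Ioi (0 : ℝ), (1 + x ^ 2)⁻¹,
      mul_nonneg (by norm_num) (integral_nonneg fun x => by positivity), fun φ => by
      refine (norm_integral_le_of_norm_le ((integrable_inv_one_add_sq.const_mul
        (8 * (({(0, 1), (1, 0)} : Finset (ℕ × ℕ)).sup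
          (schwartzSeminormFamily ℂ ℝ ℂ)) φ)).integrableOn (s := Set.Ioi 0)) ?_).trans ?_
      · filter_upwards [ae_restrict_mem measurableSet_Ioi] with x hx
        exact pv_bound φ hx
      · rw [integral_const_mul]
        exact le_of_eq (by ring)⟩

/-- The tempered distribution `pv (1 / x)`. -/
def pvInv : 𝓢'(ℝ, ℂ) := ContinuousLinearMap.toPointwiseConvergenceCLM _ _ _ _ pvForm

theorem pvInv_apply (φ : 𝓢(ℝ, ℂ)) :
    pvInv φ = ∫ x in Set.Ioi (0 : ℝ), (φ x - φ (-x)) / x := rfl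

/-- `⟨pv (1 / x), φ⟩` is the limit of `∫_{|x| > ε} φ x / x dx` as `ε` decreases to `0`. -/
theorem tendsto_pvInv (φ : 𝓢(ℝ, ℂ)) :
    Tendsto (fun ε : ℝ => ∫ x in {x : ℝ | ε < |x|}, φ x / x) (𝓝[>] 0) (𝓝 (pvInv φ)) := by
  have hφm := φ.continuous.measurable
  have key : ∀ ε : ℝ, 0 < ε → ∫ x in {x : ℝ | ε < |x|}, φ x / x
      = ∫ x in Set.Ioi (0 : ℝ), (Set.Ioi ε).indicator (fun x : ℝ => (φ x - φ (-x)) / x) x := by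
    intro ε hε
    have hI : ∀ ψ : ℝ → ℂ, Integrable ψ → Measurable ψ →
        IntegrableOn (fun x : ℝ => ψ x / x) {x : ℝ | ε < |x|} := by
      intro ψ hψ hψm
      refine Integrable.mono' ((hψ.norm.const_mul ε⁻¹).integrableOn) ?_ ?_
      · refine Measurable.aestronglyMeasurable ?_
        fun_prop
      · have hms : MeasurableSet {x : ℝ | ε < |x|} :=
          measurableSet_lt measurable_const (by fun_prop)
        filter_upwards [ae_restrict_mem hms] with x hx
        rw [norm_div, Complex.norm_real, Real.norm_eq_abs, div_eq_inv_mul]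
        have : |x|⁻¹ ≤ ε⁻¹ := inv_anti₀ hε (le_of_lt hx)
        gcongr
    have hset : {x : ℝ | ε < |x|} = Set.Ioi ε ∪ Set.Iio (-ε) := by
      ext x
      simp only [Set.mem_ofPred_eq, Set.mem_union, Set.mem_Ioi, Set.mem_Iio, lt_abs, lt_neg]
    have h1 := hI φ φ.integrable hφm
    have h2 := hI (fun x => φ (-x)) φ.integrable.comp_neg (by fun_prop)
    rw [hset] at h1 h2 ⊢
    have hdis : Disjoint (Set.Ioi ε) (Set.Iio (-ε)) :=
      Set.disjoint_left.2 fun x hx hx' => by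
        simp only [Set.mem_Ioi, Set.mem_Iio] at hx hx'; linarith
    rw [setIntegral_union hdis measurableSet_Iio (h1.mono_set Set.subset_union_left)
      (h1.mono_set Set.subset_union_right), setIntegral_indicator measurableSet_Ioi,
      show Set.Ioi (0 : ℝ) ∩ Set.Ioi ε = Set.Ioi ε by
        rw [Set.Ioi_inter_Ioi, max_eq_right hε.le],
      ← integral_Iic_eq_integral_Iio, ← integral_comp_neg_Ioi]
    rw [← integral_add (h1.mono_set Set.subset_union_left)]
    · refine integral_congr_ae (Eventually.of_forall fun x => ?_)
      simp only [Complex.ofReal_neg, div_neg]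
      ring
    · refine (h2.mono_set Set.subset_union_left).neg.congr (Eventually.of_forall fun x => ?_)
      simp [div_neg]
  rw [pvInv_apply]
  refine Tendsto.congr' (f₁ := fun ε : ℝ => ∫ x in Set.Ioi (0 : ℝ),
    (Set.Ioi ε).indicator (fun x : ℝ => (φ x - φ (-x)) / x) x) ?_ ?_
  · filter_upwards [self_mem_nhdsWithin] with ε hε
    exact (key ε hε).symm
  · refine tendsto_integral_filter_of_dominated_convergence
      (fun x : ℝ => ‖(φ x - φ (-x)) / x‖) ?_ ?_ (pv_integrable φ).norm ?_
    · exact Eventually.of_forall fun ε =>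
        (pv_integrable φ).aestronglyMeasurable.indicator measurableSet_Ioi
    · exact Eventually.of_forall fun ε => Eventually.of_forall fun x =>
        norm_indicator_le_norm_self (fun x : ℝ => (φ x - φ (-x)) / x) x
    · filter_upwards [ae_restrict_mem measurableSet_Ioi] with x hx
      refine tendsto_const_nhds.congr' ?_
      filter_upwards [mem_nhdsWithin_of_mem_nhds (Iio_mem_nhds hx)] with ε hε
      have hm : x ∈ Set.Ioi ε := hε
      simp only [Set.indicator_of_mem hm]

/-! ### The function `Φ_u` -/

/-- The `k`-th term of the series in `Φ_u x`; `logDeriv Real.Gamma` is `Γ' / Γ` and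
`(ascPochhammer ℝ k).eval a` is the Pochhammer symbol `(a)_k`. -/
def phiTerm (u x : ℝ) (k : ℕ) : ℝ :=
  (ascPochhammer ℝ k).eval (1 - u * Real.sign x) * |x| ^ k /
      ((k.factorial : ℝ) * ((k + 1).factorial : ℝ)) *
    (logDeriv Real.Gamma (1 + k - u * Real.sign x) - logDeriv Real.Gamma (1 + k)
      - logDeriv Real.Gamma (2 + k) + Real.log |x|)

/-- The function `Φ_u`. -/
def Phi (u x : ℝ) : ℝ :=
  Real.exp (-|x| / 2) *
      (-(u * Real.sin (Real.pi * u) / Real.pi) * (∑' k : ℕ, phiTerm u x k)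
        + Real.sin (Real.pi * u) / (Real.pi * x))
    - Real.sin (Real.pi * u) / (Real.pi * x)

/-- Multiplication of a tempered distribution by the coordinate function `x`. -/
def mulX : 𝓢'(ℝ, ℂ) →L[ℂ] 𝓢'(ℝ, ℂ) :=
  TemperedDistribution.smulLeftCLM ℂ (fun x : ℝ => (x : ℂ))

/-- The distributional derivative. -/
def D : 𝓢'(ℝ, ℂ) →L[ℂ] 𝓢'(ℝ, ℂ) := TemperedDistribution.derivCLM ℂ

end JeulinYor

end

/-!
Write `κ = sin (πu) / π` and `G t = t / (1 + t)`.

For `x > 0` the series defining `Φ_u` gives `Φ_u x = κ (e^{-x/2} V_{1-u} x - 1 / x)`, where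
`V_a x = kummerV a x = 1 / x + (a - 1) logSeries a x` is a logarithmic solution of a confluent
hypergeometric equation, and `Φ_u (-x) = Φ_{-u} x`. The proof rests on three facts.

* For `0 < a < 2` the function `V_a` is the Laplace integral
  `kummerI a x = ∫ e^{-xt} G^{a-1} dt` over `(0, ∞)` (`kummerV_eq_kummerI`). Each of
  them, multiplied by `x` and paired with a companion (`kummerY`, `kummerJ`), solves the same
  first order system with a singular point at `0`. A solution of that system that tends to `0` at
  the origin vanishes (`eq_zero_of_singular_system`), so it is enough to compare the limits at
  `0`; for the Laplace integrals these come from Gauss's integral for the digamma function.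

* For `0 < u < 1` the symbol is a Cauchy integral (`symbol_eq_cauchyIntegral`):
  `e^{-2iu arctan (2λ)} = cos (πu) + κ ∫ (G^{-u} / (t + 1/2 + iλ) - G^u / (t + 1/2 - iλ)) dt`.
  Up to an additive constant both sides satisfy `(λ² + 1/4) f' = -iu f`, and the limits at `±∞`
  determine the constants. Since `1 / (t + 1/2 ± iλ)` is the Fourier transform of
  `e^{-(t + 1/2)|x|}` on a half-line, pairing this identity with a test function and exchanging
  the integrals gives the decomposition of `μ^{*u}` (`muPow_eq_decomp_of_mem_Ioo`); reflection
  `x ↦ -x` gives it for `-1 < u < 0`.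

* Both sides of the decomposition satisfy the recurrence
  `x ν_u = u (ν_{u+1} + 2 ν_u + ν_{u-1})`. For `μ^{*u}` it expresses that the derivative of the
  symbol is `-iu / (λ² + 1/4)` times the symbol and that
  `2 + 2 cos (2 arctan (2λ)) = 1 / (λ² + 1/4)` (`muPow_mulCoord`); for the right-hand side it is
  a contiguity relation of the functions `V_a` (`kummerV_recurrence`, `decomp_mulCoord`). Hence
  the decomposition extends to all non-integer `u` (`muPow_eq_decomp`).

The recurrence of the `V_a` also yields a polynomial bound at infinity, hence `Φ_u x = O(1/x)`;
near `0` the singularity of `Φ_u` is logarithmic, so `Φ_u` is square integrable. The differential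
equation is the first order equation of the symbol read on the Fourier side (`muPow_ode`).
-/

namespace JeulinYor

/-! ### Everywhere convergent power series and the digamma function -/

/-- The coefficient sequence `c` defines a power series that converges absolutely on all of `ℝ`. -/
def EntireCoeff (c : ℕ → ℝ) : Prop := ∀ r : ℝ, 0 ≤ r → Summable fun k => |c k| * r ^ k

/-- The sum of the power series with coefficients `c`. -/
noncomputable def powerSum (c : ℕ → ℝ) (x : ℝ) : ℝ := ∑' k, c k * x ^ k

theorem EntireCoeff.summable {c : ℕ → ℝ} (hc : EntireCoeff c) (x : ℝ) :
    Summable fun k => c k * x ^ k := by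
  refine Summable.of_norm ?_
  simpa [abs_mul, abs_pow] using hc |x| (abs_nonneg x)

theorem EntireCoeff.mul_bound {c b : ℕ → ℝ} (hc : EntireCoeff c) {C : ℝ}
    (hb : ∀ k, |b k| ≤ C * 2 ^ k) : EntireCoeff fun k => c k * b k := by
  intro r hr
  refine Summable.of_nonneg_of_le (fun k => by positivity) (fun k => ?_)
    ((hc (2 * r) (by positivity)).mul_left C)
  rw [abs_mul, mul_pow]
  calc |c k| * |b k| * r ^ k ≤ |c k| * (C * 2 ^ k) * r ^ k := by gcongr; exact hb k
    _ = C * (|c k| * (2 ^ k * r ^ k)) := by ring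

theorem EntireCoeff.add {c d : ℕ → ℝ} (hc : EntireCoeff c) (hd : EntireCoeff d) :
    EntireCoeff fun k => c k + d k := by
  intro r hr
  refine Summable.of_nonneg_of_le (fun k => by positivity) (fun k => ?_)
    ((hc r hr).add (hd r hr))
  rw [← add_mul]
  gcongr
  exact abs_add_le _ _

theorem EntireCoeff.const_mul {c : ℕ → ℝ} (hc : EntireCoeff c) (a : ℝ) :
    EntireCoeff fun k => a * c k := by
  intro r hr
  simpa [abs_mul, mul_assoc] using (hc r hr).mul_left |a|

theorem EntireCoeff.succ {c : ℕ → ℝ} (hc : EntireCoeff c) : EntireCoeff fun k => c (k + 1) := by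
  intro r hr
  have h := (summable_nat_add_iff 1).2 (hc (r + 1) (by positivity))
  refine Summable.of_nonneg_of_le (fun k => by positivity) (fun k => ?_) h
  gcongr
  calc r ^ k ≤ (r + 1) ^ k := by gcongr; linarith
    _ ≤ (r + 1) ^ (k + 1) := pow_le_pow_right₀ (by linarith) (Nat.le_succ k)

theorem natCast_add_one_le_two_pow (k : ℕ) : ((k : ℝ) + 1) ≤ 2 ^ k := by
  have : k + 1 ≤ 2 ^ k := Nat.lt_two_pow_self
  exact_mod_cast this

theorem EntireCoeff.deriv {c : ℕ → ℝ} (hc : EntireCoeff c) :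
    EntireCoeff fun k => ((k : ℝ) + 1) * c (k + 1) := by
  have := hc.succ.mul_bound (b := fun k => (k : ℝ) + 1) (C := 1) fun k => by
    rw [abs_of_nonneg (by positivity), one_mul]
    exact natCast_add_one_le_two_pow k
  simpa only [mul_comm] using this

theorem powerSum_eq_add {c : ℕ → ℝ} (hc : EntireCoeff c) (x : ℝ) :
    powerSum c x = c 0 + x * powerSum (fun k => c (k + 1)) x := by
  rw [powerSum, (hc.summable x).tsum_eq_zero_add, powerSum, ← tsum_mul_left]
  simp only [pow_zero, mul_one]
  congr 1
  exact tsum_congr fun k => by ring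

theorem powerSum_add {c d : ℕ → ℝ} (hc : EntireCoeff c) (hd : EntireCoeff d) (x : ℝ) :
    powerSum (fun k => c k + d k) x = powerSum c x + powerSum d x := by
  rw [powerSum, powerSum, powerSum, ← (hc.summable x).tsum_add (hd.summable x)]
  exact tsum_congr fun k => by ring

theorem powerSum_const_mul (c : ℕ → ℝ) (a x : ℝ) :
    powerSum (fun k => a * c k) x = a * powerSum c x := by
  rw [powerSum, powerSum, ← tsum_mul_left]
  exact tsum_congr fun k => by ring

theorem hasDerivAt_powerSum {c : ℕ → ℝ} (hc : EntireCoeff c) (x : ℝ) :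
    HasDerivAt (powerSum c) (powerSum (fun k => ((k : ℝ) + 1) * c (k + 1)) x) x := by
  set R : ℝ := |x| + 1 with hR
  have hR1 : 1 ≤ R := by rw [hR]; linarith [abs_nonneg x]
  have hsum : Summable fun k : ℕ => |c k| * (2 * R) ^ k := hc (2 * R) (by positivity)
  have hderiv : ∀ (k : ℕ) (y : ℝ), y ∈ Metric.ball (0 : ℝ) R →
      HasDerivAt (fun z => c k * z ^ k) (c k * (k * y ^ (k - 1))) y := fun k y _ =>
    (hasDerivAt_pow k y).const_mul (c k)
  have hx : x ∈ Metric.ball (0 : ℝ) R := by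
    rw [mem_ball_zero_iff, Real.norm_eq_abs]; linarith
  have hbound : ∀ (k : ℕ) (y : ℝ), y ∈ Metric.ball (0 : ℝ) R →
      ‖c k * (k * y ^ (k - 1))‖ ≤ |c k| * (2 * R) ^ k := by
    intro k y hy
    rw [mem_ball_zero_iff, Real.norm_eq_abs] at hy
    rw [norm_mul, Real.norm_eq_abs, norm_mul, norm_pow, mul_pow, Real.norm_eq_abs,
      Real.norm_eq_abs, Nat.abs_cast]
    have h1 : (k : ℝ) ≤ 2 ^ k := by linarith [natCast_add_one_le_two_pow k]
    have h2 : |y| ^ (k - 1) ≤ R ^ k :=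
      (pow_le_pow_left₀ (abs_nonneg y) hy.le _).trans
        (pow_le_pow_right₀ hR1 (Nat.sub_le k 1))
    gcongr
  have h := hasDerivAt_tsum_of_isPreconnected hsum Metric.isOpen_ball
    (convex_ball (0 : ℝ) R).isPreconnected hderiv hbound hx (hc.summable x) hx
  refine h.congr_deriv ?_
  have hs : Summable fun k : ℕ => c k * (k * x ^ (k - 1)) :=
    Summable.of_norm_bounded hsum fun k => hbound k x hx
  rw [hs.tsum_eq_zero_add]
  simp only [Nat.cast_zero, zero_mul, mul_zero, zero_add, powerSum]
  refine tsum_congr fun k => ?_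
  rw [Nat.add_sub_cancel]
  push_cast
  ring

theorem continuous_powerSum {c : ℕ → ℝ} (hc : EntireCoeff c) : Continuous (powerSum c) :=
  continuous_iff_continuousAt.2 fun x => (hasDerivAt_powerSum hc x).continuousAt

theorem powerSum_zero {c : ℕ → ℝ} (hc : EntireCoeff c) : powerSum c 0 = c 0 := by
  rw [powerSum_eq_add hc]; simp

/-- The digamma function `Γ' / Γ` of a real variable. -/
noncomputable abbrev psi (x : ℝ) : ℝ := logDeriv Real.Gamma x

theorem psi_add_one {x : ℝ} (hx : ∀ m : ℕ, x ≠ -m) : psi (x + 1) = psi x + 1 / x := by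
  have hx0 : x ≠ 0 := by simpa using hx 0
  have hΓ : Real.Gamma x ≠ 0 := Real.Gamma_ne_zero hx
  have hd := Real.differentiableAt_Gamma hx
  have h1 : HasDerivAt (fun y => Real.Gamma (y + 1))
      (1 * Real.Gamma x + x * deriv Real.Gamma x) x := by
    refine ((hasDerivAt_id x).mul hd.hasDerivAt).congr_of_eventuallyEq ?_
    filter_upwards [isOpen_ne.mem_nhds hx0] with y hy
    exact Real.Gamma_add_one hy
  have h2 : deriv Real.Gamma (x + 1) = 1 * Real.Gamma x + x * deriv Real.Gamma x := by
    rw [← h1.deriv, deriv_comp_add_const]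
  rw [psi, psi, logDeriv_apply, logDeriv_apply, h2, Real.Gamma_add_one hx0]
  field_simp
  ring

theorem psi_one : psi 1 = -Real.eulerMascheroniConstant := by
  rw [psi, logDeriv_apply, Real.hasDerivAt_Gamma_one.deriv, Real.Gamma_one, div_one]

theorem ne_neg_natCast_add {a : ℝ} (ha : ∀ m : ℕ, a ≠ -m) (k m : ℕ) : a + k ≠ -m := by
  intro h
  refine ha (m + k) ?_
  push_cast
  linarith

theorem one_ne_neg_natCast (m : ℕ) : (1 : ℝ) ≠ -m := by
  have : (0 : ℝ) ≤ m := Nat.cast_nonneg m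
  intro h; linarith

/-- Along `a, a + 1, a + 2, …` the digamma function grows at most geometrically; this crude bound
suffices against the factorials. -/
theorem exists_abs_psi_add_le {a : ℝ} (ha : ∀ m : ℕ, a ≠ -m) :
    ∃ C, 0 ≤ C ∧ ∀ k : ℕ, |psi (a + k)| ≤ C * 2 ^ k := by
  have htend : Tendsto (fun k : ℕ => 1 / (a + k)) atTop (𝓝 0) :=
    (tendsto_atTop_add_const_left _ a tendsto_natCast_atTop_atTop).const_div_atTop 1
  obtain ⟨M, hM⟩ := htend.norm.bddAbove_range
  have hM' : ∀ k : ℕ, |1 / (a + k)| ≤ M := fun k => hM ⟨k, rfl⟩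
  have hM0 : 0 ≤ M := (abs_nonneg _).trans (hM' 0)
  have hlin : ∀ k : ℕ, |psi (a + k)| ≤ |psi a| + k * M := by
    intro k
    induction k with
    | zero => simp
    | succ k ih =>
      have h := psi_add_one (ne_neg_natCast_add ha k)
      rw [Nat.cast_succ, ← add_assoc, h]
      calc |psi (a + k) + 1 / (a + k)| ≤ |psi (a + k)| + |1 / (a + k)| := abs_add_le _ _
        _ ≤ (|psi a| + k * M) + M := add_le_add ih (hM' k)
        _ = |psi a| + (k + 1) * M := by ring
  refine ⟨|psi a| + M, by positivity, fun k => (hlin k).trans ?_⟩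
  have h1 := natCast_add_one_le_two_pow k
  have h2 : (0 : ℝ) ≤ k := Nat.cast_nonneg k
  nlinarith [abs_nonneg (psi a), mul_nonneg h2 (abs_nonneg (psi a))]

/-! ### The logarithmic solutions of Kummer's equation -/

/-- The coefficients `(a)_k / (k! (k+1)!)` of the regular solution of Kummer's equation with
parameters `(a, 2)`. -/
noncomputable def kummerCoeff (a : ℝ) (k : ℕ) : ℝ :=
  (ascPochhammer ℝ k).eval a / ((k.factorial : ℝ) * ((k + 1).factorial : ℝ))

/-- The digamma combination that accompanies `kummerCoeff a k` in the logarithmic solution. -/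
noncomputable def psiCoeff (a : ℝ) (k : ℕ) : ℝ := psi (a + k) - psi (1 + k) - psi (2 + k)

theorem kummerCoeff_zero (a : ℝ) : kummerCoeff a 0 = 1 := by simp [kummerCoeff]

theorem kummerCoeff_succ (a : ℝ) (k : ℕ) :
    kummerCoeff a (k + 1) = kummerCoeff a k * (a + k) / ((k + 1) * (k + 2)) := by
  have h1 : ((k.factorial : ℕ) : ℝ) ≠ 0 := by exact_mod_cast k.factorial_ne_zero
  have h2 : (k : ℝ) + 1 ≠ 0 := by positivity
  have h3 : (k : ℝ) + 2 ≠ 0 := by positivity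
  rw [kummerCoeff, kummerCoeff, ascPochhammer_succ_eval, Nat.factorial_succ (k + 1),
    Nat.factorial_succ k]
  push_cast
  field_simp
  ring

theorem kummerCoeff_sub_one (a : ℝ) (k : ℕ) :
    kummerCoeff (a - 1) (k + 1) = (a - 1) * kummerCoeff a k / ((k + 1) * (k + 2)) := by
  have h1 : ((k.factorial : ℕ) : ℝ) ≠ 0 := by exact_mod_cast k.factorial_ne_zero
  have h2 : (k : ℝ) + 1 ≠ 0 := by positivity
  have h3 : (k : ℝ) + 2 ≠ 0 := by positivity
  have h4 : (ascPochhammer ℝ (k + 1)).eval (a - 1) = (a - 1) * (ascPochhammer ℝ k).eval a := by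
    rw [ascPochhammer_succ_left]
    simp [Polynomial.eval_comp]
  rw [kummerCoeff, kummerCoeff, h4, Nat.factorial_succ (k + 1), Nat.factorial_succ k]
  push_cast
  field_simp
  ring

theorem mul_kummerCoeff_add_one (a : ℝ) (k : ℕ) :
    a * kummerCoeff (a + 1) k = (a + k) * kummerCoeff a k := by
  have h4 : a * (ascPochhammer ℝ k).eval (a + 1) = (ascPochhammer ℝ k).eval a * (a + k) := by
    rw [← ascPochhammer_succ_eval, ascPochhammer_succ_left]
    simp [Polynomial.eval_comp]
  rw [kummerCoeff, kummerCoeff, ← mul_div_assoc, h4]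
  ring

theorem abs_kummerCoeff_le (a : ℝ) (k : ℕ) :
    |kummerCoeff a k| ≤ (1 + |a|) ^ k / k.factorial := by
  induction k with
  | zero => simp [kummerCoeff_zero]
  | succ k ih =>
    rw [kummerCoeff_succ, abs_div, abs_mul, abs_of_pos (by positivity : (0 : ℝ) < (k + 1) * (k + 2)),
      Nat.factorial_succ, pow_succ]
    have h1 : |a + k| ≤ (1 + |a|) * (k + 2) := by
      refine (abs_add_le _ _).trans ?_
      rw [Nat.abs_cast]
      nlinarith [abs_nonneg a, mul_nonneg (abs_nonneg a) (Nat.cast_nonneg (α := ℝ) k)]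
    calc |kummerCoeff a k| * |a + k| / ((k + 1) * (k + 2))
        ≤ (1 + |a|) ^ k / k.factorial * ((1 + |a|) * (k + 2)) / ((k + 1) * (k + 2)) := by gcongr
      _ = (1 + |a|) ^ k * (1 + |a|) / ((k + 1 : ℕ) * k.factorial : ℕ) := by
        push_cast
        field_simp

theorem entireCoeff_kummerCoeff (a : ℝ) : EntireCoeff (kummerCoeff a) := by
  intro r hr
  refine Summable.of_nonneg_of_le (fun k => by positivity) (fun k => ?_)
    (Real.summable_pow_div_factorial ((1 + |a|) * r))
  rw [mul_pow, mul_div_right_comm]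
  gcongr
  exact abs_kummerCoeff_le a k

theorem two_ne_neg_natCast (m : ℕ) : (2 : ℝ) ≠ -m := by
  have : (0 : ℝ) ≤ m := Nat.cast_nonneg m
  intro h; linarith

theorem entireCoeff_mul_psiCoeff {a : ℝ} (ha : ∀ m : ℕ, a ≠ -m) :
    EntireCoeff fun k => kummerCoeff a k * psiCoeff a k := by
  obtain ⟨C₁, -, h1⟩ := exists_abs_psi_add_le ha
  obtain ⟨C₂, -, h2⟩ := exists_abs_psi_add_le one_ne_neg_natCast
  obtain ⟨C₃, -, h3⟩ := exists_abs_psi_add_le two_ne_neg_natCast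
  refine (entireCoeff_kummerCoeff a).mul_bound (C := C₁ + C₂ + C₃) fun k => ?_
  rw [psiCoeff]
  have e1 := abs_sub (psi (a + k) - psi (1 + k)) (psi (2 + k))
  have e2 := abs_sub (psi (a + k)) (psi (1 + k))
  linarith [h1 k, h2 k, h3 k]

/-- The general term of the logarithmic series. -/
noncomputable def logTerm (a x : ℝ) (k : ℕ) : ℝ :=
  kummerCoeff a k * x ^ k * (psiCoeff a k + Real.log x)

/-- The logarithmic series `∑ (a)_k x^k / (k! (k+1)!) (ψ(a+k) - ψ(1+k) - ψ(2+k) + log x)`. -/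
noncomputable def logSeries (a x : ℝ) : ℝ := ∑' k, logTerm a x k

/-- The logarithmic solution `1/x + (a-1) logSeries a x` of Kummer's equation
`x w'' + (2 - x) w' - a w = 0`; in classical notation it is `Γ(a) U(a, 2, x)`. -/
noncomputable def kummerV (a x : ℝ) : ℝ := 1 / x + (a - 1) * logSeries a x

/-- The companion of `kummerV`, classically `Γ(a) U(a, 1, x)`; both together solve the first order
system of `hasDerivAt_mul_kummerV` and `hasDerivAt_kummerY`. -/
noncomputable def kummerY (a x : ℝ) : ℝ :=
  -(Real.log x * powerSum (fun k => ((k : ℝ) + 1) * kummerCoeff a k) x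
    + powerSum (fun k => ((k : ℝ) + 1) * (kummerCoeff a k * psiCoeff a k) + kummerCoeff a k) x)

theorem summable_logTerm {a : ℝ} (ha : ∀ m : ℕ, a ≠ -m) (x : ℝ) : Summable (logTerm a x) := by
  have h := ((entireCoeff_mul_psiCoeff ha).summable x).add
    (((entireCoeff_kummerCoeff a).summable x).mul_left (Real.log x))
  refine h.congr fun k => ?_
  rw [logTerm]; ring

theorem logSeries_eq {a : ℝ} (ha : ∀ m : ℕ, a ≠ -m) (x : ℝ) :
    logSeries a x = Real.log x * powerSum (kummerCoeff a) x
      + powerSum (fun k => kummerCoeff a k * psiCoeff a k) x := by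
  rw [logSeries, powerSum, powerSum, ← tsum_mul_left,
    ← (((entireCoeff_kummerCoeff a).summable x).mul_left (Real.log x)).tsum_add
      ((entireCoeff_mul_psiCoeff ha).summable x)]
  exact tsum_congr fun k => by rw [logTerm]; ring

/-- The coefficients of `x * powerSum c x`. -/
theorem entireCoeff_shift {c : ℕ → ℝ} (hc : EntireCoeff c) :
    EntireCoeff fun k => Nat.casesOn k 0 c := by
  intro r hr
  rw [← summable_nat_add_iff 1]
  refine ((hc r hr).mul_left r).congr fun k => ?_
  simp only
  ring

theorem powerSum_shift {c : ℕ → ℝ} (hc : EntireCoeff c) (x : ℝ) :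
    powerSum (fun k => Nat.casesOn k 0 c) x = x * powerSum c x := by
  rw [powerSum_eq_add (entireCoeff_shift hc)]
  simp

theorem entireCoeff_natCast_mul {c : ℕ → ℝ} (hc : EntireCoeff c) :
    EntireCoeff fun k => ((k : ℝ) + 1) * c k := (entireCoeff_shift hc).deriv

theorem hasDerivAt_mul_powerSum {c : ℕ → ℝ} (hc : EntireCoeff c) (x : ℝ) :
    HasDerivAt (fun x => x * powerSum c x) (powerSum (fun k => ((k : ℝ) + 1) * c k) x) x := by
  have h := hasDerivAt_powerSum (entireCoeff_shift hc) x
  exact h.congr_of_eventuallyEq (Eventually.of_forall fun y => (powerSum_shift hc y).symm)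

theorem hasDerivAt_mul_kummerV {a : ℝ} (ha : ∀ m : ℕ, a ≠ -m) {x : ℝ} (hx : 0 < x) :
    HasDerivAt (fun x => x * kummerV a x) (-((a - 1) * kummerY a x)) x := by
  have hA := entireCoeff_kummerCoeff a
  have hB := entireCoeff_mul_psiCoeff ha
  have h1 := ((Real.hasDerivAt_log hx.ne').mul (hasDerivAt_mul_powerSum hA x)).add
    (hasDerivAt_mul_powerSum hB x)
  have h2 := (h1.const_mul (a - 1)).const_add 1
  refine (h2.congr_deriv ?_).congr_of_eventuallyEq ?_
  · rw [kummerY, powerSum_add (entireCoeff_natCast_mul hB) hA]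
    field_simp
    ring
  · filter_upwards [isOpen_ne.mem_nhds hx.ne'] with y hy
    simp only [Pi.add_apply, Pi.mul_apply]
    rw [kummerV, logSeries_eq ha]
    field_simp

theorem psiCoeff_succ {a : ℝ} (ha : ∀ m : ℕ, a ≠ -m) (k : ℕ) :
    psiCoeff a (k + 1) = psiCoeff a k + 1 / (a + k) - 1 / (k + 1) - 1 / (k + 2) := by
  have h1 := psi_add_one (ne_neg_natCast_add ha k)
  have h2 := psi_add_one (ne_neg_natCast_add one_ne_neg_natCast k)
  have h3 := psi_add_one (ne_neg_natCast_add two_ne_neg_natCast k)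
  rw [psiCoeff, psiCoeff]
  push_cast
  rw [← add_assoc, ← add_assoc, ← add_assoc, h1, h2, h3, add_comm (1 : ℝ) k, add_comm (2 : ℝ) k]
  ring

theorem hasDerivAt_kummerY {a : ℝ} (ha : ∀ m : ℕ, a ≠ -m) {x : ℝ} (hx : 0 < x) :
    HasDerivAt (kummerY a) (kummerY a x - kummerV a x) x := by
  have hA := entireCoeff_kummerCoeff a
  have hB := entireCoeff_mul_psiCoeff ha
  have hR := entireCoeff_natCast_mul hA
  have hC := (entireCoeff_natCast_mul hB).add hA
  have h1 := (((Real.hasDerivAt_log hx.ne').mul (hasDerivAt_powerSum hR x)).add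
    (hasDerivAt_powerSum hC x)).neg
  refine h1.congr_deriv ?_
  have e1 : powerSum (fun k => ((k : ℝ) + 1) * (((k + 1 : ℕ) : ℝ) + 1) * kummerCoeff a (k + 1)) x
      = powerSum (fun k => ((k : ℝ) + 1) * kummerCoeff a k) x
        + (a - 1) * powerSum (kummerCoeff a) x := by
    rw [← powerSum_const_mul, ← powerSum_add hR (hA.const_mul _)]
    congr 1
    funext k
    rw [kummerCoeff_succ]
    push_cast
    field_simp
    ring
  have e2 : powerSum (fun k => (((k + 1 : ℕ) : ℝ) + 1) * kummerCoeff a (k + 1)) x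
      + powerSum (fun k => ((k : ℝ) + 1) * ((((k + 1 : ℕ) : ℝ) + 1)
        * (kummerCoeff a (k + 1) * psiCoeff a (k + 1)) + kummerCoeff a (k + 1))) x
      = powerSum (fun k => ((k : ℝ) + 1) * (kummerCoeff a k * psiCoeff a k) + kummerCoeff a k) x
        + (a - 1) * powerSum (fun k => kummerCoeff a k * psiCoeff a k) x := by
    rw [← powerSum_const_mul, ← powerSum_add hC (hB.const_mul _), ← powerSum_add hR.succ hC.deriv]
    congr 1
    funext k
    have hk : a + k ≠ 0 := by simpa using ne_neg_natCast_add ha k 0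
    rw [psiCoeff_succ ha, kummerCoeff_succ]
    push_cast
    field_simp
    ring
  simp only [mul_assoc] at e1 e2 ⊢
  have e3 : powerSum (fun k => ((k : ℝ) + 1) * kummerCoeff a k) x
      = 1 + x * powerSum (fun k => (((k + 1 : ℕ) : ℝ) + 1) * kummerCoeff a (k + 1)) x := by
    rw [powerSum_eq_add hR]
    simp [kummerCoeff_zero]
  rw [kummerV, kummerY, logSeries_eq ha, e1]
  generalize powerSum (fun k => ((k : ℝ) + 1) * kummerCoeff a k) x = p at e3 ⊢
  generalize powerSum (fun k => (((k + 1 : ℕ) : ℝ) + 1) * kummerCoeff a (k + 1)) x = q at e2 e3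
  generalize powerSum (fun k => ((k : ℝ) + 1) * ((((k + 1 : ℕ) : ℝ) + 1)
    * (kummerCoeff a (k + 1) * psiCoeff a (k + 1)) + kummerCoeff a (k + 1))) x = r at e2 ⊢
  generalize powerSum (fun k => ((k : ℝ) + 1) * (kummerCoeff a k * psiCoeff a k)
    + kummerCoeff a k) x = s at e2 ⊢
  have e4 : x⁻¹ * p = x⁻¹ + q := by rw [e3]; field_simp
  rw [e4, one_div]
  linear_combination -e2

theorem tendsto_mul_log_zero : Tendsto (fun x => x * Real.log x) (𝓝[>] 0) (𝓝 0) := by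
  have h := Real.continuous_mul_log.tendsto 0
  simp only [zero_mul] at h
  exact h.mono_left nhdsWithin_le_nhds

theorem tendsto_mul_kummerV {a : ℝ} (ha : ∀ m : ℕ, a ≠ -m) :
    Tendsto (fun x => x * kummerV a x) (𝓝[>] 0) (𝓝 1) := by
  have hA := (continuous_powerSum (entireCoeff_kummerCoeff a)).tendsto 0
  have hB := (continuous_powerSum (entireCoeff_mul_psiCoeff ha)).tendsto 0
  have hx : Tendsto (fun x : ℝ => x) (𝓝[>] 0) (𝓝 0) := nhdsWithin_le_nhds
  have h := (((tendsto_mul_log_zero.mul (hA.mono_left nhdsWithin_le_nhds)).add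
    (hx.mul (hB.mono_left nhdsWithin_le_nhds))).const_mul (a - 1)).const_add 1
  simp only [zero_mul, add_zero, mul_zero] at h
  refine h.congr' ?_
  filter_upwards [self_mem_nhdsWithin] with x hx
  have hx0 : x ≠ 0 := ne_of_gt hx
  rw [kummerV, logSeries_eq ha]
  field_simp

/-- The singularity of `kummerY` at `0` is `-log x`, and the constant term involves `ψ(a)`. -/
theorem tendsto_kummerY_add_log {a : ℝ} (ha : ∀ m : ℕ, a ≠ -m) :
    Tendsto (fun x => kummerY a x + Real.log x) (𝓝[>] 0) (𝓝 (-(psi a - 2 * psi 1))) := by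
  have hA := entireCoeff_kummerCoeff a
  have hB := entireCoeff_mul_psiCoeff ha
  have hR := entireCoeff_natCast_mul hA
  have hC := (entireCoeff_natCast_mul hB).add hA
  have h1 := (continuous_powerSum hR.succ).tendsto 0
  have h2 := (continuous_powerSum hC).tendsto 0
  rw [powerSum_zero hC] at h2
  have h := ((tendsto_mul_log_zero.mul (h1.mono_left nhdsWithin_le_nhds)).add
    (h2.mono_left nhdsWithin_le_nhds)).neg
  have hc : -(psi a - 2 * psi 1) = -(0 * powerSum (fun k => (((k + 1 : ℕ) : ℝ) + 1)
      * kummerCoeff a (k + 1)) 0 + ((((0 : ℕ) : ℝ) + 1) * (kummerCoeff a 0 * psiCoeff a 0)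
      + kummerCoeff a 0)) := by
    have := psi_add_one one_ne_neg_natCast
    rw [one_add_one_eq_two] at this
    rw [psiCoeff, kummerCoeff_zero]
    simp only [Nat.cast_zero, add_zero]
    rw [this]
    ring
  rw [hc]
  refine h.congr' ?_
  filter_upwards [self_mem_nhdsWithin] with x hx
  rw [kummerY, powerSum_eq_add hR]
  simp only [Nat.cast_zero, zero_add, kummerCoeff_zero, one_mul]
  ring

/-- The three-term recurrence in the parameter `a`. It is a termwise identity of the series, in
which `logTerm a x k` is moved to index `k + 1` by the factor `x`; the term `1 / x` of `kummerV` absorbs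
what is left over at index `0`. -/
theorem kummerV_recurrence {a : ℝ} (ha : ∀ m : ℤ, a ≠ m) {x : ℝ} (hx : 0 < x) :
    (a - 1) * (kummerV (a - 1) x + kummerV (a + 1) x) = (x + 2 * a - 2) * kummerV a x := by
  have ha0 : ∀ m : ℕ, a ≠ -m := fun m h => ha (-m) (by push_cast; exact h)
  have ham : ∀ m : ℕ, a - 1 ≠ -m := fun m h => ha (1 - m) (by push_cast; linarith)
  have hap : ∀ m : ℕ, a + 1 ≠ -m := fun m h => ha (-1 - m) (by push_cast; linarith)
  have ha1 : a - 1 ≠ 0 := sub_ne_zero.2 (by exact_mod_cast ha 1)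
  have ha2 : a ≠ 0 := by exact_mod_cast ha 0
  have hs0 := summable_logTerm ha0 x
  have hsm := summable_logTerm ham x
  have hsp := summable_logTerm hap x
  have key : ∀ k : ℕ, (a - 2) * logTerm (a - 1) x (k + 1) + a * logTerm (a + 1) x (k + 1)
      = x * logTerm a x k + (2 * a - 2) * logTerm a x (k + 1) := by
    intro k
    have hk : a + k ≠ 0 := by simpa using ne_neg_natCast_add ha0 k 0
    have hk1 : a + k + 1 ≠ 0 := by
      have := ne_neg_natCast_add ha0 (k + 1) 0
      simpa [add_assoc] using this
    have e1 : psiCoeff (a - 1) (k + 1) = psiCoeff a k - 1 / (k + 1) - 1 / (k + 2) := by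
      have h2 := psi_add_one (ne_neg_natCast_add one_ne_neg_natCast k)
      have h3 := psi_add_one (ne_neg_natCast_add two_ne_neg_natCast k)
      rw [psiCoeff, psiCoeff, show a - 1 + ((k + 1 : ℕ) : ℝ) = a + k by push_cast; ring]
      push_cast
      rw [← add_assoc, ← add_assoc, h2, h3, add_comm (1 : ℝ) k, add_comm (2 : ℝ) k]
      ring
    have e2 : psiCoeff (a + 1) (k + 1) = psiCoeff a (k + 1) + 1 / (a + k + 1) := by
      have h1 := psi_add_one (ne_neg_natCast_add ha0 (k + 1))
      rw [psiCoeff, psiCoeff, show a + 1 + ((k + 1 : ℕ) : ℝ) = a + ((k + 1 : ℕ) : ℝ) + 1 by ring, h1]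
      push_cast
      ring
    have e3 := mul_kummerCoeff_add_one a (k + 1)
    have e4 : a * logTerm (a + 1) x (k + 1) = (a + ((k + 1 : ℕ) : ℝ)) * kummerCoeff a (k + 1)
        * x ^ (k + 1) * (psiCoeff (a + 1) (k + 1) + Real.log x) := by
      rw [logTerm, ← e3]; ring
    rw [e4, e2, logTerm, logTerm, logTerm, e1, psiCoeff_succ ha0, kummerCoeff_sub_one,
      kummerCoeff_succ]
    push_cast
    generalize psiCoeff a k = p
    generalize kummerCoeff a k = c
    rw [pow_succ]
    field_simp
    ring
  have key0 : (a - 2) * logTerm (a - 1) x 0 + a * logTerm (a + 1) x 0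
      = 1 / (a - 1) + (2 * a - 2) * logTerm a x 0 := by
    have h1 := psi_add_one (x := a) ha0
    have h2 := psi_add_one (x := a - 1) ham
    rw [sub_add_cancel] at h2
    simp only [logTerm, kummerCoeff_zero, psiCoeff, Nat.cast_zero, add_zero, pow_zero, mul_one,
      one_mul]
    rw [h1, h2]
    field_simp
    ring
  have hsum : (a - 2) * logSeries (a - 1) x + a * logSeries (a + 1) x
      = 1 / (a - 1) + (x + 2 * a - 2) * logSeries a x := by
    have h0 : logSeries a x = logTerm a x 0 + ∑' k, logTerm a x (k + 1) := hs0.tsum_eq_zero_add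
    have hm : logSeries (a - 1) x = logTerm (a - 1) x 0 + ∑' k, logTerm (a - 1) x (k + 1) :=
      hsm.tsum_eq_zero_add
    have hp : logSeries (a + 1) x = logTerm (a + 1) x 0 + ∑' k, logTerm (a + 1) x (k + 1) :=
      hsp.tsum_eq_zero_add
    have hs0' := (summable_nat_add_iff 1).2 hs0
    have hsm' := (summable_nat_add_iff 1).2 hsm
    have hsp' := (summable_nat_add_iff 1).2 hsp
    have ht := tsum_congr (L := SummationFilter.unconditional ℕ) key
    rw [(hsm'.mul_left _).tsum_add (hsp'.mul_left _), (hs0.mul_left _).tsum_add (hs0'.mul_left _),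
      tsum_mul_left, tsum_mul_left, tsum_mul_left, tsum_mul_left] at ht
    change _ = x * logSeries a x + _ at ht
    rw [hm, hp]
    linear_combination key0 + ht - (2 * a - 2) * h0
  simp only [kummerV]
  have hx0 := hx.ne'
  have e : (a - 1) * (1 / (a - 1)) = 1 := by field_simp
  have e' : x * (1 / x) = 1 := by field_simp
  linear_combination (a - 1) * hsum + e - e'

/-! ### Powers of `t / (1 + t)` and the weight dominating all integrals -/

/-- The function `t ↦ t / (1 + t)`, an increasing bijection from `(0, ∞)` onto `(0, 1)`. -/
noncomputable def ratio (t : ℝ) : ℝ := t / (1 + t)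

theorem ratio_pos {t : ℝ} (ht : 0 < t) : 0 < ratio t := by unfold ratio; positivity

theorem one_sub_ratio {t : ℝ} (ht : 0 < t) : 1 - ratio t = 1 / (1 + t) := by
  unfold ratio; field_simp; ring

theorem ratio_lt_one {t : ℝ} (ht : 0 < t) : ratio t < 1 := by
  have := one_sub_ratio ht
  have : 0 < 1 / (1 + t) := by positivity
  linarith

theorem measurable_ratio : Measurable ratio := by unfold ratio; fun_prop

@[fun_prop]
theorem measurable_ratio_rpow (p : ℝ) : Measurable fun t => ratio t ^ p :=
  measurable_ratio.pow_const p

theorem continuousAt_ratio {t : ℝ} (ht : 0 ≤ t) : ContinuousAt ratio t := by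
  unfold ratio
  exact continuousAt_id.div (by fun_prop) (by positivity)

theorem ratio_zero : ratio 0 = 0 := by simp [ratio]

theorem hasDerivAt_ratio {t : ℝ} (ht : 0 < t) : HasDerivAt ratio (1 / (1 + t) ^ 2) t := by
  have h := (hasDerivAt_id t).div ((hasDerivAt_id t).const_add 1) (by simp; positivity)
  refine h.congr_deriv ?_
  simp

theorem hasDerivAt_ratio_rpow (p : ℝ) {t : ℝ} (ht : 0 < t) :
    HasDerivAt (fun t => ratio t ^ p) (p * ratio t ^ (p - 1) / (1 + t) ^ 2) t := by
  refine ((hasDerivAt_ratio ht).rpow_const (Or.inl (ratio_pos ht).ne')).congr_deriv ?_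
  ring

theorem tendsto_ratio : Tendsto ratio atTop (𝓝 1) := by
  have h : Tendsto (fun t : ℝ => 1 - 1 / (1 + t)) atTop (𝓝 (1 - 0)) :=
    ((tendsto_atTop_add_const_left _ 1 tendsto_id).const_div_atTop 1).const_sub 1
  rw [sub_zero] at h
  refine h.congr' ?_
  filter_upwards [eventually_gt_atTop 0] with t ht
  rw [← one_sub_ratio ht]; ring

theorem tendsto_ratio_rpow (p : ℝ) : Tendsto (fun t => ratio t ^ p) atTop (𝓝 1) := by
  have := tendsto_ratio.rpow_const (p := p) (Or.inl one_ne_zero)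
  simpa using this

/-- The integrable weight `(t / (1 + t)) ^ p / (1 + t) ^ 2`, with `p > -1`. -/
noncomputable def weight (p t : ℝ) : ℝ := ratio t ^ p / (1 + t) ^ 2

theorem weight_nonneg (p : ℝ) {t : ℝ} (ht : 0 < t) : 0 ≤ weight p t := by
  unfold weight
  have := ratio_pos ht
  positivity

theorem integrableOn_weight {p : ℝ} (hp : -1 < p) : IntegrableOn (weight p) (Set.Ioi 0) := by
  have hp1 : p + 1 ≠ 0 := by linarith
  refine integrableOn_Ioi_deriv_of_nonneg (g := fun t => ratio t ^ (p + 1) / (p + 1))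
    (l := 1 / (p + 1)) ?_ ?_ ?_ ?_
  · refine ContinuousAt.continuousWithinAt ?_
    exact ((continuousAt_ratio le_rfl).rpow_const (Or.inr (by linarith))).div_const _
  · intro t ht
    refine ((hasDerivAt_ratio_rpow (p + 1) ht).div_const (p + 1)).congr_deriv ?_
    rw [weight, add_sub_cancel_right]
    field_simp
  · exact fun t ht => weight_nonneg p ht
  · exact (tendsto_ratio_rpow (p + 1)).div_const _

theorem ratio_rpow_anti {t : ℝ} (ht : 0 < t) {p q : ℝ} (h : p ≤ q) :
    ratio t ^ q ≤ ratio t ^ p :=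
  Real.rpow_le_rpow_of_exponent_ge (ratio_pos ht) (ratio_lt_one ht).le h

theorem abs_one_sub_ratio_rpow_le {p : ℝ} (hp : |p| ≤ 1) {t : ℝ} (ht : 0 < t) :
    |1 - ratio t ^ p| ≤ ratio t ^ (-|p|) / (1 + t) := by
  have h0 := ratio_pos ht
  have h1 := ratio_lt_one ht
  have key : ∀ q : ℝ, 0 ≤ q → q ≤ 1 → 0 ≤ 1 - ratio t ^ q ∧ 1 - ratio t ^ q ≤ 1 / (1 + t) := by
    intro q hq hq1
    rw [← one_sub_ratio ht]
    refine ⟨sub_nonneg.2 (Real.rpow_le_one h0.le h1.le hq), ?_⟩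
    have := ratio_rpow_anti ht hq1
    rw [Real.rpow_one] at this
    linarith
  have hbig : 1 ≤ ratio t ^ (-|p|) := Real.one_le_rpow_of_pos_of_le_one_of_nonpos h0 h1.le
    (neg_nonpos.2 (abs_nonneg p))
  obtain ⟨k0, k1⟩ := key |p| (abs_nonneg p) hp
  rcases le_total 0 p with hp0 | hp0
  · rw [abs_of_nonneg hp0] at *
    rw [abs_of_nonneg k0]
    refine k1.trans ?_
    gcongr
  · rw [abs_of_nonpos hp0] at *
    rw [neg_neg] at *
    have e : 1 - ratio t ^ p = -(ratio t ^ p * (1 - ratio t ^ (-p))) := by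
      rw [mul_sub, ← Real.rpow_add h0]; simp
    rw [e, abs_neg, abs_of_nonneg (mul_nonneg (by positivity) k0), ← mul_one_div]
    gcongr

/-- Exponential decay beats the quadratic denominator of the weight. -/
theorem exists_exp_neg_mul_le {c : ℝ} (hc : 0 < c) :
    ∃ C, 0 ≤ C ∧ ∀ t : ℝ, 0 ≤ t → Real.exp (-c * t) ≤ C / (1 + t) ^ 2 := by
  set m := min 1 (c / 2) with hm
  have hm0 : 0 < m := lt_min one_pos (by positivity)
  refine ⟨1 / m ^ 2, by positivity, fun t ht => ?_⟩
  have h1 : m * (1 + t) ≤ Real.exp (c / 2 * t) := by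
    refine le_trans ?_ (Real.add_one_le_exp _)
    have a1 : m ≤ 1 := min_le_left _ _
    have a2 : m ≤ c / 2 := min_le_right _ _
    nlinarith
  have h2 : (m * (1 + t)) ^ 2 ≤ Real.exp (c * t) := by
    calc (m * (1 + t)) ^ 2 ≤ Real.exp (c / 2 * t) ^ 2 := by gcongr
      _ = Real.exp (c * t) := by rw [← Real.exp_nat_mul]; congr 1; push_cast; ring
  rw [neg_mul, Real.exp_neg, div_div, ← mul_pow, ← one_div]
  exact one_div_le_one_div_of_le (by positivity) h2

theorem integrableOn_exp_mul_ratio_rpow {c p : ℝ} (hc : 0 < c) (hp : -1 < p) :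
    IntegrableOn (fun t => Real.exp (-c * t) * ratio t ^ p) (Set.Ioi 0) := by
  obtain ⟨C, hC, h⟩ := exists_exp_neg_mul_le hc
  refine Integrable.mono' ((integrableOn_weight hp).const_mul C) ?_ ?_
  · exact Measurable.aestronglyMeasurable (by fun_prop)
  · filter_upwards [ae_restrict_mem measurableSet_Ioi] with t ht
    have ht0 : 0 < t := ht
    have hr := ratio_pos ht0
    rw [Real.norm_eq_abs, abs_of_nonneg (by positivity), weight]
    calc Real.exp (-c * t) * ratio t ^ p ≤ C / (1 + t) ^ 2 * ratio t ^ p := by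
          gcongr; exact h t ht0.le
      _ = C * (ratio t ^ p / (1 + t) ^ 2) := by ring

/-! ### The Laplace integrals solving Kummer's equation -/

/-- The Laplace transform of `(t / (1 + t)) ^ p * f t`. -/
noncomputable def laplaceRatio (p : ℝ) (f : ℝ → ℝ) (x : ℝ) : ℝ :=
  ∫ t in Set.Ioi (0 : ℝ), Real.exp (-x * t) * ratio t ^ p * f t

theorem integrableOn_laplaceRatio {p x : ℝ} (hp : -1 < p) (hx : 0 < x) {f : ℝ → ℝ}
    (hf : Measurable f) (hf1 : ∀ t, 0 < t → |f t| ≤ 1) :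
    IntegrableOn (fun t => Real.exp (-x * t) * ratio t ^ p * f t) (Set.Ioi 0) := by
  refine Integrable.mono' (integrableOn_exp_mul_ratio_rpow hx hp) ?_ ?_
  · exact Measurable.aestronglyMeasurable (by fun_prop)
  · filter_upwards [ae_restrict_mem measurableSet_Ioi] with t ht
    have ht0 : 0 < t := ht
    have hr := ratio_pos ht0
    rw [norm_mul, Real.norm_eq_abs, Real.norm_eq_abs, abs_of_nonneg (by positivity)]
    exact mul_le_of_le_one_right (by positivity) (hf1 t ht0)

theorem hasDerivAt_laplaceRatio {p x : ℝ} (hp : -1 < p) (hx : 0 < x) {f : ℝ → ℝ}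
    (hf : Measurable f) (hf1 : ∀ t, 0 < t → |f t| ≤ 1) :
    IntegrableOn (fun t => -t * (Real.exp (-x * t) * ratio t ^ p * f t)) (Set.Ioi 0) ∧
    HasDerivAt (laplaceRatio p f)
      (∫ t in Set.Ioi (0 : ℝ), -t * (Real.exp (-x * t) * ratio t ^ p * f t)) x := by
  have hx4 : 0 < x / 4 := by positivity
  refine hasDerivAt_integral_of_dominated_loc_of_deriv_le (s := Set.Ioi (x / 2))
    (F := fun x t => Real.exp (-x * t) * ratio t ^ p * f t)
    (F' := fun x t => -t * (Real.exp (-x * t) * ratio t ^ p * f t)) (x₀ := x)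
    (μ := volume.restrict (Set.Ioi 0))
    (bound := fun t => 4 / x * (Real.exp (-(x / 4) * t) * ratio t ^ p))
    (Ioi_mem_nhds (by linarith)) ?_ (integrableOn_laplaceRatio hp hx hf hf1) ?_ ?_ ?_ ?_
  · exact Eventually.of_forall fun y => Measurable.aestronglyMeasurable (by fun_prop)
  · exact Measurable.aestronglyMeasurable (by fun_prop)
  · filter_upwards [ae_restrict_mem measurableSet_Ioi] with t ht y hy
    have ht0 : 0 < t := ht
    have hy0 : x / 2 < y := hy
    have hr := ratio_pos ht0
    rw [norm_mul, norm_mul, norm_neg, Real.norm_eq_abs, Real.norm_eq_abs, Real.norm_eq_abs,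
      abs_of_pos ht0, abs_of_nonneg (by positivity : 0 ≤ Real.exp (-y * t) * ratio t ^ p)]
    have h1 : Real.exp (-y * t) ≤ Real.exp (-(x / 4) * t) * Real.exp (-(x / 4) * t) := by
      rw [← Real.exp_add]
      apply Real.exp_le_exp.2
      nlinarith
    have h2 : t * Real.exp (-(x / 4) * t) ≤ 4 / x := by
      have h3 := Real.add_one_le_exp (x / 4 * t)
      rw [neg_mul, Real.exp_neg, ← div_eq_mul_inv, div_le_iff₀ (Real.exp_pos _)]
      calc t = 4 / x * (x / 4 * t) := by field_simp
        _ ≤ 4 / x * Real.exp (x / 4 * t) := by gcongr; linarith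
    calc t * (Real.exp (-y * t) * ratio t ^ p * |f t|)
        ≤ t * ((Real.exp (-(x / 4) * t) * Real.exp (-(x / 4) * t)) * ratio t ^ p * 1) := by
          gcongr; exact hf1 t ht0
      _ = t * Real.exp (-(x / 4) * t) * (Real.exp (-(x / 4) * t) * ratio t ^ p) := by ring
      _ ≤ 4 / x * (Real.exp (-(x / 4) * t) * ratio t ^ p) := by gcongr
  · exact (integrableOn_exp_mul_ratio_rpow hx4 hp).const_mul _
  · refine Eventually.of_forall fun t y _ => ?_
    have h := ((((hasDerivAt_id y).neg.mul_const t).exp).mul_const (ratio t ^ p)).mul_const (f t)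
    refine h.congr_deriv ?_
    simp only [Pi.neg_apply, id]
    ring

/-- The Laplace integral `∫ e^{-xt} (t/(1+t))^{a-1} dt`, classically `Γ(a) U(a, 2, x)`. -/
noncomputable def kummerI (a : ℝ) : ℝ → ℝ := laplaceRatio (a - 1) fun _ => 1

/-- The Laplace integral `∫ e^{-xt} (t/(1+t))^{a-1} dt/(1+t)`, classically `Γ(a) U(a, 1, x)`. -/
noncomputable def kummerJ (a : ℝ) : ℝ → ℝ := laplaceRatio (a - 1) fun t => (1 + t)⁻¹

theorem abs_inv_one_add_le {t : ℝ} (ht : 0 < t) : |(1 + t)⁻¹| ≤ 1 := by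
  rw [abs_of_nonneg (by positivity)]
  exact inv_le_one_of_one_le₀ (by linarith)

theorem hasDerivAt_kummerJ {a x : ℝ} (ha : 0 < a) (hx : 0 < x) :
    HasDerivAt (kummerJ a) (kummerJ a x - kummerI a x) x := by
  have hp : -1 < a - 1 := by linarith
  refine (hasDerivAt_laplaceRatio hp hx (f := fun t => (1 + t)⁻¹) (by fun_prop)
    fun t ht => abs_inv_one_add_le ht).2.congr_deriv ?_
  rw [kummerJ, kummerI, laplaceRatio, laplaceRatio, ← integral_sub]
  · refine setIntegral_congr_fun measurableSet_Ioi fun t ht => ?_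
    have ht0 : 0 < t := ht
    field_simp
    ring
  · exact integrableOn_laplaceRatio hp hx (by fun_prop) fun t ht => abs_inv_one_add_le ht
  · exact integrableOn_laplaceRatio hp hx (by fun_prop) (by simp)

theorem tendsto_one_add_mul_exp {x : ℝ} (hx : 0 < x) :
    Tendsto (fun t : ℝ => (1 + t) * Real.exp (-x * t)) atTop (𝓝 0) := by
  have h1 : Tendsto (fun t : ℝ => t ^ 1 * Real.exp (-t)) atTop (𝓝 0) :=
    Real.tendsto_pow_mul_exp_neg_atTop_nhds_zero 1
  have h2 := h1.comp (tendsto_id.const_mul_atTop hx)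
  have h3 := (Real.tendsto_exp_neg_atTop_nhds_zero).comp (tendsto_id.const_mul_atTop hx)
  have h := h3.add (h2.const_mul (1 / x))
  rw [mul_zero, add_zero] at h
  refine h.congr fun t => ?_
  simp only [Function.comp_apply, id, pow_one, neg_mul]
  field_simp

theorem hasDerivAt_mul_kummerI {a x : ℝ} (ha : 0 < a) (hx : 0 < x) :
    HasDerivAt (fun x => x * kummerI a x) (-((a - 1) * kummerJ a x)) x := by
  have hp : -1 < a - 1 := by linarith
  obtain ⟨hint, hder⟩ := hasDerivAt_laplaceRatio hp hx (f := fun _ => 1) (by fun_prop) (by simp)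
  refine ((hasDerivAt_id x).mul hder).congr_deriv ?_
  have hI := integrableOn_laplaceRatio hp hx (f := fun _ => 1) (by fun_prop) (by simp)
  have hJ := integrableOn_laplaceRatio hp hx (f := fun t => (1 + t)⁻¹) (by fun_prop)
    fun t ht => abs_inv_one_add_le ht
  -- The boundary term `(1 + t) e^{-xt} (t / (1 + t)) ^ a` vanishes at both ends.
  have hF : ∀ t ∈ Set.Ioi (0 : ℝ),
      HasDerivAt (fun t => (1 + t) * Real.exp (-x * t) * ratio t ^ a)
      (Real.exp (-x * t) * ratio t ^ (a - 1) * 1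
        + x * (-t * (Real.exp (-x * t) * ratio t ^ (a - 1) * 1))
        + (a - 1) * (Real.exp (-x * t) * ratio t ^ (a - 1) * (1 + t)⁻¹)) t := by
    intro t ht
    have ht0 : 0 < t := ht
    have h := ((((hasDerivAt_id t).const_add 1).mul
      (((hasDerivAt_id t).const_mul (-x)).exp)).mul (hasDerivAt_ratio_rpow a ht0))
    refine h.congr_deriv ?_
    have e : ratio t ^ a = ratio t ^ (a - 1) * (t / (1 + t)) := by
      rw [Real.rpow_sub_one (ratio_pos ht0).ne', ← ratio, div_mul_cancel₀]
      exact (ratio_pos ht0).ne'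
    simp only [Pi.mul_apply, id, mul_one, one_mul]
    rw [e]
    field_simp
    ring
  have hzero := integral_Ioi_of_hasDerivAt_of_tendsto (m := 0)
    (f := fun t => (1 + t) * Real.exp (-x * t) * ratio t ^ a) ?_ hF
    ((hI.add (hint.const_mul x)).add (hJ.const_mul (a - 1))) ?_
  · have hI1 : IntegrableOn (fun t => Real.exp (-x * t) * ratio t ^ (a - 1) * 1
        + x * (-t * (Real.exp (-x * t) * ratio t ^ (a - 1) * 1))) (Set.Ioi 0) :=
      hI.add (hint.const_mul x)
    rw [integral_add hI1 (hJ.const_mul (a - 1)), integral_add hI (hint.const_mul x),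
      integral_const_mul, integral_const_mul, ratio_zero, Real.zero_rpow ha.ne'] at hzero
    simp only [id, one_mul, kummerJ, laplaceRatio]
    linarith
  · refine ContinuousAt.continuousWithinAt ?_
    exact ContinuousAt.mul (by fun_prop)
      ((continuousAt_ratio le_rfl).rpow_const (Or.inr ha.le))
  · simpa using (tendsto_one_add_mul_exp hx).mul (tendsto_ratio_rpow a)

/-! ### Behaviour of the Laplace integrals at the origin -/

theorem integral_exp_neg_mul_Ioi {x : ℝ} (hx : 0 < x) :
    ∫ t in Set.Ioi (0 : ℝ), Real.exp (-x * t) = 1 / x := by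
  rw [integral_exp_mul_Ioi (by linarith : -x < 0)]
  simp

theorem integrableOn_exp_neg_mul_Ioi {x : ℝ} (hx : 0 < x) :
    IntegrableOn (fun t => Real.exp (-x * t)) (Set.Ioi 0) :=
  integrableOn_exp_mul_Ioi (by linarith) 0

/-- The substitution `s = t / (1 + t)`. -/
theorem integral_Ioo_eq_integral_ratio (g : ℝ → ℝ) :
    ∫ s in Set.Ioo (0 : ℝ) 1, g s = ∫ t in Set.Ioi (0 : ℝ), 1 / (1 + t) ^ 2 * g (ratio t) := by
  have himg : ratio '' Set.Ioi 0 = Set.Ioo 0 1 := by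
    ext s
    constructor
    · rintro ⟨t, ht, rfl⟩
      exact ⟨ratio_pos ht, ratio_lt_one ht⟩
    · rintro ⟨h0, h1⟩
      have h2 : 0 < 1 - s := by linarith
      refine ⟨s / (1 - s), div_pos h0 h2, ?_⟩
      rw [ratio]
      field_simp
      ring
  have hinj : Set.InjOn ratio (Set.Ioi 0) := by
    intro s hs t ht h
    have hs0 : 0 < s := hs
    have ht0 : 0 < t := ht
    have e : 1 / (1 + s) = 1 / (1 + t) := by rw [← one_sub_ratio hs0, ← one_sub_ratio ht0, h]
    field_simp at e
    linarith
  rw [← himg, integral_image_eq_integral_abs_deriv_smul measurableSet_Ioi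
    (fun t ht => (hasDerivAt_ratio ht).hasDerivWithinAt) hinj]
  refine setIntegral_congr_fun measurableSet_Ioi fun t ht => ?_
  simp only [smul_eq_mul]
  rw [abs_of_nonneg (by positivity)]

theorem beta_eq_integral_Ioo {a b : ℝ} (ha : 0 < a) (hb : 0 < b) :
    Real.Gamma a * Real.Gamma b / Real.Gamma (a + b)
      = ∫ s in Set.Ioo (0 : ℝ) 1, s ^ (a - 1) * (1 - s) ^ (b - 1) := by
  have h := ProbabilityTheory.beta_eq_betaIntegralReal a b ha hb
  rw [ProbabilityTheory.beta] at h
  rw [h, Complex.betaIntegral, intervalIntegral.integral_of_le zero_le_one,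
    integral_Ioc_eq_integral_Ioo]
  rw [← Complex.ofReal_re (∫ s in Set.Ioo (0 : ℝ) 1, s ^ (a - 1) * (1 - s) ^ (b - 1)),
    ← integral_complex_ofReal]
  congr 1
  refine setIntegral_congr_fun measurableSet_Ioo fun s hs => ?_
  have h1 : 0 ≤ 1 - s := by linarith [hs.2]
  rw [Complex.ofReal_mul, Complex.ofReal_cpow hs.1.le, Complex.ofReal_cpow h1]
  push_cast
  rfl

theorem neg_one_lt_neg_abs_sub_one {a : ℝ} (ha : 0 < a) (ha2 : a < 2) : -1 < -|a - 1| := by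
  rw [neg_lt_neg_iff, abs_lt]
  constructor <;> linarith

theorem abs_one_sub_ratio_rpow_div_le {p : ℝ} (hp : |p| ≤ 1) {t : ℝ} (ht : 0 < t) :
    |(1 - ratio t ^ p) / (1 + t)| ≤ weight (-|p|) t := by
  rw [abs_div, abs_of_pos (by positivity : 0 < 1 + t), weight, pow_two, ← div_div]
  gcongr
  exact abs_one_sub_ratio_rpow_le hp ht

/-- Gauss' integral for the digamma function, obtained by removing the pole of the beta integral
`B(a, ε)` as `ε` tends to `0`. -/
theorem integral_one_sub_ratio_rpow_div {a : ℝ} (ha : 0 < a) (ha2 : a < 2) :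
    ∫ t in Set.Ioi (0 : ℝ), (1 - ratio t ^ (a - 1)) / (1 + t) = psi a - psi 1 := by
  have hp := neg_one_lt_neg_abs_sub_one ha ha2
  have hp1 : |a - 1| ≤ 1 := by linarith
  -- The factor `(1 + t) ^ (-ε)` makes both parts integrable. The integral of the first is `1 / ε`,
  -- that of the second is `B(a, ε)`, and their difference is a difference quotient at `ε = 0`.
  set F : ℝ → ℝ → ℝ := fun ε t => (1 - ratio t ^ (a - 1)) / (1 + t) * (1 + t) ^ (-ε) with hF
  have hmeas : ∀ ε, AEStronglyMeasurable (F ε) (volume.restrict (Set.Ioi 0)) := fun ε => by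
    refine Measurable.aestronglyMeasurable ?_
    have : Measurable fun t : ℝ => (1 + t) ^ (-ε) := (measurable_const.add measurable_id).pow_const _
    fun_prop
  have hbound : ∀ ε, 0 < ε → ∀ᵐ t ∂volume.restrict (Set.Ioi (0 : ℝ)),
      ‖F ε t‖ ≤ weight (-|a - 1|) t := by
    intro ε hε
    filter_upwards [ae_restrict_mem measurableSet_Ioi] with t ht
    have ht0 : 0 < t := ht
    rw [hF, norm_mul, Real.norm_eq_abs, Real.norm_eq_abs]
    have h2 : |(1 + t) ^ (-ε)| ≤ 1 := by
      rw [abs_of_nonneg (by positivity)]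
      exact Real.rpow_le_one_of_one_le_of_nonpos (by linarith) (by linarith)
    calc _ ≤ weight (-|a - 1|) t * 1 :=
          mul_le_mul (abs_one_sub_ratio_rpow_div_le hp1 ht0) h2 (abs_nonneg _)
            (weight_nonneg _ ht0)
      _ = _ := mul_one _
  have hlim : Tendsto (fun ε => ∫ t in Set.Ioi (0 : ℝ), F ε t) (𝓝[>] 0)
      (𝓝 (∫ t in Set.Ioi (0 : ℝ), (1 - ratio t ^ (a - 1)) / (1 + t))) := by
    refine tendsto_integral_filter_of_dominated_convergence (weight (-|a - 1|))
      (Eventually.of_forall hmeas) ?_ (integrableOn_weight hp) ?_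
    · filter_upwards [self_mem_nhdsWithin] with ε hε using hbound ε hε
    · filter_upwards [ae_restrict_mem measurableSet_Ioi] with t ht
      have ht0 : 0 < t := ht
      have h1 : Tendsto (fun ε : ℝ => (1 + t) ^ (-ε)) (𝓝 0) (𝓝 ((1 + t) ^ (-(0 : ℝ)))) :=
        (Real.continuousAt_const_rpow (by positivity : (1 + t) ≠ 0)).comp_of_eq
          continuous_neg.continuousAt rfl
      have h2 := (h1.const_mul ((1 - ratio t ^ (a - 1)) / (1 + t)))
      rw [neg_zero, Real.rpow_zero, mul_one] at h2
      exact h2.mono_left nhdsWithin_le_nhds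
  have heq : ∀ ε, 0 < ε → ∫ t in Set.Ioi (0 : ℝ), F ε t
      = ε⁻¹ • -(Real.Gamma a * Real.Gamma (1 + ε) / Real.Gamma (a + ε)
        - Real.Gamma a * Real.Gamma (1 + 0) / Real.Gamma (a + 0)) := by
    intro ε hε
    have hone : IntegrableOn (fun t : ℝ => (t + 1) ^ (-(1 + ε))) (Set.Ioi 0) :=
      integrableOn_add_rpow_Ioi_of_lt (by linarith) (by norm_num)
    have hone' : ∫ t in Set.Ioi (0 : ℝ), (t + 1) ^ (-(1 + ε)) = 1 / ε := by
      have h := (measurePreserving_add_right (volume : Measure ℝ) 1).setIntegral_preimage_emb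
        (measurableEmbedding_addRight 1) (fun t : ℝ => t ^ (-(1 + ε))) (Set.Ioi 1)
      rw [Set.preimage_add_const_Ioi, sub_self] at h
      rw [h, integral_Ioi_rpow_of_lt (by linarith) one_pos, Real.one_rpow,
        show -(1 + ε) + 1 = -ε by ring, neg_div_neg_eq]
    have hbeta := beta_eq_integral_Ioo ha hε
    rw [integral_Ioo_eq_integral_ratio] at hbeta
    have hFε : IntegrableOn (F ε) (Set.Ioi 0) :=
      (integrableOn_weight hp).mono' (hmeas ε) (hbound ε hε)
    have hdiff : ∫ t in Set.Ioi (0 : ℝ), ((t + 1) ^ (-(1 + ε)) - F ε t)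
        = Real.Gamma a * Real.Gamma ε / Real.Gamma (a + ε) := by
      rw [hbeta]
      refine setIntegral_congr_fun measurableSet_Ioi fun t ht => ?_
      have ht0 : 0 < t := ht
      have h1 : 0 < 1 + t := by positivity
      simp only [hF]
      rw [one_sub_ratio ht0, one_div (1 + t), Real.inv_rpow h1.le, ← Real.rpow_neg h1.le,
        add_comm t 1, show -(1 + ε) = -ε - 1 by ring, show -(ε - 1) = -ε + 1 by ring,
        Real.rpow_sub_one h1.ne', Real.rpow_add_one h1.ne']
      field_simp
      ring
    rw [integral_sub hone hFε, hone'] at hdiff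
    have hG1 : Real.Gamma (1 + ε) = ε * Real.Gamma ε := by
      rw [add_comm, Real.Gamma_add_one hε.ne']
    have hGa : Real.Gamma a ≠ 0 := (Real.Gamma_pos_of_pos ha).ne'
    have hGa' : Real.Gamma (a + ε) ≠ 0 := (Real.Gamma_pos_of_pos (by linarith)).ne'
    rw [add_zero, add_zero, Real.Gamma_one, hG1, smul_eq_mul,
      show ∫ t in Set.Ioi (0 : ℝ), F ε t
        = 1 / ε - Real.Gamma a * Real.Gamma ε / Real.Gamma (a + ε) by linarith]
    field_simp
    ring
  have hpole : ∀ b : ℝ, 0 < b → ∀ m : ℕ, b ≠ -m := fun b hb m h => by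
    have : (0 : ℝ) ≤ m := Nat.cast_nonneg m
    linarith
  have hder : HasDerivAt
      (fun ε => -(Real.Gamma a * Real.Gamma (1 + ε) / Real.Gamma (a + ε))) (psi a - psi 1) 0 := by
    have h1 : HasDerivAt (fun ε => Real.Gamma (1 + ε)) (deriv Real.Gamma 1) 0 := by
      have := (Real.differentiableAt_Gamma (hpole 1 one_pos)).hasDerivAt
      exact HasDerivAt.comp_const_add 1 0 (by simpa using this)
    have h2 : HasDerivAt (fun ε => Real.Gamma (a + ε)) (deriv Real.Gamma a) 0 := by
      have := (Real.differentiableAt_Gamma (hpole a ha)).hasDerivAt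
      exact HasDerivAt.comp_const_add a 0 (by simpa using this)
    have hGa : Real.Gamma a ≠ 0 := (Real.Gamma_pos_of_pos ha).ne'
    have h := ((h1.const_mul (Real.Gamma a)).div h2 (by simpa using hGa)).neg
    refine h.congr_deriv ?_
    rw [psi, psi, logDeriv_apply, logDeriv_apply, add_zero, add_zero, Real.Gamma_one]
    field_simp
    ring
  have hslope := hder.tendsto_slope_zero_right
  refine tendsto_nhds_unique hlim (hslope.congr' ?_)
  filter_upwards [self_mem_nhdsWithin] with ε hε
  rw [heq ε hε, zero_add]
  congr 1
  ring

theorem integrableOn_log_mul_exp :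
    IntegrableOn (fun v : ℝ => (|Real.log v| + v) * Real.exp (-v)) (Set.Ioi 0) := by
  have h1 : IntegrableOn (fun v : ℝ => Real.exp (-v) * v ^ ((1 / 2 : ℝ) - 1)) (Set.Ioi 0) :=
    Real.GammaIntegral_convergent (by norm_num)
  have h2 : IntegrableOn (fun v : ℝ => Real.exp (-v) * v ^ ((2 : ℝ) - 1)) (Set.Ioi 0) :=
    Real.GammaIntegral_convergent (by norm_num)
  refine ((h1.const_mul 2).add (h2.const_mul 2)).mono' ?_ ?_
  · exact Measurable.aestronglyMeasurable (by fun_prop)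
  · filter_upwards [ae_restrict_mem measurableSet_Ioi] with v hv
    have hv0 : 0 < v := hv
    rw [Real.norm_eq_abs, abs_of_nonneg (by positivity)]
    have e1 : Real.log v ≤ v := (Real.log_le_sub_one_of_pos hv0).trans (by linarith)
    have e2 : -Real.log v ≤ 2 * v ^ ((1 / 2 : ℝ) - 1) := by
      have := Real.log_le_rpow_div (inv_nonneg.2 hv0.le) (by norm_num : (0 : ℝ) < 1 / 2)
      rw [Real.log_inv, Real.inv_rpow hv0.le, ← Real.rpow_neg hv0.le] at this
      norm_num at this ⊢
      linarith
    have e0 : 0 ≤ v ^ ((1 / 2 : ℝ) - 1) := by positivity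
    have e3 : |Real.log v| ≤ 2 * v ^ ((1 / 2 : ℝ) - 1) + v := by
      rw [abs_le]; constructor <;> linarith
    have e4 : v ^ ((2 : ℝ) - 1) = v := by norm_num
    simp only [Pi.add_apply]
    rw [e4]
    have := Real.exp_pos (-v)
    nlinarith

/-- The integral is `Γ'(1)`, and `Γ 1 = 1`. -/
theorem integral_log_mul_exp : ∫ v in Set.Ioi (0 : ℝ), Real.log v * Real.exp (-v) = psi 1 := by
  have h1 := Complex.hasDerivAt_GammaIntegral (s := 1) (by simp)
  have h2 : HasDerivAt Complex.Gamma (∫ t : ℝ in Set.Ioi 0,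
      (t : ℂ) ^ ((1 : ℂ) - 1) * (Real.log t * Real.exp (-t))) 1 := by
    refine h1.congr_of_eventuallyEq ?_
    have : ∀ᶠ s : ℂ in 𝓝 1, 0 < s.re :=
      Complex.continuous_re.continuousAt.eventually (Ioi_mem_nhds (by simp))
    filter_upwards [this] with s hs using Complex.Gamma_eq_integral hs
  have h3 := h2.unique Complex.hasDerivAt_Gamma_one
  rw [psi_one]
  apply Complex.ofReal_injective
  push_cast
  rw [← h3, ← integral_complex_ofReal]
  refine setIntegral_congr_fun measurableSet_Ioi fun t ht => ?_
  simp

theorem abs_log_add_le {x v : ℝ} (hx : 0 < x) (hx1 : x ≤ 1) (hv : 0 < v) :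
    |Real.log (x + v)| ≤ |Real.log v| + v := by
  rw [abs_le]
  constructor
  · have h1 : Real.log v ≤ Real.log (x + v) := Real.log_le_log hv (by linarith)
    have h2 := neg_abs_le (Real.log v)
    linarith
  · have h1 := Real.log_le_sub_one_of_pos (by positivity : 0 < x + v)
    have h2 := abs_nonneg (Real.log v)
    linarith

/-- Integration by parts followed by the substitution `v = x t`; the right-hand side has an evident
limit as `x` tends to `0`. -/
theorem integral_exp_div_one_add_add_log {x : ℝ} (hx : 0 < x) (hx1 : x ≤ 1) :
    (∫ t in Set.Ioi (0 : ℝ), Real.exp (-x * t) * (1 + t)⁻¹) + Real.log x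
      = ∫ v in Set.Ioi (0 : ℝ), Real.log (x + v) * Real.exp (-v) := by
  have hlog : ∀ t : ℝ, 0 < t → 0 ≤ Real.log (1 + t) ∧ Real.log (1 + t) ≤ 1 + t := fun t ht =>
    ⟨Real.log_nonneg (by linarith), (Real.log_le_sub_one_of_pos (by positivity)).trans (by linarith)⟩
  have hint1 : IntegrableOn (fun v => Real.log (x + v) * Real.exp (-v)) (Set.Ioi 0) := by
    refine integrableOn_log_mul_exp.mono' ?_ ?_
    · exact Measurable.aestronglyMeasurable (by fun_prop)
    · filter_upwards [ae_restrict_mem measurableSet_Ioi] with v hv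
      rw [norm_mul, Real.norm_eq_abs, Real.norm_eq_abs, abs_of_pos (Real.exp_pos _)]
      gcongr
      exact abs_log_add_le hx hx1 hv
  have hint2 : IntegrableOn (fun v => Real.log x * Real.exp (-v)) (Set.Ioi 0) :=
    (integrableOn_exp_neg_Ioi 0).const_mul _
  have hsplit : ∀ v ∈ Set.Ioi (0 : ℝ), Real.log (x + v) * Real.exp (-v) - Real.log x * Real.exp (-v)
      = Real.log (1 + x⁻¹ * v) * Real.exp (-v) := by
    intro v hv
    have hv0 : 0 < v := hv
    rw [show 1 + x⁻¹ * v = (x + v) / x by field_simp, Real.log_div (by positivity) hx.ne']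
    ring
  have hint3 : IntegrableOn (fun v => Real.log (1 + x⁻¹ * v) * Real.exp (-v)) (Set.Ioi 0) :=
    (hint1.sub hint2).congr_fun hsplit measurableSet_Ioi
  have hint4 : IntegrableOn (fun t => Real.log (1 + t) * Real.exp (-x * t)) (Set.Ioi 0) := by
    have h := (integrableOn_Ioi_comp_mul_left_iff
      (fun v => Real.log (1 + x⁻¹ * v) * Real.exp (-v)) 0 hx).2 (by simpa using hint3)
    refine h.congr_fun (fun t _ => ?_) measurableSet_Ioi
    simp only
    rw [inv_mul_cancel_left₀ hx.ne', neg_mul]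
  have hscale : x * ∫ t in Set.Ioi (0 : ℝ), Real.log (1 + t) * Real.exp (-x * t)
      = ∫ v in Set.Ioi (0 : ℝ), Real.log (1 + x⁻¹ * v) * Real.exp (-v) := by
    have h := integral_comp_mul_left_Ioi' (fun v => Real.log (1 + x⁻¹ * v) * Real.exp (-v)) 0 hx
    rw [mul_zero] at h
    rw [← h, smul_eq_mul]
    congr 1
    refine setIntegral_congr_fun measurableSet_Ioi fun t _ => ?_
    rw [inv_mul_cancel_left₀ hx.ne', neg_mul]
  have hparts : ∫ t in Set.Ioi (0 : ℝ), Real.exp (-x * t) * (1 + t)⁻¹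
      = x * ∫ t in Set.Ioi (0 : ℝ), Real.log (1 + t) * Real.exp (-x * t) := by
    have hE : IntegrableOn (fun t => Real.exp (-x * t) * (1 + t)⁻¹) (Set.Ioi 0) := by
      refine (integrableOn_exp_neg_mul_Ioi hx).mono' ?_ ?_
      · exact Measurable.aestronglyMeasurable (by fun_prop)
      · filter_upwards [ae_restrict_mem measurableSet_Ioi] with t ht
        rw [norm_mul, Real.norm_eq_abs, Real.norm_eq_abs, abs_of_pos (Real.exp_pos _)]
        exact mul_le_of_le_one_right (Real.exp_pos _).le (abs_inv_one_add_le ht)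
    have h := integral_Ioi_of_hasDerivAt_of_tendsto (a := 0) (m := 0)
      (f := fun t => Real.log (1 + t) * Real.exp (-x * t))
      (f' := fun t => Real.exp (-x * t) * (1 + t)⁻¹
        - x * (Real.log (1 + t) * Real.exp (-x * t))) ?_ ?_ (hE.sub (hint4.const_mul x)) ?_
    · rw [integral_sub hE (hint4.const_mul x), integral_const_mul] at h
      simp only [add_zero, Real.log_one, zero_mul, sub_zero] at h
      linarith
    · refine ContinuousAt.continuousWithinAt (ContinuousAt.mul ?_ (by fun_prop))
      exact (Real.continuousAt_log (by norm_num)).comp_of_eq (by fun_prop) rfl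
    · intro t ht
      have ht0 : 0 < t := ht
      have h1 := (((hasDerivAt_id t).const_add 1).log (by simp; positivity)).mul
        (((hasDerivAt_id t).const_mul (-x)).exp)
      refine h1.congr_deriv ?_
      simp only [id]
      ring
    · refine squeeze_zero' ?_ ?_ (tendsto_one_add_mul_exp hx)
      · filter_upwards [eventually_gt_atTop 0] with t ht
        exact mul_nonneg (hlog t ht).1 (Real.exp_pos _).le
      · filter_upwards [eventually_gt_atTop 0] with t ht
        have := (hlog t ht).2
        gcongr
  rw [hparts, hscale, ← setIntegral_congr_fun measurableSet_Ioi hsplit, integral_sub hint1 hint2,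
    integral_const_mul, integral_exp_neg_Ioi_zero]
  ring

theorem tendsto_integral_exp_div_one_add_add_log :
    Tendsto (fun x => (∫ t in Set.Ioi (0 : ℝ), Real.exp (-x * t) * (1 + t)⁻¹) + Real.log x)
      (𝓝[>] 0) (𝓝 (psi 1)) := by
  have hlim : Tendsto (fun x => ∫ v in Set.Ioi (0 : ℝ), Real.log (x + v) * Real.exp (-v)) (𝓝[>] 0)
      (𝓝 (∫ v in Set.Ioi (0 : ℝ), Real.log v * Real.exp (-v))) := by
    refine tendsto_integral_filter_of_dominated_convergence
      (fun v => (|Real.log v| + v) * Real.exp (-v)) ?_ ?_ integrableOn_log_mul_exp ?_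
    · exact Eventually.of_forall fun x => Measurable.aestronglyMeasurable (by fun_prop)
    · filter_upwards [Ioc_mem_nhdsGT one_pos] with x hx
      filter_upwards [ae_restrict_mem measurableSet_Ioi] with v hv
      rw [norm_mul, Real.norm_eq_abs, Real.norm_eq_abs, abs_of_pos (Real.exp_pos _)]
      gcongr
      exact abs_log_add_le hx.1 hx.2 hv
    · filter_upwards [ae_restrict_mem measurableSet_Ioi] with v hv
      have hv0 : v ≠ 0 := ne_of_gt hv
      have h : Tendsto (fun x : ℝ => Real.log (x + v)) (𝓝 0) (𝓝 (Real.log v)) :=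
        (Real.continuousAt_log hv0).tendsto.comp (by
          have : Continuous fun x : ℝ => x + v := by fun_prop
          simpa using this.tendsto 0)
      exact (h.mono_left nhdsWithin_le_nhds).mul_const _
  rw [integral_log_mul_exp] at hlim
  refine hlim.congr' ?_
  filter_upwards [Ioc_mem_nhdsGT one_pos] with x hx
  exact (integral_exp_div_one_add_add_log hx.1 hx.2).symm

/-- The Laplace integral has the same singularity and constant term at `0` as the logarithmic
solution, see `tendsto_kummerY_add_log`. -/
theorem tendsto_kummerJ_add_log {a : ℝ} (ha : 0 < a) (ha2 : a < 2) :
    Tendsto (fun x => kummerJ a x + Real.log x) (𝓝[>] 0) (𝓝 (-(psi a - 2 * psi 1))) := by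
  have hp := neg_one_lt_neg_abs_sub_one ha ha2
  have hp1 : |a - 1| ≤ 1 := by linarith
  have hlim : Tendsto (fun x => ∫ t in Set.Ioi (0 : ℝ),
      Real.exp (-x * t) * ((1 - ratio t ^ (a - 1)) / (1 + t))) (𝓝[>] 0)
      (𝓝 (∫ t in Set.Ioi (0 : ℝ), (1 - ratio t ^ (a - 1)) / (1 + t))) := by
    refine tendsto_integral_filter_of_dominated_convergence (weight (-|a - 1|))
      (Eventually.of_forall fun x => Measurable.aestronglyMeasurable (by fun_prop)) ?_
      (integrableOn_weight hp) ?_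
    · filter_upwards [self_mem_nhdsWithin] with x hx
      filter_upwards [ae_restrict_mem measurableSet_Ioi] with t ht
      have hx0 : 0 < x := hx
      have ht0 : 0 < t := ht
      rw [norm_mul, Real.norm_eq_abs, Real.norm_eq_abs, abs_of_pos (Real.exp_pos _)]
      have h1 : Real.exp (-x * t) ≤ 1 := Real.exp_le_one_iff.2 (by nlinarith)
      exact (mul_le_of_le_one_left (abs_nonneg _) h1).trans (abs_one_sub_ratio_rpow_div_le hp1 ht0)
    · refine Eventually.of_forall fun t => ?_
      have h : Continuous fun x : ℝ =>
        Real.exp (-x * t) * ((1 - ratio t ^ (a - 1)) / (1 + t)) := by fun_prop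
      have h0 := (h.tendsto 0).mono_left (nhdsWithin_le_nhds (s := Set.Ioi 0))
      simpa using h0
  rw [integral_one_sub_ratio_rpow_div ha ha2] at hlim
  have h := tendsto_integral_exp_div_one_add_add_log.sub hlim
  rw [show psi 1 - (psi a - psi 1) = -(psi a - 2 * psi 1) by ring] at h
  refine h.congr' ?_
  filter_upwards [self_mem_nhdsWithin] with x hx
  have hx0 : 0 < x := hx
  have hJ := integrableOn_laplaceRatio (p := a - 1) (by linarith) hx0
    (f := fun t => (1 + t)⁻¹) (by fun_prop) fun t ht => abs_inv_one_add_le ht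
  have hE := integrableOn_laplaceRatio (p := 0) (by linarith) hx0
    (f := fun t => (1 + t)⁻¹) (by fun_prop) fun t ht => abs_inv_one_add_le ht
  simp only [Real.rpow_zero, mul_one] at hE
  have hJE : ∫ t in Set.Ioi (0 : ℝ), Real.exp (-x * t) * ((1 - ratio t ^ (a - 1)) / (1 + t))
      = (∫ t in Set.Ioi (0 : ℝ), Real.exp (-x * t) * (1 + t)⁻¹) - kummerJ a x := by
    rw [kummerJ, laplaceRatio, ← integral_sub hE hJ]
    refine setIntegral_congr_fun measurableSet_Ioi fun t ht => ?_
    ring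
  rw [hJE]
  ring

theorem tendsto_mul_kummerI {a : ℝ} (ha : 0 < a) (ha2 : a < 2) :
    Tendsto (fun x => x * kummerI a x) (𝓝[>] 0) (𝓝 1) := by
  have hp := neg_one_lt_neg_abs_sub_one ha ha2
  have hp1 : |a - 1| ≤ 1 := by linarith
  have hlim : Tendsto (fun x => ∫ t in Set.Ioi (0 : ℝ),
      x * (Real.exp (-x * t) * (1 - ratio t ^ (a - 1)))) (𝓝[>] 0)
      (𝓝 (∫ _t in Set.Ioi (0 : ℝ), 0)) := by
    refine tendsto_integral_filter_of_dominated_convergence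
      (fun t => 2 * weight (-|a - 1|) t)
      (Eventually.of_forall fun x => Measurable.aestronglyMeasurable (by fun_prop)) ?_
      ((integrableOn_weight hp).const_mul 2) ?_
    · filter_upwards [Ioc_mem_nhdsGT one_pos] with x hx
      filter_upwards [ae_restrict_mem measurableSet_Ioi] with t ht
      have hx0 : 0 < x := hx.1
      have ht0 : 0 < t := ht
      rw [norm_mul, norm_mul, Real.norm_eq_abs, Real.norm_eq_abs, Real.norm_eq_abs,
        abs_of_pos (Real.exp_pos _), abs_of_pos hx0]
      have h1 := abs_one_sub_ratio_rpow_le hp1 ht0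
      have h2 : x * (1 + t) * Real.exp (-x * t) ≤ 2 := by
        have h3 := Real.add_one_le_exp (x * t)
        rw [neg_mul, Real.exp_neg, ← div_eq_mul_inv, div_le_iff₀ (Real.exp_pos _)]
        nlinarith [hx.2, mul_pos hx0 ht0]
      have h0 := ratio_pos ht0
      calc x * (Real.exp (-x * t) * |1 - ratio t ^ (a - 1)|)
          ≤ x * (Real.exp (-x * t) * (ratio t ^ (-|a - 1|) / (1 + t))) := by gcongr
        _ = x * (1 + t) * Real.exp (-x * t) * weight (-|a - 1|) t := by
          rw [weight]; field_simp
        _ ≤ 2 * weight (-|a - 1|) t := by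
          have := weight_nonneg (-|a - 1|) ht0
          gcongr
    · refine Eventually.of_forall fun t => ?_
      have h : Continuous fun x : ℝ =>
        x * (Real.exp (-x * t) * (1 - ratio t ^ (a - 1))) := by fun_prop
      have h0 := (h.tendsto 0).mono_left (nhdsWithin_le_nhds (s := Set.Ioi 0))
      simpa using h0
  rw [integral_zero] at hlim
  have h := hlim.const_sub 1
  rw [sub_zero] at h
  refine h.congr' ?_
  filter_upwards [self_mem_nhdsWithin] with x hx
  have hx0 : 0 < x := hx
  have hI := integrableOn_laplaceRatio (p := a - 1) (by linarith) hx0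
    (f := fun _ => 1) (by fun_prop) (by simp)
  have e : ∫ t in Set.Ioi (0 : ℝ), Real.exp (-x * t) * (1 - ratio t ^ (a - 1))
      = 1 / x - kummerI a x := by
    rw [kummerI, laplaceRatio, ← integral_exp_neg_mul_Ioi hx0,
      ← integral_sub (integrableOn_exp_neg_mul_Ioi hx0) hI]
    refine setIntegral_congr_fun measurableSet_Ioi fun t ht => ?_
    ring
  rw [integral_const_mul, e]
  field_simp
  ring

/-! ### Identification of the logarithmic series with the Laplace integral -/

/-- A solution of the singular linear system `h' = -c f`, `f' = f - h / x` on `(0, ∞)` that tends to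
zero at the origin has `f = 0`: the supremum of `|f x| exp (-L x)` over `(0, X]` is at most half of
itself for large `L`. -/
theorem eq_zero_of_singular_system {c : ℝ} {f h : ℝ → ℝ}
    (hh : ∀ x, 0 < x → HasDerivAt h (-(c * f x)) x)
    (hf : ∀ x, 0 < x → HasDerivAt f (f x - h x / x) x)
    (hh0 : Tendsto h (𝓝[>] 0) (𝓝 0)) (hf0 : Tendsto f (𝓝[>] 0) (𝓝 0)) {X : ℝ} (hX : 0 < X) :
    f X = 0 := by
  set L : ℝ := 2 * (1 + |c|) with hL
  have hL0 : 0 < L := by positivity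
  -- The value of `f` at `0` is arbitrary; it is replaced by the limit to get a continuous one.
  set g : ℝ → ℝ := fun x => |Function.update f 0 0 x| * Real.exp (-L * x) with hg
  have hgf : ∀ x, 0 < x → g x = |f x| * Real.exp (-L * x) := fun x hx => by
    rw [hg]; simp only [Function.update_of_ne hx.ne']
  have hcont : ContinuousOn g (Set.Icc 0 X) := by
    refine ContinuousOn.mul (ContinuousOn.abs ?_) (by fun_prop)
    intro x hx
    rcases hx.1.eq_or_lt with rfl | hx0
    · rw [continuousWithinAt_update_same]
      refine hf0.mono_left (nhdsWithin_mono _ ?_)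
      rintro y ⟨hy, hy0⟩
      exact lt_of_le_of_ne hy.1 (Ne.symm hy0)
    · refine ContinuousAt.continuousWithinAt ?_
      exact (continuousAt_update_of_ne hx0.ne').2 (hf x hx0).continuousAt
  obtain ⟨z, hz, hmax⟩ := isCompact_Icc.exists_isMaxOn (Set.nonempty_Icc.2 hX.le) hcont
  set S := g z with hS
  have hS0 : 0 ≤ S := by rw [hS, hg]; positivity
  have hfS : ∀ x, 0 < x → x ≤ X → |f x| ≤ S * Real.exp (L * x) := by
    intro x hx hxX
    have h1 : g x ≤ S := hmax ⟨hx.le, hxX⟩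
    rw [hgf x hx] at h1
    calc |f x| = |f x| * Real.exp (-L * x) * Real.exp (L * x) := by
          rw [mul_assoc, ← Real.exp_add]; simp
      _ ≤ S * Real.exp (L * x) := by gcongr
  have hhS : ∀ x, 0 < x → x ≤ X → |h x| ≤ |c| * (S * Real.exp (L * x)) * x := by
    intro x hx hxX
    have hev : ∀ᶠ ε in 𝓝[>] (0 : ℝ), |h x - h ε| ≤ |c| * (S * Real.exp (L * x)) * (x - ε) := by
      filter_upwards [Ioo_mem_nhdsGT hx] with ε hε
      have := (convex_Icc ε x).norm_image_sub_le_of_norm_hasDerivWithin_le (f := h)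
        (f' := fun y => -(c * f y)) (C := |c| * (S * Real.exp (L * x)))
        (fun y hy => (hh y (hε.1.trans_le hy.1)).hasDerivWithinAt) (fun y hy => ?_)
        (Set.left_mem_Icc.2 hε.2.le) (Set.right_mem_Icc.2 hε.2.le)
      · rwa [Real.norm_eq_abs, Real.norm_eq_abs, abs_of_pos (by linarith [hε.2] : 0 < x - ε)] at this
      · rw [norm_neg, norm_mul, Real.norm_eq_abs, Real.norm_eq_abs]
        have h1 := hfS y (hε.1.trans_le hy.1) (hy.2.trans hxX)
        have h2 : Real.exp (L * y) ≤ Real.exp (L * x) := Real.exp_le_exp.2 (by nlinarith [hy.2])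
        calc |c| * |f y| ≤ |c| * (S * Real.exp (L * y)) := by gcongr
          _ ≤ |c| * (S * Real.exp (L * x)) := by gcongr
    have hl := (hh0.const_sub (h x)).abs
    have hr : Tendsto (fun ε : ℝ => |c| * (S * Real.exp (L * x)) * (x - ε)) (𝓝[>] 0)
        (𝓝 (|c| * (S * Real.exp (L * x)) * (x - 0))) :=
      ((tendsto_const_nhds.sub (tendsto_id.mono_left nhdsWithin_le_nhds)).const_mul _)
    have := le_of_tendsto_of_tendsto hl hr hev
    simpa using this
  have hfS2 : ∀ x, 0 < x → x ≤ X → |f x| ≤ S / 2 * Real.exp (L * x) := by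
    intro x hx hxX
    have hev : ∀ᶠ ε in 𝓝[>] (0 : ℝ), |f x - f ε| ≤ S / 2 * Real.exp (L * x) := by
      filter_upwards [Ioo_mem_nhdsGT hx] with ε hε
      have := image_norm_le_of_norm_deriv_right_le_deriv_boundary (f := fun y => f y - f ε)
        (f' := fun y => f y - h y / y) (a := ε) (b := x)
        (B := fun y => S / 2 * Real.exp (L * y)) (B' := fun y => S / 2 * (Real.exp (L * y) * L))
        (fun y hy => ((hf y (hε.1.trans_le hy.1)).sub_const _).continuousAt.continuousWithinAt)
        (fun y hy => ((hf y (hε.1.trans_le hy.1)).sub_const _).hasDerivWithinAt)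
        (by simp; positivity)
        (fun y => by
          simpa using (((hasDerivAt_id y).const_mul L).exp).const_mul (S / 2))
        (fun y hy => ?_) (Set.right_mem_Icc.2 hε.2.le)
      · exact this
      · have hy0 : 0 < y := hε.1.trans_le hy.1
        have h1 := hfS y hy0 (hy.2.le.trans hxX)
        have h2 := hhS y hy0 (hy.2.le.trans hxX)
        have h3 : |h y / y| ≤ |c| * (S * Real.exp (L * y)) := by
          rw [abs_div, abs_of_pos hy0, div_le_iff₀ hy0]
          exact h2
        calc |f y - h y / y| ≤ |f y| + |h y / y| := abs_sub _ _
          _ ≤ S * Real.exp (L * y) + |c| * (S * Real.exp (L * y)) := add_le_add h1 h3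
          _ = S / 2 * (Real.exp (L * y) * L) := by rw [hL]; ring
    have hl := (hf0.const_sub (f x)).abs
    have := le_of_tendsto hl hev
    simpa using this
  have hSz : S ≤ S / 2 := by
    rcases hz.1.eq_or_lt with hz0 | hz0
    · have : S = 0 := by rw [hS, ← hz0, hg]; simp
      linarith
    · have h1 := hfS2 z hz0 hz.2
      calc S = |f z| * Real.exp (-L * z) := by rw [hS, hgf z hz0]
        _ ≤ S / 2 * Real.exp (L * z) * Real.exp (-L * z) := by gcongr
        _ = S / 2 := by rw [mul_assoc, ← Real.exp_add]; simp
  have hS00 : S = 0 := by linarith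
  have := hfS X hX le_rfl
  rw [hS00, zero_mul] at this
  exact abs_nonpos_iff.1 this

theorem ne_neg_natCast_of_pos {a : ℝ} (ha : 0 < a) (m : ℕ) : a ≠ -m := by
  have : (0 : ℝ) ≤ m := Nat.cast_nonneg m
  intro h
  linarith

/-- For `0 < a < 2` the logarithmic series is the Laplace integral `∫ e^{-xt} (t/(1+t))^{a-1} dt`:
both solve the same first order system and agree to leading orders at the origin. -/
theorem kummerV_eq_kummerI {a : ℝ} (ha : 0 < a) (ha2 : a < 2) {x : ℝ} (hx : 0 < x) :
    kummerV a x = kummerI a x := by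
  have hpole := ne_neg_natCast_of_pos ha
  set f : ℝ → ℝ := fun x => kummerY a x - kummerJ a x with hf
  set h : ℝ → ℝ := fun x => x * kummerV a x - x * kummerI a x with hh
  have hdiv : ∀ y, 0 < y → h y / y = kummerV a y - kummerI a y := by
    intro y hy
    rw [hh]
    field_simp
  have hder : ∀ y, 0 < y → HasDerivAt f (f y - h y / y) y := by
    intro y hy
    refine ((hasDerivAt_kummerY hpole hy).sub (hasDerivAt_kummerJ ha hy)).congr_deriv ?_
    rw [hdiv y hy, hf]
    ring
  have hfz : ∀ y, 0 < y → f y = 0 := by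
    intro y hy
    refine eq_zero_of_singular_system (c := a - 1) (h := h) ?_ hder ?_ ?_ hy
    · intro z hz
      refine ((hasDerivAt_mul_kummerV hpole hz).sub (hasDerivAt_mul_kummerI ha hz)).congr_deriv ?_
      rw [hf]
      ring
    · simpa using (tendsto_mul_kummerV hpole).sub (tendsto_mul_kummerI ha ha2)
    · simpa using (tendsto_kummerY_add_log hpole).sub (tendsto_kummerJ_add_log ha ha2)
  -- As `f` vanishes identically, its derivative `f - h / x` gives `h = 0`.
  have hd0 : HasDerivAt f 0 x :=
    (hasDerivAt_const x 0).congr_of_eventuallyEq (by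
      filter_upwards [Ioi_mem_nhds hx] with y hy using hfz y hy)
  have := hd0.unique (hder x hx)
  rw [hfz x hx, hdiv x hx] at this
  linarith

/-! ### Size of the logarithmic solution and square integrability of `Φ_u` -/

theorem measurable_kummerV {a : ℝ} (ha : ∀ m : ℕ, a ≠ -m) : Measurable (kummerV a) := by
  have h1 := (continuous_powerSum (entireCoeff_kummerCoeff a)).measurable
  have h2 := (continuous_powerSum (entireCoeff_mul_psiCoeff ha)).measurable
  have : kummerV a = fun x => 1 / x + (a - 1) * (Real.log x * powerSum (kummerCoeff a) x
      + powerSum (fun k => kummerCoeff a k * psiCoeff a k) x) := by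
    funext x
    rw [kummerV, logSeries_eq ha]
  rw [this]
  fun_prop

/-- `kummerV a` grows at most polynomially at infinity. -/
def PolyBoundedV (a : ℝ) : Prop :=
  ∃ (C : ℝ) (n : ℕ), 0 ≤ C ∧ ∀ x, 1 ≤ x → |kummerV a x| ≤ C * x ^ n

theorem polyBoundedV_of_mem_Ioo {a : ℝ} (ha : 0 < a) (ha2 : a < 2) : PolyBoundedV a := by
  have hI : ∀ x, 0 < x → 0 ≤ kummerI a x := fun x hx => by
    refine setIntegral_nonneg measurableSet_Ioi fun t ht => ?_
    have := ratio_pos ht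
    positivity
  refine ⟨kummerI a 1, 0, hI 1 one_pos, fun x hx => ?_⟩
  have hx0 : 0 < x := by linarith
  rw [kummerV_eq_kummerI ha ha2 hx0, pow_zero, mul_one, abs_of_nonneg (hI x hx0)]
  refine setIntegral_mono_on (integrableOn_laplaceRatio (by linarith) hx0 (by fun_prop) (by simp))
    (integrableOn_laplaceRatio (by linarith) one_pos (by fun_prop) (by simp)) measurableSet_Ioi
    fun t ht => ?_
  have h0 := ratio_pos ht
  have ht0 : 0 < t := ht
  have h1 : Real.exp (-x * t) ≤ Real.exp (-1 * t) := Real.exp_le_exp.2 (by nlinarith)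
  gcongr

theorem PolyBoundedV.of_recurrence {a b b' α β : ℝ} (hb : PolyBoundedV b) (hb' : PolyBoundedV b')
    (h : ∀ x, 1 ≤ x → kummerV a x = (α * x + β) * kummerV b x - kummerV b' x) :
    PolyBoundedV a := by
  obtain ⟨C, n, hC, hn⟩ := hb
  obtain ⟨C', n', hC', hn'⟩ := hb'
  refine ⟨(|α| + |β|) * C + C', n + 1 + n', by positivity, fun x hx => ?_⟩
  have hx0 : 0 ≤ x := by linarith
  rw [h x hx]
  have h1 : |α * x + β| ≤ (|α| + |β|) * x := by
    calc |α * x + β| ≤ |α * x| + |β| := abs_add_le _ _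
      _ ≤ (|α| + |β|) * x := by
        rw [abs_mul, abs_of_nonneg hx0]
        nlinarith [abs_nonneg β]
  have e1 : x ^ (n + 1) ≤ x ^ (n + 1 + n') := pow_le_pow_right₀ hx (by omega)
  have e2 : x ^ n' ≤ x ^ (n + 1 + n') := pow_le_pow_right₀ hx (by omega)
  calc |(α * x + β) * kummerV b x - kummerV b' x|
      ≤ |α * x + β| * |kummerV b x| + |kummerV b' x| := by
        rw [← abs_mul]; exact abs_sub _ _
    _ ≤ (|α| + |β|) * x * (C * x ^ n) + C' * x ^ n' := by
        gcongr
        · exact hn x hx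
        · exact hn' x hx
    _ = (|α| + |β|) * C * x ^ (n + 1) + C' * x ^ n' := by ring
    _ ≤ (|α| + |β|) * C * x ^ (n + 1 + n') + C' * x ^ (n + 1 + n') := by gcongr
    _ = ((|α| + |β|) * C + C') * x ^ (n + 1 + n') := by ring

theorem kummerV_add_one {a : ℝ} (ha : ∀ m : ℤ, a ≠ m) {x : ℝ} (hx : 0 < x) :
    kummerV (a + 1) x
      = (1 / (a - 1) * x + 2) * kummerV a x - kummerV (a - 1) x := by
  have ha1 : a - 1 ≠ 0 := sub_ne_zero.2 (by exact_mod_cast ha 1)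
  have h := kummerV_recurrence ha hx
  field_simp
  linear_combination h

/-- Off the integers the polynomial bound spreads from `0 < a < 2` to all parameters by the
three-term recurrence. -/
theorem polyBoundedV {a : ℝ} (ha : ∀ m : ℤ, a ≠ m) : PolyBoundedV a := by
  have hv0 : 0 < Int.fract a := Int.fract_pos.2 (ha _)
  have hv1 : Int.fract a < 1 := Int.fract_lt_one a
  have hshift : ∀ n m : ℤ, Int.fract a + n ≠ m := by
    intro n m h
    refine ha (m - n + ⌊a⌋) ?_
    have := Int.fract_add_floor a
    push_cast
    linarith
  have key : ∀ n : ℤ, PolyBoundedV (Int.fract a + n) ∧ PolyBoundedV (Int.fract a + n + 1) := by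
    intro n
    induction n with
    | zero =>
      simp only [Int.cast_zero, add_zero]
      exact ⟨polyBoundedV_of_mem_Ioo hv0 (by linarith),
        polyBoundedV_of_mem_Ioo (by linarith) (by linarith)⟩
    | succ i ih =>
      rw [show Int.fract a + ((i + 1 : ℤ) : ℝ) = Int.fract a + (i : ℤ) + 1 by push_cast; ring]
      refine ⟨ih.2, ih.2.of_recurrence ih.1
        (α := 1 / (Int.fract a + (i : ℤ) + 1 - 1)) (β := 2) fun x hx => ?_⟩
      · have h := kummerV_add_one (a := Int.fract a + (i : ℤ) + 1) (fun m => by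
          have := hshift (i + 1) m
          push_cast at this
          rwa [← add_assoc] at this) (by linarith : 0 < x)
        rw [h, add_sub_cancel_right]
    | pred i ih =>
      rw [show Int.fract a + ((-i - 1 : ℤ) : ℝ) + 1 = Int.fract a + (-i : ℤ) by push_cast; ring]
      refine ⟨ih.1.of_recurrence ih.2
        (α := 1 / (Int.fract a + (-i : ℤ) - 1)) (β := 2) fun x hx => ?_, ih.1⟩
      · have h := kummerV_add_one (a := Int.fract a + (-i : ℤ)) (hshift (-i))
          (by linarith : 0 < x)
        rw [h, show Int.fract a + ((-i - 1 : ℤ) : ℝ) = Int.fract a + (-i : ℤ) - 1 by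
          push_cast; ring]
        ring
  have h := (key ⌊a⌋).1
  rwa [Int.fract_add_floor] at h

theorem exists_abs_kummerV_sub_inv_le {a : ℝ} (ha : ∀ m : ℕ, a ≠ -m) :
    ∃ C, 0 ≤ C ∧ ∀ x, 0 < x → x ≤ 1 → |kummerV a x - 1 / x| ≤ C * (|Real.log x| + 1) := by
  obtain ⟨C₁, h1⟩ := isCompact_Icc.exists_bound_of_continuousOn (s := Set.Icc (0 : ℝ) 1)
    (continuous_powerSum (entireCoeff_kummerCoeff a)).continuousOn
  obtain ⟨C₂, h2⟩ := isCompact_Icc.exists_bound_of_continuousOn (s := Set.Icc (0 : ℝ) 1)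
    (continuous_powerSum (entireCoeff_mul_psiCoeff ha)).continuousOn
  have hC1 : 0 ≤ C₁ := (norm_nonneg _).trans (h1 0 (by simp))
  have hC2 : 0 ≤ C₂ := (norm_nonneg _).trans (h2 0 (by simp))
  refine ⟨|a - 1| * (C₁ + C₂), by positivity, fun x hx hx1 => ?_⟩
  have e1 := h1 x ⟨hx.le, hx1⟩
  have e2 := h2 x ⟨hx.le, hx1⟩
  rw [Real.norm_eq_abs] at e1 e2
  rw [kummerV, logSeries_eq ha, add_sub_cancel_left, abs_mul, mul_assoc]
  gcongr
  calc _ ≤ |Real.log x| * |powerSum (kummerCoeff a) x|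
        + |powerSum (fun k => kummerCoeff a k * psiCoeff a k) x| := by
        rw [← abs_mul]; exact abs_add_le _ _
    _ ≤ |Real.log x| * C₁ + C₂ := by gcongr
    _ ≤ (C₁ + C₂) * (|Real.log x| + 1) := by
        nlinarith [abs_nonneg (Real.log x), mul_nonneg hC2 (abs_nonneg (Real.log x))]

theorem phiTerm_eq (u x : ℝ) : phiTerm u x = logTerm (1 - u * Real.sign x) |x| := by
  funext k
  rw [phiTerm, logTerm, kummerCoeff, psiCoeff,
    show (1 : ℝ) + k - u * Real.sign x = 1 - u * Real.sign x + k by ring]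
  ring

theorem Phi_of_pos (u : ℝ) {x : ℝ} (hx : 0 < x) :
    Phi u x = Real.sin (Real.pi * u) / Real.pi
      * (Real.exp (-x / 2) * kummerV (1 - u) x - 1 / x) := by
  rw [Phi, phiTerm_eq, Real.sign_of_pos hx, mul_one, abs_of_pos hx, kummerV, logSeries]
  have := Real.pi_ne_zero
  field_simp
  ring

theorem Phi_neg (u x : ℝ) : Phi u (-x) = Phi (-u) x := by
  rw [Phi, Phi, phiTerm_eq, phiTerm_eq, Real.sign_neg, abs_neg, mul_neg u,
    neg_mul u (Real.sign x), mul_neg Real.pi u, mul_neg Real.pi x, Real.sin_neg, div_neg]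
  ring

theorem ne_neg_natCast_of_ne_intCast {a : ℝ} (ha : ∀ m : ℤ, a ≠ m) (m : ℕ) : a ≠ -m := by
  have := ha (-m)
  push_cast at this
  exact this

theorem one_sub_ne_intCast {u : ℝ} (hu : ∀ m : ℤ, u ≠ m) (m : ℤ) : 1 - u ≠ m := by
  intro h
  refine hu (1 - m) ?_
  push_cast
  linarith

theorem neg_ne_intCast {u : ℝ} (hu : ∀ m : ℤ, u ≠ m) (m : ℤ) : -u ≠ m := by
  intro h
  refine hu (-m) ?_
  push_cast
  linarith

theorem summable_phiTerm {u : ℝ} (hu : ∀ m : ℤ, u ≠ m) {x : ℝ} (hx : x ≠ 0) :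
    Summable (phiTerm u x) := by
  rw [phiTerm_eq]
  refine summable_logTerm (ne_neg_natCast_of_ne_intCast ?_) _
  rcases lt_or_gt_of_ne hx with h | h
  · rw [Real.sign_of_neg h, mul_neg, mul_one]
    exact one_sub_ne_intCast (neg_ne_intCast hu)
  · rw [Real.sign_of_pos h, mul_one]
    exact one_sub_ne_intCast hu

theorem exists_abs_Phi_le_of_le_one {u : ℝ} (hu : ∀ m : ℤ, u ≠ m) :
    ∃ C, ∀ x, 0 < x → x ≤ 1 → |Phi u x| ≤ C * x ^ (-(1 / 4) : ℝ) := by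
  obtain ⟨C, hC, h⟩ := exists_abs_kummerV_sub_inv_le
    (ne_neg_natCast_of_ne_intCast (one_sub_ne_intCast hu))
  refine ⟨|Real.sin (Real.pi * u) / Real.pi| * (5 * C + 1), fun x hx hx1 => ?_⟩
  rw [Phi_of_pos u hx, abs_mul, mul_assoc]
  gcongr
  set y := x ^ (-(1 / 4) : ℝ) with hy
  have hy1 : 1 ≤ y := Real.one_le_rpow_of_pos_of_le_one_of_nonpos hx hx1 (by norm_num)
  have hlog : |Real.log x| ≤ 4 * y := by
    rw [abs_of_nonpos (Real.log_nonpos hx.le hx1)]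
    have := Real.log_le_rpow_div (inv_nonneg.2 hx.le) (by norm_num : (0 : ℝ) < 1 / 4)
    rw [Real.log_inv, Real.inv_rpow hx.le, ← Real.rpow_neg hx.le, ← hy] at this
    linarith
  have he1 : Real.exp (-x / 2) ≤ 1 := Real.exp_le_one_iff.2 (by linarith)
  have he2 : 1 - x / 2 ≤ Real.exp (-x / 2) := by
    have := Real.add_one_le_exp (-x / 2)
    linarith
  have h3 : |(Real.exp (-x / 2) - 1) / x| ≤ 1 := by
    rw [abs_div, abs_of_pos hx, div_le_one hx, abs_le]
    constructor <;> linarith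
  have h4 := h x hx hx1
  calc |Real.exp (-x / 2) * kummerV (1 - u) x - 1 / x|
      = |Real.exp (-x / 2) * (kummerV (1 - u) x - 1 / x) + (Real.exp (-x / 2) - 1) / x| := by
        congr 1; ring
    _ ≤ Real.exp (-x / 2) * |kummerV (1 - u) x - 1 / x| + |(Real.exp (-x / 2) - 1) / x| := by
        refine (abs_add_le _ _).trans ?_
        rw [abs_mul, abs_of_pos (Real.exp_pos _)]
    _ ≤ 1 * (C * (4 * y + y)) + y := by
        gcongr
        · refine h4.trans ?_
          gcongr
        · linarith
    _ = (5 * C + 1) * y := by ring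

theorem exists_abs_Phi_le_of_one_le {u : ℝ} (hu : ∀ m : ℤ, u ≠ m) :
    ∃ C, ∀ x, 1 ≤ x → |Phi u x| ≤ C * x⁻¹ := by
  obtain ⟨C, n, hC, h⟩ := polyBoundedV (one_sub_ne_intCast hu)
  refine ⟨|Real.sin (Real.pi * u) / Real.pi| * (C * (2 ^ (n + 1) * (n + 1).factorial) + 1),
    fun x hx => ?_⟩
  have hx0 : 0 < x := by linarith
  rw [Phi_of_pos u hx0, abs_mul, mul_assoc]
  gcongr
  have h1 : Real.exp (-x / 2) * x ^ n ≤ 2 ^ (n + 1) * (n + 1).factorial * x⁻¹ := by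
    have h2 := Real.pow_div_factorial_le_exp (x / 2) (by positivity) (n + 1)
    rw [div_pow, div_div, div_le_iff₀ (by positivity)] at h2
    rw [neg_div, Real.exp_neg, inv_mul_eq_div, div_le_iff₀ (Real.exp_pos _)]
    rw [pow_succ x] at h2
    rw [mul_right_comm, ← div_eq_mul_inv, le_div_iff₀ hx0]
    linarith
  calc |Real.exp (-x / 2) * kummerV (1 - u) x - 1 / x|
      ≤ Real.exp (-x / 2) * |kummerV (1 - u) x| + x⁻¹ := by
        refine (abs_sub _ _).trans ?_
        rw [abs_mul, abs_of_pos (Real.exp_pos _), abs_of_pos (by positivity : 0 < 1 / x), one_div]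
    _ ≤ Real.exp (-x / 2) * (C * x ^ n) + x⁻¹ := by gcongr; exact h x hx
    _ = C * (Real.exp (-x / 2) * x ^ n) + x⁻¹ := by ring
    _ ≤ C * (2 ^ (n + 1) * (n + 1).factorial * x⁻¹) + x⁻¹ := by gcongr
    _ = (C * (2 ^ (n + 1) * (n + 1).factorial) + 1) * x⁻¹ := by ring

theorem memLp_indicator_Phi {u : ℝ} (hu : ∀ m : ℤ, u ≠ m) :
    MemLp ((Set.Ioi (0 : ℝ)).indicator (Phi u)) 2 volume := by
  have hm : AEStronglyMeasurable (Phi u) (volume.restrict (Set.Ioi 0)) := by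
    have h1 := measurable_kummerV (ne_neg_natCast_of_ne_intCast (one_sub_ne_intCast hu))
    refine AEStronglyMeasurable.congr (f := fun x => Real.sin (Real.pi * u) / Real.pi
      * (Real.exp (-x / 2) * kummerV (1 - u) x - 1 / x)) ?_ ?_
    · exact Measurable.aestronglyMeasurable (by fun_prop)
    · filter_upwards [ae_restrict_mem measurableSet_Ioi] with x hx
      exact (Phi_of_pos u hx).symm
  rw [memLp_indicator_iff_restrict measurableSet_Ioi, memLp_two_iff_integrable_sq hm]
  change IntegrableOn _ _ _
  rw [← Set.Ioc_union_Ioi_eq_Ioi zero_le_one]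
  refine IntegrableOn.union ?_ ?_
  · obtain ⟨C, hC⟩ := exists_abs_Phi_le_of_le_one hu
    have hi : IntegrableOn (fun x : ℝ => x ^ (-(1 / 2) : ℝ)) (Set.Ioc 0 1) :=
      (intervalIntegrable_iff_integrableOn_Ioc_of_le zero_le_one).1
        (intervalIntegral.intervalIntegrable_rpow' (by norm_num))
    refine (hi.const_mul (C ^ 2)).mono' ?_ ?_
    · exact ((hm.mono_set Set.Ioc_subset_Ioi_self).pow 2)
    · filter_upwards [ae_restrict_mem measurableSet_Ioc] with x hx
      rw [norm_pow, Real.norm_eq_abs]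
      calc |Phi u x| ^ 2 ≤ (C * x ^ (-(1 / 4) : ℝ)) ^ 2 := by gcongr; exact hC x hx.1 hx.2
        _ = C ^ 2 * x ^ (-(1 / 2) : ℝ) := by
          rw [mul_pow, ← Real.rpow_natCast (x ^ (-(1 / 4) : ℝ)), ← Real.rpow_mul hx.1.le]
          norm_num
  · obtain ⟨C, hC⟩ := exists_abs_Phi_le_of_one_le hu
    have hi : IntegrableOn (fun x : ℝ => x ^ (-2 : ℝ)) (Set.Ioi 1) :=
      integrableOn_Ioi_rpow_of_lt (by norm_num) one_pos
    refine (hi.const_mul (C ^ 2)).mono' ?_ ?_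
    · exact ((hm.mono_set (Set.Ioi_subset_Ioi zero_le_one)).pow 2)
    · filter_upwards [ae_restrict_mem measurableSet_Ioi] with x hx
      have hx1 : 1 < x := hx
      rw [norm_pow, Real.norm_eq_abs]
      calc |Phi u x| ^ 2 ≤ (C * x⁻¹) ^ 2 := by gcongr; exact hC x hx1.le
        _ = C ^ 2 * x ^ (-2 : ℝ) := by
          rw [mul_pow, inv_pow, Real.rpow_neg (by linarith)]
          norm_num

theorem ae_ne_zero : ∀ᵐ x : ℝ, x ≠ 0 := by
  simp [ae_iff]

theorem memLp_Phi {u : ℝ} (hu : ∀ m : ℤ, u ≠ m) : MemLp (Phi u) 2 volume := by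
  have h1 := memLp_indicator_Phi hu
  have h2 := (memLp_indicator_Phi (neg_ne_intCast hu)).comp_measurePreserving
    (Measure.measurePreserving_neg (volume : Measure ℝ))
  refine (memLp_congr_ae ?_).1 (h1.add h2)
  filter_upwards [ae_ne_zero] with x hx
  simp only [Pi.add_apply, Function.comp_apply]
  rcases lt_or_gt_of_ne hx with h | h
  · rw [Set.indicator_of_notMem (by simp [h.le]), Set.indicator_of_mem (by simpa using h), zero_add,
      Phi_neg, neg_neg]
  · rw [Set.indicator_of_notMem (by simp [h.le] : -x ∉ Set.Ioi (0 : ℝ)),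
      Set.indicator_of_mem (by simpa using h), add_zero]

theorem memLp_ofReal_Phi {u : ℝ} (hu : ∀ m : ℤ, u ≠ m) :
    MemLp (fun x : ℝ => (Phi u x : ℂ)) 2 (volume : Measure ℝ) :=
  (memLp_Phi hu).ofReal

/-! ### The distributions `μ^{*u}` on Fourier transforms of test functions -/

/-- Multiplication of a Schwartz function by the coordinate function. -/
noncomputable def mulCoord : 𝓢(ℝ, ℂ) →L[ℂ] 𝓢(ℝ, ℂ) :=
  SchwartzMap.smulLeftCLM ℂ fun x : ℝ => (x : ℂ)

theorem mulCoord_apply (φ : 𝓢(ℝ, ℂ)) (x : ℝ) : mulCoord φ x = x * φ x := by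
  rw [mulCoord, SchwartzMap.smulLeftCLM_apply_apply (by fun_prop), smul_eq_mul]

theorem hasDerivAt_schwartz (φ : 𝓢(ℝ, ℂ)) (x : ℝ) :
    HasDerivAt φ (SchwartzMap.derivCLM ℂ ℂ φ x) x := by
  rw [SchwartzMap.derivCLM_apply]
  exact φ.differentiableAt.hasDerivAt

theorem norm_exp_neg_I_mul (l x : ℝ) : ‖Complex.exp (-Complex.I * l * x)‖ = 1 := by
  rw [show -Complex.I * l * x = ((-(l * x) : ℝ) : ℂ) * Complex.I by push_cast; ring]
  exact Complex.norm_exp_ofReal_mul_I _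

theorem integrable_exp_mul (ψ : 𝓢(ℝ, ℂ)) (l : ℝ) :
    Integrable fun x : ℝ => Complex.exp (-Complex.I * l * x) * ψ x := by
  refine ψ.integrable.norm.mono' ?_ (Eventually.of_forall fun x => ?_)
  · exact Continuous.aestronglyMeasurable (by have := ψ.continuous; fun_prop)
  · rw [norm_mul, norm_exp_neg_I_mul, one_mul]

theorem mulCoord_schwartzFourier (ψ : 𝓢(ℝ, ℂ)) :
    mulCoord (schwartzFourier ψ)
      = schwartzFourier (-Complex.I • SchwartzMap.derivCLM ℂ ℂ ψ) := by
  ext l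
  have hu : ∀ x : ℝ, HasDerivAt (fun x : ℝ => Complex.exp (-Complex.I * l * x))
      (-Complex.I * l * Complex.exp (-Complex.I * l * x)) x := fun x => by
    have h := ((Complex.ofRealCLM.hasDerivAt (x := x)).const_mul (-Complex.I * l)).cexp
    refine h.congr_deriv ?_
    simp
    ring
  have h := integral_mul_deriv_eq_deriv_mul_of_integrable
    (u := fun x : ℝ => Complex.exp (-Complex.I * l * x)) (v := ψ)
    (v' := SchwartzMap.derivCLM ℂ ℂ ψ) (fun x _ => hu x) (fun x _ => hasDerivAt_schwartz ψ x)
    (integrable_exp_mul _ l) ?_ (integrable_exp_mul ψ l)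
  · rw [mulCoord_apply, schwartzFourier_apply, schwartzFourier_apply]
    simp only [smul_apply, smul_eq_mul]
    simp_rw [mul_left_comm _ (-Complex.I)]
    rw [integral_const_mul, h]
    simp_rw [mul_assoc (-Complex.I * (l : ℂ))]
    rw [integral_const_mul]
    linear_combination ((l : ℂ) * ∫ x : ℝ, Complex.exp (-Complex.I * l * x) * ψ x) * Complex.I_sq
  · have := (integrable_exp_mul ψ l).const_mul (-Complex.I * l)
    refine this.congr (Eventually.of_forall fun x => ?_)
    simp only [Pi.mul_apply]
    ring

theorem deriv_schwartzFourier (ψ : 𝓢(ℝ, ℂ)) :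
    SchwartzMap.derivCLM ℂ ℂ (schwartzFourier ψ)
      = schwartzFourier (-Complex.I • mulCoord ψ) := by
  ext l
  have h := hasDerivAt_integral_of_dominated_loc_of_deriv_le (μ := volume) (s := Set.univ)
    (F := fun (l : ℝ) (x : ℝ) => Complex.exp (-Complex.I * l * x) * ψ x)
    (F' := fun (l : ℝ) (x : ℝ) => Complex.exp (-Complex.I * l * x) * (-Complex.I • mulCoord ψ) x)
    (bound := fun x => ‖(-Complex.I • mulCoord ψ) x‖) (x₀ := l) univ_mem
    (Eventually.of_forall fun l => (integrable_exp_mul ψ l).aestronglyMeasurable)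
    (integrable_exp_mul ψ l) (integrable_exp_mul _ l).aestronglyMeasurable
    (Eventually.of_forall fun x l _ => ?_) (-Complex.I • mulCoord ψ).integrable.norm
    (Eventually.of_forall fun x l _ => ?_)
  · have h1 := hasDerivAt_schwartz (schwartzFourier ψ) l
    rw [funext (schwartzFourier_apply ψ)] at h1
    rw [h1.unique h.2, schwartzFourier_apply]
  · rw [norm_mul, norm_exp_neg_I_mul, one_mul]
  · have h := (((Complex.ofRealCLM.hasDerivAt (x := l)).const_mul
      (-Complex.I)).mul_const (x : ℂ)).cexp.mul_const (ψ x)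
    refine h.congr_deriv ?_
    simp only [smul_apply, smul_eq_mul, mulCoord_apply]
    simp
    ring

theorem muPow_schwartzFourier (u : ℝ) (ψ : 𝓢(ℝ, ℂ)) :
    muPow u (schwartzFourier ψ) = ∫ l : ℝ, ψ l * symbol u l := by
  rw [← symbolDist_apply]
  change symbolDist u (schwartzFourierInv (schwartzFourier ψ)) = _
  rw [schwartzFourierInv_fourier]

theorem norm_symbol (u l : ℝ) : ‖symbol u l‖ = 1 := by
  rw [symbol, show (-2 * Complex.I * u * Real.arctan (2 * l) : ℂ)
    = ((-2 * u * Real.arctan (2 * l) : ℝ) : ℂ) * Complex.I by push_cast; ring]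
  exact Complex.norm_exp_ofReal_mul_I _

theorem continuous_symbol (u : ℝ) : Continuous (symbol u) := by unfold symbol; fun_prop

theorem integrable_mul_symbol (u : ℝ) (ψ : 𝓢(ℝ, ℂ)) :
    Integrable fun l : ℝ => ψ l * symbol u l := by
  refine ψ.integrable.norm.mono' ?_ (Eventually.of_forall fun x => ?_)
  · exact (ψ.continuous.mul (continuous_symbol u)).aestronglyMeasurable
  · rw [norm_mul, norm_symbol, mul_one]

theorem quarter_add_sq_ne_zero (l : ℝ) : ((l : ℂ) ^ 2 + 1 / 4) ≠ 0 := by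
  have h : (0 : ℝ) < l ^ 2 + 1 / 4 := by positivity
  have : ((l ^ 2 + 1 / 4 : ℝ) : ℂ) ≠ 0 := by exact_mod_cast h.ne'
  push_cast at this
  exact this

theorem hasDerivAt_symbol (u l : ℝ) :
    HasDerivAt (symbol u) (-Complex.I * u / ((l : ℂ) ^ 2 + 1 / 4) * symbol u l) l := by
  have h1 : HasDerivAt (fun l : ℝ => Real.arctan (2 * l)) (1 / (1 + (2 * l) ^ 2) * 2) l := by
    simpa using ((hasDerivAt_id l).const_mul 2).arctan
  have h := (h1.ofReal_comp.const_mul (-2 * Complex.I * u)).cexp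
  refine h.congr_deriv ?_
  have := quarter_add_sq_ne_zero l
  have h2 : (1 + (2 * (l : ℂ)) ^ 2) ≠ 0 := by
    intro h0
    apply this
    linear_combination h0 / 4
  rw [symbol]
  push_cast
  field_simp
  ring

theorem norm_deriv_symbol_le (u l : ℝ) :
    ‖-Complex.I * u / ((l : ℂ) ^ 2 + 1 / 4) * symbol u l‖ ≤ 4 * |u| := by
  have e : ((l : ℂ) ^ 2 + 1 / 4) = ((l ^ 2 + 1 / 4 : ℝ) : ℂ) := by push_cast; ring
  rw [norm_mul, norm_symbol, mul_one, norm_div, norm_mul, norm_neg, Complex.norm_I, one_mul, e,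
    Complex.norm_real, Complex.norm_real, Real.norm_eq_abs, Real.norm_eq_abs,
    abs_of_pos (by positivity : 0 < l ^ 2 + 1 / 4), div_le_iff₀ (by positivity)]
  nlinarith [abs_nonneg u, mul_nonneg (abs_nonneg u) (sq_nonneg l)]

/-- Integration by parts against the symbol. -/
theorem integral_deriv_mul_symbol (u : ℝ) (ψ : 𝓢(ℝ, ℂ)) :
    ∫ l : ℝ, SchwartzMap.derivCLM ℂ ℂ ψ l * symbol u l
      = ∫ l : ℝ, Complex.I * u / ((l : ℂ) ^ 2 + 1 / 4) * (ψ l * symbol u l) := by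
  have hu' : Integrable fun l : ℝ =>
      -Complex.I * u / ((l : ℂ) ^ 2 + 1 / 4) * symbol u l * ψ l := by
    refine (ψ.integrable.norm.const_mul (4 * |u|)).mono' ?_ (Eventually.of_forall fun l => ?_)
    · refine Continuous.aestronglyMeasurable ?_
      have h1 := continuous_symbol u
      have h2 := ψ.continuous
      have h3 : Continuous fun l : ℝ => -Complex.I * u / ((l : ℂ) ^ 2 + 1 / 4) :=
        Continuous.div (by fun_prop) (by fun_prop) quarter_add_sq_ne_zero
      fun_prop
    · rw [norm_mul]
      gcongr
      exact norm_deriv_symbol_le u l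
  have h := integral_mul_deriv_eq_deriv_mul_of_integrable (u := symbol u) (v := ψ)
    (v' := SchwartzMap.derivCLM ℂ ℂ ψ) (fun x _ => hasDerivAt_symbol u x)
    (fun x _ => hasDerivAt_schwartz ψ x) ?_ hu' ?_
  · simp_rw [mul_comm _ (symbol u _)]
    rw [h, ← integral_neg]
    refine integral_congr_ae (Eventually.of_forall fun l => ?_)
    simp only
    ring
  · exact (integrable_mul_symbol u (SchwartzMap.derivCLM ℂ ℂ ψ)).congr
      (Eventually.of_forall fun l => mul_comm _ _)
  · exact (integrable_mul_symbol u ψ).congr (Eventually.of_forall fun l => mul_comm _ _)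

theorem symbol_add_one_add (u l : ℝ) :
    symbol (u + 1) l + 2 * symbol u l + symbol (u - 1) l
      = 1 / ((l : ℂ) ^ 2 + 1 / 4) * symbol u l := by
  set θ : ℝ := Real.arctan (2 * l) with hθ
  have h1 : symbol (u + 1) l = symbol u l * Complex.exp (-(2 * θ : ℝ) * Complex.I) := by
    rw [symbol, symbol, ← Complex.exp_add, ← hθ]
    congr 1
    push_cast
    ring
  have h2 : symbol (u - 1) l = symbol u l * Complex.exp ((2 * θ : ℝ) * Complex.I) := by
    rw [symbol, symbol, ← Complex.exp_add, ← hθ]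
    congr 1
    push_cast
    ring
  have hc := Complex.two_cos ((2 * θ : ℝ) : ℂ)
  have h4 : Real.cos θ ^ 2 = 1 / (1 + (2 * l) ^ 2) := Real.cos_sq_arctan _
  have h3 : (2 + 2 * Complex.cos (2 * θ : ℝ) : ℂ) = 1 / ((l : ℂ) ^ 2 + 1 / 4) := by
    rw [← Complex.ofReal_cos, Real.cos_two_mul, h4]
    have := quarter_add_sq_ne_zero l
    have h2 : (1 + (2 * (l : ℂ)) ^ 2) ≠ 0 := by
      intro h0
      apply this
      linear_combination h0 / 4
    push_cast
    field_simp
    ring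
  rw [h1, h2, ← h3]
  linear_combination -(symbol u l) * hc

/-- The recurrence `x μ^{*u} = u (μ^{*(u+1)} + 2 μ^{*u} + μ^{*(u-1)})`, tested on `φ`. -/
theorem muPow_mulCoord (u : ℝ) (φ : 𝓢(ℝ, ℂ)) :
    muPow u (mulCoord φ) = u * (muPow (u + 1) φ + 2 * muPow u φ + muPow (u - 1) φ) := by
  rw [← schwartzFourier_inv φ]
  generalize schwartzFourierInv φ = ψ
  rw [mulCoord_schwartzFourier]
  simp only [muPow_schwartzFourier]
  have h2 : Integrable fun l : ℝ => ψ l * symbol (u + 1) l + 2 * (ψ l * symbol u l) :=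
    (integrable_mul_symbol _ ψ).add ((integrable_mul_symbol u ψ).const_mul 2)
  rw [← integral_const_mul, ← integral_add (integrable_mul_symbol _ ψ)
    ((integrable_mul_symbol u ψ).const_mul 2), ← integral_add h2
    (integrable_mul_symbol _ ψ), ← integral_const_mul]
  have h : ∫ l : ℝ, (-Complex.I • SchwartzMap.derivCLM ℂ ℂ ψ) l * symbol u l
      = -Complex.I * ∫ l : ℝ, SchwartzMap.derivCLM ℂ ℂ ψ l * symbol u l := by
    rw [← integral_const_mul]
    refine integral_congr_ae (Eventually.of_forall fun l => ?_)
    simp only [smul_apply, smul_eq_mul]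
    ring
  rw [h, integral_deriv_mul_symbol, ← integral_const_mul]
  refine integral_congr_ae (Eventually.of_forall fun l => ?_)
  have hs := symbol_add_one_add u l
  simp only
  linear_combination (-(u : ℂ) * ψ l) * hs
    - (u * (ψ l * symbol u l) / ((l : ℂ) ^ 2 + 1 / 4)) * Complex.I_sq

/-- The differential equation satisfied by `μ^{*u}`; on the Fourier side it is the first order
equation of `hasDerivAt_symbol`. -/
theorem muPow_ode (u : ℝ) :
    mulX (D (D (muPow u))) + (2 : ℂ) • D (muPow u)
      + ((u : ℂ) • muPow u - (1 / 4 : ℂ) • mulX (muPow u)) = 0 := by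
  ext φ
  rw [← schwartzFourier_inv φ]
  generalize schwartzFourierInv φ = ψ
  set d := SchwartzMap.derivCLM ℂ ℂ ψ with hd
  change muPow u (-SchwartzMap.derivCLM ℂ ℂ (-SchwartzMap.derivCLM ℂ ℂ
      (mulCoord (schwartzFourier ψ))))
    + 2 * muPow u (-SchwartzMap.derivCLM ℂ ℂ (schwartzFourier ψ))
    + (u * muPow u (schwartzFourier ψ) - 1 / 4 * muPow u (mulCoord (schwartzFourier ψ))) = 0
  rw [mulCoord_schwartzFourier, ← hd]
  simp only [deriv_schwartzFourier, map_neg, neg_neg, map_smul]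
  simp only [smul_eq_mul]
  -- Testing `symbol' = -iu / (λ² + 1/4) symbol` against `χ = (λ² + 1/4) ψ` clears the denominator.
  set χ := mulCoord (mulCoord ψ) + (1 / 4 : ℂ) • ψ with hχ
  have hχd : SchwartzMap.derivCLM ℂ ℂ χ
      = mulCoord (mulCoord d) + (2 : ℂ) • mulCoord ψ + (1 / 4 : ℂ) • d := by
    ext l
    have h1 : HasDerivAt (fun x : ℝ => (x : ℂ) * (x * ψ x) + 1 / 4 * ψ x)
        (1 * (l * ψ l) + l * (1 * ψ l + l * d l) + 1 / 4 * d l) l := by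
      have hx : HasDerivAt (fun x : ℝ => (x : ℂ)) 1 l := Complex.ofRealCLM.hasDerivAt
      exact (hx.mul (hx.mul (hasDerivAt_schwartz ψ l))).add
        ((hasDerivAt_schwartz ψ l).const_mul (1 / 4))
    have h2 : (χ : ℝ → ℂ) = fun x : ℝ => (x : ℂ) * (x * ψ x) + 1 / 4 * ψ x := by
      funext x
      simp [hχ, mulCoord_apply]
    have h3 := hasDerivAt_schwartz χ l
    rw [h2] at h3
    rw [h3.unique h1]
    simp only [mulCoord_apply, add_apply, smul_apply, smul_eq_mul]
    ring
  have key := integral_deriv_mul_symbol u χ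
  have hR : ∫ l : ℝ, Complex.I * u / ((l : ℂ) ^ 2 + 1 / 4) * (χ l * symbol u l)
      = Complex.I * u * ∫ l : ℝ, ψ l * symbol u l := by
    rw [← integral_const_mul]
    refine integral_congr_ae (Eventually.of_forall fun l => ?_)
    have := quarter_add_sq_ne_zero l
    have e : χ l = ((l : ℂ) ^ 2 + 1 / 4) * ψ l := by
      simp only [hχ, add_apply, smul_apply, mulCoord_apply, smul_eq_mul]
      ring
    simp only
    rw [e]
    generalize (l : ℂ) ^ 2 + 1 / 4 = q at this ⊢
    field_simp
  rw [← muPow_schwartzFourier, hχd, hR, ← muPow_schwartzFourier] at key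
  simp only [map_add, map_smul, smul_eq_mul] at key
  linear_combination Complex.I * key + (u * muPow u (schwartzFourier ψ)
    - Complex.I * muPow u (schwartzFourier (mulCoord (mulCoord d)))) * Complex.I_sq

/-! ### The symbol as a Cauchy integral -/

theorem half_one_add_le_norm (l : ℝ) {t : ℝ} (ht : 0 < t) :
    (1 + t) / 2 ≤ ‖((t : ℂ) + 1 / 2 + Complex.I * l)‖ := by
  have h := Complex.abs_re_le_norm ((t : ℂ) + 1 / 2 + Complex.I * l)
  have e : ((t : ℂ) + 1 / 2 + Complex.I * l).re = t + 1 / 2 := by simp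
  rw [e, abs_of_pos (by positivity)] at h
  linarith

theorem add_half_add_ne_zero (l : ℝ) {t : ℝ} (ht : 0 ≤ t) :
    (t : ℂ) + 1 / 2 + Complex.I * l ≠ 0 := by
  intro h
  have := congrArg Complex.re h
  simp at this
  linarith

theorem norm_inv_le (l : ℝ) {t : ℝ} (ht : 0 < t) :
    ‖((t : ℂ) + 1 / 2 + Complex.I * l)⁻¹‖ ≤ 2 / (1 + t) := by
  rw [norm_inv, inv_le_comm₀ (norm_pos_iff.2 (add_half_add_ne_zero l ht.le)) (by positivity),
    inv_div]
  exact half_one_add_le_norm l ht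

/-- The integrand `G^{-u}/(t + 1/2 + iλ) - G^u/(t + 1/2 - iλ)`, with `G = t / (1 + t)`. -/
noncomputable def cauchyKernel (u l t : ℝ) : ℂ :=
  (ratio t ^ (-u) : ℝ) * ((t : ℂ) + 1 / 2 + Complex.I * l)⁻¹
    - (ratio t ^ u : ℝ) * ((t : ℂ) + 1 / 2 + Complex.I * (-l : ℝ))⁻¹

/-- The derivative of `cauchyKernel` in the variable `λ`, up to the factor `-i`. -/
noncomputable def cauchyKernelSq (u l t : ℝ) : ℂ :=
  (ratio t ^ (-u) : ℝ) * (((t : ℂ) + 1 / 2 + Complex.I * l)⁻¹) ^ 2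
    + (ratio t ^ u : ℝ) * (((t : ℂ) + 1 / 2 + Complex.I * (-l : ℝ))⁻¹) ^ 2

/-- The Cauchy integral `∫ (G^{-u}/(t + 1/2 + iλ) - G^u/(t + 1/2 - iλ)) dt` over `(0, ∞)`. -/
noncomputable def cauchyIntegral (u l : ℝ) : ℂ := ∫ t in Set.Ioi (0 : ℝ), cauchyKernel u l t

theorem measurable_cauchyKernel (u l : ℝ) : Measurable (cauchyKernel u l) := by
  unfold cauchyKernel; fun_prop

theorem measurable_cauchyKernelSq (u l : ℝ) : Measurable (cauchyKernelSq u l) := by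
  unfold cauchyKernelSq; fun_prop

theorem ratio_rpow_eq_weight (p : ℝ) {t : ℝ} (ht : 0 < t) :
    ratio t ^ p = (1 + t) ^ 2 * weight p t := by
  rw [weight]; field_simp

theorem ratio_rpow_sub_le {u : ℝ} (hu : 0 < u) (hu1 : u < 1) {t : ℝ} (ht : 0 < t) :
    0 ≤ ratio t ^ (-u) - ratio t ^ u ∧
      ratio t ^ (-u) - ratio t ^ u ≤ 2 * (1 + t) * weight (-u) t := by
  have h0 := ratio_pos ht
  have h1 := abs_one_sub_ratio_rpow_le (p := u) (by rw [abs_of_pos hu]; exact hu1.le) ht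
  have h2 := abs_one_sub_ratio_rpow_le (p := -u) (by rw [abs_neg, abs_of_pos hu]; exact hu1.le) ht
  rw [abs_neg] at h2
  rw [abs_of_pos hu] at h1 h2
  have e : ratio t ^ (-u) / (1 + t) = (1 + t) * weight (-u) t := by rw [weight]; field_simp
  rw [e] at h1 h2
  refine ⟨sub_nonneg.2 (ratio_rpow_anti ht (by linarith)), ?_⟩
  have h3 := (abs_le.1 h1).2
  have h4 := (abs_le.1 h2).1
  linarith

theorem ratio_rpow_le_weight {u : ℝ} (hu : 0 < u) {t : ℝ} (ht : 0 < t) :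
    ratio t ^ u ≤ (1 + t) ^ 2 * weight (-u) t := by
  rw [← ratio_rpow_eq_weight _ ht]
  exact ratio_rpow_anti ht (by linarith)

/-- The kernel split into a part with an integrable difference of powers and a Poisson kernel. -/
theorem cauchyKernel_eq (u l : ℝ) {t : ℝ} (ht : 0 < t) :
    cauchyKernel u l t
      = (ratio t ^ (-u) - ratio t ^ u : ℝ) * ((t : ℂ) + 1 / 2 + Complex.I * l)⁻¹
        + (ratio t ^ u * (2 * l / ((t + 1 / 2) ^ 2 + l ^ 2)) : ℝ) * -Complex.I := by
  have h1 := add_half_add_ne_zero l ht.le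
  have h2 := add_half_add_ne_zero (-l) ht.le
  have e : (((t + 1 / 2) ^ 2 + l ^ 2 : ℝ) : ℂ)
      = ((t : ℂ) + 1 / 2 + Complex.I * l) * ((t : ℂ) + 1 / 2 + Complex.I * (-l : ℝ)) := by
    push_cast
    linear_combination (l : ℂ) ^ 2 * Complex.I_sq
  have e2 : ((t : ℂ) + 1 / 2 + Complex.I * l)⁻¹ - ((t : ℂ) + 1 / 2 + Complex.I * (-l : ℝ))⁻¹
      = (2 * l / ((t + 1 / 2) ^ 2 + l ^ 2) : ℝ) * -Complex.I := by
    rw [Complex.ofReal_div, e, inv_sub_inv h1 h2]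
    push_cast
    ring
  rw [cauchyKernel, Complex.ofReal_mul, mul_assoc, ← e2]
  push_cast
  ring

theorem norm_cauchyKernel_fst_le {u : ℝ} (hu : 0 < u) (hu1 : u < 1) (l : ℝ) {t : ℝ} (ht : 0 < t) :
    ‖((ratio t ^ (-u) - ratio t ^ u : ℝ) : ℂ) * ((t : ℂ) + 1 / 2 + Complex.I * l)⁻¹‖
      ≤ 4 * weight (-u) t := by
  obtain ⟨h0, h1⟩ := ratio_rpow_sub_le hu hu1 ht
  rw [norm_mul, Complex.norm_real, Real.norm_eq_abs, abs_of_nonneg h0]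
  calc _ ≤ 2 * (1 + t) * weight (-u) t * (2 / (1 + t)) :=
        mul_le_mul h1 (norm_inv_le l ht) (norm_nonneg _) (h0.trans h1)
    _ = 4 * weight (-u) t := by field_simp; ring

theorem norm_cauchyKernel_le {u : ℝ} (hu : 0 < u) (hu1 : u < 1) (l : ℝ) {t : ℝ} (ht : 0 < t) :
    ‖cauchyKernel u l t‖ ≤ 8 * (1 + |l|) * weight (-u) t := by
  have hw := weight_nonneg (-u) ht
  have h0 := ratio_pos ht
  rw [cauchyKernel_eq u l ht]
  refine (norm_add_le _ _).trans ?_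
  have h1 := norm_cauchyKernel_fst_le hu hu1 l ht
  have h2 : ‖((ratio t ^ u * (2 * l / ((t + 1 / 2) ^ 2 + l ^ 2)) : ℝ) : ℂ) * -Complex.I‖
      ≤ 8 * |l| * weight (-u) t := by
    rw [norm_mul, norm_neg, Complex.norm_I, mul_one, Complex.norm_real, Real.norm_eq_abs, abs_mul,
      abs_of_pos (by positivity), abs_div, abs_mul, abs_two,
      abs_of_pos (by positivity : 0 < (t + 1 / 2) ^ 2 + l ^ 2)]
    have h3 : 2 * |l| / ((t + 1 / 2) ^ 2 + l ^ 2) ≤ 8 * |l| / (1 + t) ^ 2 := by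
      rw [div_le_div_iff₀ (by positivity) (by positivity)]
      have : (1 + t) ^ 2 ≤ 4 * ((t + 1 / 2) ^ 2 + l ^ 2) := by nlinarith [sq_nonneg l]
      nlinarith [abs_nonneg l, mul_le_mul_of_nonneg_left this (abs_nonneg l)]
    calc _ ≤ (1 + t) ^ 2 * weight (-u) t * (8 * |l| / (1 + t) ^ 2) := by
          gcongr
          exact ratio_rpow_le_weight hu ht
      _ = 8 * |l| * weight (-u) t := by field_simp
  nlinarith

theorem norm_cauchyKernelSq_le {u : ℝ} (hu : 0 < u) (l : ℝ) {t : ℝ} (ht : 0 < t) :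
    ‖cauchyKernelSq u l t‖ ≤ 8 * weight (-u) t := by
  have h0 := ratio_pos ht
  have hw := weight_nonneg (-u) ht
  have key : ∀ (p l : ℝ), ratio t ^ p ≤ (1 + t) ^ 2 * weight (-u) t →
      ‖((ratio t ^ p : ℝ) : ℂ) * (((t : ℂ) + 1 / 2 + Complex.I * l)⁻¹) ^ 2‖
        ≤ 4 * weight (-u) t := by
    intro p l hp
    rw [norm_mul, norm_pow, Complex.norm_real, Real.norm_eq_abs, abs_of_pos (by positivity)]
    calc _ ≤ (1 + t) ^ 2 * weight (-u) t * (2 / (1 + t)) ^ 2 := by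
          gcongr
          exact norm_inv_le l ht
      _ = 4 * weight (-u) t := by field_simp; ring
  refine (norm_add_le _ _).trans ?_
  have h1 := key (-u) l (ratio_rpow_eq_weight _ ht).le
  have h2 := key u (-l) (ratio_rpow_le_weight hu ht)
  linarith

theorem integrableOn_cauchyKernel {u : ℝ} (hu : 0 < u) (hu1 : u < 1) (l : ℝ) :
    IntegrableOn (cauchyKernel u l) (Set.Ioi 0) := by
  refine ((integrableOn_weight (p := -u) (by linarith)).const_mul (8 * (1 + |l|))).mono'
    (measurable_cauchyKernel u l).aestronglyMeasurable ?_
  filter_upwards [ae_restrict_mem measurableSet_Ioi] with t ht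
  exact norm_cauchyKernel_le hu hu1 l ht

theorem integrableOn_cauchyKernelSq {u : ℝ} (hu : 0 < u) (hu1 : u < 1) (l : ℝ) :
    IntegrableOn (cauchyKernelSq u l) (Set.Ioi 0) := by
  refine ((integrableOn_weight (p := -u) (by linarith)).const_mul 8).mono'
    (measurable_cauchyKernelSq u l).aestronglyMeasurable ?_
  filter_upwards [ae_restrict_mem measurableSet_Ioi] with t ht
  exact norm_cauchyKernelSq_le hu l ht

theorem hasDerivAt_cauchyIntegral {u : ℝ} (hu : 0 < u) (hu1 : u < 1) (l : ℝ) :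
    HasDerivAt (cauchyIntegral u)
      (-Complex.I * ∫ t in Set.Ioi (0 : ℝ), cauchyKernelSq u l t) l := by
  have h := hasDerivAt_integral_of_dominated_loc_of_deriv_le (s := Set.univ)
    (μ := volume.restrict (Set.Ioi (0 : ℝ)))
    (F := cauchyKernel u) (F' := fun l t => -Complex.I * cauchyKernelSq u l t)
    (bound := fun t => 8 * weight (-u) t) (x₀ := l) univ_mem
    (Eventually.of_forall fun l => (measurable_cauchyKernel u l).aestronglyMeasurable)
    (integrableOn_cauchyKernel hu hu1 l)
    ((integrableOn_cauchyKernelSq hu hu1 l).const_mul _).aestronglyMeasurable ?_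
    ((integrableOn_weight (p := -u) (by linarith)).const_mul 8) ?_
  · rw [← integral_const_mul]
    exact h.2
  · filter_upwards [ae_restrict_mem measurableSet_Ioi] with t ht l _
    rw [norm_mul, norm_neg, Complex.norm_I, one_mul]
    exact norm_cauchyKernelSq_le hu l ht
  · filter_upwards [ae_restrict_mem measurableSet_Ioi] with t ht l _
    have ht0 : 0 ≤ t := le_of_lt ht
    have h1 : HasDerivAt (fun l : ℝ => (t : ℂ) + 1 / 2 + Complex.I * l) Complex.I l := by
      simpa using ((Complex.ofRealCLM.hasDerivAt (x := l)).const_mul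
        Complex.I).const_add ((t : ℂ) + 1 / 2)
    have h2 : HasDerivAt (fun l : ℝ => (t : ℂ) + 1 / 2 + Complex.I * (-l : ℝ)) (-Complex.I) l := by
      have := ((Complex.ofRealCLM.hasDerivAt (x := l)).const_mul
        (-Complex.I)).const_add ((t : ℂ) + 1 / 2)
      simpa using this
    have h3 := ((h1.inv (add_half_add_ne_zero l ht0)).const_mul ((ratio t ^ (-u) : ℝ) : ℂ)).sub
      ((h2.inv (add_half_add_ne_zero (-l) ht0)).const_mul ((ratio t ^ u : ℝ) : ℂ))
    refine h3.congr_deriv ?_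
    rw [cauchyKernelSq]
    simp only [inv_pow, div_eq_mul_inv]
    ring

/-- An antiderivative in `t` showing that `cauchyIntegral` solves a first order equation in `λ`; it
equals `t (1 + t) (G^{-u}/(t + 1/2 + iλ) + G^u/(t + 1/2 - iλ))`. -/
noncomputable def cauchyPrimitive (u l t : ℝ) : ℂ :=
  ((1 + t) ^ 2 * ratio t ^ (1 - u) : ℝ) * ((t : ℂ) + 1 / 2 + Complex.I * l)⁻¹
    + ((1 + t) ^ 2 * ratio t ^ (1 + u) : ℝ) * ((t : ℂ) + 1 / 2 + Complex.I * (-l : ℝ))⁻¹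

theorem hasDerivAt_one_add_sq_mul_ratio_rpow (u : ℝ) {t : ℝ} (ht : 0 < t) :
    HasDerivAt (fun t => (1 + t) ^ 2 * ratio t ^ (1 + u)) ((2 * t + 1 + u) * ratio t ^ u) t := by
  have h := (((hasDerivAt_id t).const_add 1).pow 2).mul (hasDerivAt_ratio_rpow (1 + u) ht)
  refine h.congr_deriv ?_
  have e : ratio t ^ (1 + u) = t / (1 + t) * ratio t ^ u := by
    rw [Real.rpow_add (ratio_pos ht), Real.rpow_one, ratio]
  simp only [Pi.pow_apply, id]
  rw [e, add_sub_cancel_left]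
  push_cast
  field_simp
  ring

theorem hasDerivAt_cauchyPrimitive (u l : ℝ) {t : ℝ} (ht : 0 < t) :
    HasDerivAt (cauchyPrimitive u l) ((ratio t ^ (-u) + ratio t ^ u : ℝ)
      + (((l : ℂ) ^ 2 + 1 / 4) * cauchyKernelSq u l t - u * cauchyKernel u l t)) t := by
  have key : ∀ p m : ℝ, HasDerivAt (fun t : ℝ => (((1 + t) ^ 2 * ratio t ^ (1 + p) : ℝ) : ℂ)
      * ((t : ℂ) + 1 / 2 + Complex.I * m)⁻¹)
      ((ratio t ^ p : ℝ) * (1 + p * ((t : ℂ) + 1 / 2 + Complex.I * m)⁻¹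
        + ((m : ℂ) ^ 2 + 1 / 4) * (((t : ℂ) + 1 / 2 + Complex.I * m)⁻¹) ^ 2)) t := by
    intro p m
    have hne := add_half_add_ne_zero m ht.le
    have h1 : HasDerivAt (fun t : ℝ => (t : ℂ) + 1 / 2 + Complex.I * m) 1 t := by
      simpa using ((Complex.ofRealCLM.hasDerivAt (x := t)).add_const (1 / 2 : ℂ)).add_const
        (Complex.I * m)
    have h2 := (hasDerivAt_one_add_sq_mul_ratio_rpow p ht).ofReal_comp.mul (h1.inv hne)
    refine h2.congr_deriv ?_
    have e : ratio t ^ (1 + p) = t / (1 + t) * ratio t ^ p := by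
      rw [Real.rpow_add (ratio_pos ht), Real.rpow_one, ratio]
    have e2 : (1 + t) ^ 2 * ratio t ^ (1 + p) = t * (1 + t) * ratio t ^ p := by
      rw [e]; field_simp
    rw [e2, Pi.inv_apply, div_eq_mul_inv (-1 : ℂ), ← inv_pow]
    have hy := mul_inv_cancel₀ hne
    generalize ((t : ℂ) + 1 / 2 + Complex.I * m)⁻¹ = y at hy ⊢
    push_cast
    linear_combination ((ratio t ^ p : ℝ) : ℂ) * (1 - ((t : ℂ) + 1 / 2 + Complex.I * m) * y
      + 2 * Complex.I * m * y) * hy - ((ratio t ^ p : ℝ) : ℂ) * m ^ 2 * y ^ 2 * Complex.I_sq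
  have h := (key (-u) l).add (key u (-l))
  rw [← sub_eq_add_neg] at h
  refine h.congr_deriv ?_
  rw [cauchyKernelSq, cauchyKernel]
  push_cast
  ring

theorem tendsto_cauchyPrimitive_sub (u l : ℝ) :
    Tendsto (fun t => cauchyPrimitive u l t - cauchyPrimitive u 0 t) atTop (𝓝 0) := by
  have hinv : ∀ m : ℝ, Tendsto (fun t : ℝ => (1 + t : ℂ) * ((t : ℂ) + 1 / 2 + Complex.I * m)⁻¹)
      atTop (𝓝 1) := by
    intro m
    have h1 : Tendsto (fun t : ℝ => ((t : ℂ) + 1 / 2 + Complex.I * m)⁻¹) atTop (𝓝 0) := by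
      refine squeeze_zero_norm' (a := fun t : ℝ => 2 / (1 + t)) ?_ ?_
      · filter_upwards [eventually_gt_atTop 0] with t ht using norm_inv_le m ht
      · exact (tendsto_atTop_add_const_left _ 1 tendsto_id).const_div_atTop 2
    have h2 := (h1.const_mul (1 / 2 - Complex.I * m)).const_add 1
    rw [mul_zero, add_zero] at h2
    refine h2.congr' ?_
    filter_upwards [eventually_gt_atTop 0] with t ht
    have := add_half_add_ne_zero m ht.le
    rw [show (1 + t : ℂ) = ((t : ℂ) + 1 / 2 + Complex.I * m) + (1 / 2 - Complex.I * m) by ring,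
      add_mul, mul_inv_cancel₀ this]
  have hpow : ∀ p : ℝ, Tendsto (fun t => ((ratio t ^ p : ℝ) : ℂ)) atTop (𝓝 1) := fun p => by
    have := (Complex.continuous_ofReal.tendsto 1).comp (tendsto_ratio_rpow p)
    rwa [Complex.ofReal_one] at this
  have h := (((hpow (1 - u)).mul ((hinv 0).mul (hinv l))).mul_const (-Complex.I * l)).add
    (((hpow (1 + u)).mul ((hinv 0).mul (hinv (-l)))).mul_const (Complex.I * l))
  rw [show (1 : ℂ) * (1 * 1) * (-Complex.I * l) + 1 * (1 * 1) * (Complex.I * l) = 0 by ring] at h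
  refine h.congr' ?_
  filter_upwards [eventually_gt_atTop 0] with t ht
  have h0 := add_half_add_ne_zero 0 ht.le
  have h1 := add_half_add_ne_zero l ht.le
  have h2 := add_half_add_ne_zero (-l) ht.le
  have key : ∀ m : ℝ, (t : ℂ) + 1 / 2 + Complex.I * m ≠ 0 →
      ((t : ℂ) + 1 / 2 + Complex.I * m)⁻¹ - ((t : ℂ) + 1 / 2 + Complex.I * (0 : ℝ))⁻¹
      = ((t : ℂ) + 1 / 2 + Complex.I * (0 : ℝ))⁻¹ * ((t : ℂ) + 1 / 2 + Complex.I * m)⁻¹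
        * (-Complex.I * m) := by
    intro m hm
    rw [inv_sub_inv hm h0]
    field_simp
    push_cast
    ring
  have k1 := key l h1
  have k2 := key (-l) h2
  rw [cauchyPrimitive, cauchyPrimitive, neg_zero]
  push_cast at k1 k2 ⊢
  linear_combination -((1 + t : ℂ) ^ 2 * ((ratio t ^ (1 - u) : ℝ) : ℂ)) * k1
    - ((1 + t : ℂ) ^ 2 * ((ratio t ^ (1 + u) : ℝ) : ℂ)) * k2

/-- The first order differential equation of `cauchyIntegral`, whose derivative is `-i` times the
integral of `cauchyKernelSq`: the left-hand side has the same value at `l` and at `0`. Values are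
compared because the derivative of `cauchyPrimitive` is integrable only after a difference. -/
theorem cauchyIntegral_ode {u : ℝ} (hu : 0 < u) (hu1 : u < 1) (l : ℝ) :
    ((l : ℂ) ^ 2 + 1 / 4) * (∫ t in Set.Ioi (0 : ℝ), cauchyKernelSq u l t)
        - u * cauchyIntegral u l
      = 1 / 4 * (∫ t in Set.Ioi (0 : ℝ), cauchyKernelSq u 0 t) - u * cauchyIntegral u 0 := by
  have hS := fun l => integrableOn_cauchyKernelSq hu hu1 l
  have hK := fun l => integrableOn_cauchyKernel hu hu1 l
  have hE : ∀ l : ℝ, IntegrableOn (fun t => ((l : ℂ) ^ 2 + 1 / 4) * cauchyKernelSq u l t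
      - u * cauchyKernel u l t) (Set.Ioi 0) := fun l =>
    ((hS l).const_mul _).sub ((hK l).const_mul _)
  have hI : ∀ l : ℝ, ∫ t in Set.Ioi (0 : ℝ), (((l : ℂ) ^ 2 + 1 / 4) * cauchyKernelSq u l t
      - u * cauchyKernel u l t) = ((l : ℂ) ^ 2 + 1 / 4)
        * (∫ t in Set.Ioi (0 : ℝ), cauchyKernelSq u l t) - u * cauchyIntegral u l := fun l => by
    rw [integral_sub ((hS l).const_mul _) ((hK l).const_mul _), integral_const_mul,
      integral_const_mul, cauchyIntegral]
  have h := integral_Ioi_of_hasDerivAt_of_tendsto (a := 0) (m := 0)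
    (f := fun t => cauchyPrimitive u l t - cauchyPrimitive u 0 t)
    (f' := fun t => (((l : ℂ) ^ 2 + 1 / 4) * cauchyKernelSq u l t - u * cauchyKernel u l t)
      - ((((0 : ℝ) : ℂ) ^ 2 + 1 / 4) * cauchyKernelSq u 0 t - u * cauchyKernel u 0 t)) ?_ ?_
    ((hE l).sub (hE 0)) (tendsto_cauchyPrimitive_sub u l)
  · rw [integral_sub (hE l) (hE 0), hI, hI] at h
    have e : ∀ m : ℝ, cauchyPrimitive u m 0 = 0 := fun m => by
      rw [cauchyPrimitive, ratio_zero, Real.zero_rpow (by linarith), Real.zero_rpow (by linarith)]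
      simp
    rw [e, e] at h
    simp only [Complex.ofReal_zero] at h
    linear_combination h
  · have hc : ∀ m : ℝ, ContinuousAt (cauchyPrimitive u m) 0 := by
      intro m
      have hr : ∀ p : ℝ, 0 ≤ p → ContinuousAt (fun t => (1 + t) ^ 2 * ratio t ^ p) 0 := fun p hp =>
        ContinuousAt.mul (by fun_prop) ((continuousAt_ratio le_rfl).rpow_const (Or.inr hp))
      have hi : ∀ m : ℝ, ContinuousAt (fun t : ℝ => ((t : ℂ) + 1 / 2 + Complex.I * m)⁻¹) 0 :=
        fun m => ContinuousAt.inv₀ (by fun_prop) (add_half_add_ne_zero m le_rfl)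
      exact ((Complex.continuous_ofReal.continuousAt.comp (hr (1 - u) (by linarith))).mul
        (hi m)).add ((Complex.continuous_ofReal.continuousAt.comp (hr (1 + u) (by linarith))).mul
        (hi (-m)))
    exact ((hc l).sub (hc 0)).continuousWithinAt
  · intro t ht
    refine ((hasDerivAt_cauchyPrimitive u l ht).sub
      (hasDerivAt_cauchyPrimitive u 0 ht)).congr_deriv ?_
    ring

theorem integral_poisson {l : ℝ} (hl : 0 < l) :
    IntegrableOn (fun t : ℝ => 2 * l / ((t + 1 / 2) ^ 2 + l ^ 2)) (Set.Ioi 0) ∧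
    ∫ t in Set.Ioi (0 : ℝ), 2 * l / ((t + 1 / 2) ^ 2 + l ^ 2)
      = Real.pi - 2 * Real.arctan (1 / 2 / l) := by
  have hd : ∀ t ∈ Set.Ici (0 : ℝ), HasDerivAt (fun t => 2 * Real.arctan ((t + 1 / 2) / l))
      (2 * l / ((t + 1 / 2) ^ 2 + l ^ 2)) t := by
    intro t _
    have h := ((((hasDerivAt_id t).add_const (1 / 2)).div_const l).arctan).const_mul 2
    refine h.congr_deriv ?_
    simp only [id]
    field_simp
    ring
  have ht : Tendsto (fun t => 2 * Real.arctan ((t + 1 / 2) / l)) atTop (𝓝 Real.pi) := by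
    have h1 : Tendsto (fun t : ℝ => (t + 1 / 2) / l) atTop atTop :=
      (tendsto_atTop_add_const_right _ _ tendsto_id).atTop_div_const hl
    have h2 := ((Real.tendsto_arctan_atTop.mono_right nhdsWithin_le_nhds).comp h1).const_mul 2
    rwa [mul_div_cancel₀ _ (two_ne_zero)] at h2
  have hi := integrableOn_Ioi_deriv_of_nonneg' hd (fun t _ => by positivity) ht
  refine ⟨hi, ?_⟩
  rw [integral_Ioi_of_hasDerivAt_of_tendsto' hd hi ht]
  simp

/-- The first part of `cauchyKernel_eq` tends to `0` by dominated convergence. In the second part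
`ratio t ^ u` may be replaced by `1`, which leaves a Poisson integral of limit `π`. -/
theorem tendsto_cauchyIntegral {u : ℝ} (hu : 0 < u) (hu1 : u < 1) :
    Tendsto (cauchyIntegral u) atTop (𝓝 (-Complex.I * Real.pi)) := by
  have hw := integrableOn_weight (p := -u) (by linarith)
  have hA : Tendsto (fun l : ℝ => ∫ t in Set.Ioi (0 : ℝ),
      ((ratio t ^ (-u) - ratio t ^ u : ℝ) : ℂ) * ((t : ℂ) + 1 / 2 + Complex.I * l)⁻¹) atTop
      (𝓝 (∫ _t in Set.Ioi (0 : ℝ), (0 : ℂ))) := by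
    refine tendsto_integral_filter_of_dominated_convergence (fun t => 4 * weight (-u) t)
      (Eventually.of_forall fun l => Measurable.aestronglyMeasurable (by fun_prop))
      (Eventually.of_forall fun l => ?_) (hw.const_mul 4) (Eventually.of_forall fun t => ?_)
    · filter_upwards [ae_restrict_mem measurableSet_Ioi] with t ht
      exact norm_cauchyKernel_fst_le hu hu1 l ht
    · have h : Tendsto (fun l : ℝ => ((t : ℂ) + 1 / 2 + Complex.I * l)⁻¹) atTop (𝓝 0) := by
        refine squeeze_zero_norm' (a := fun l : ℝ => l⁻¹) ?_ tendsto_inv_atTop_zero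
        filter_upwards [eventually_gt_atTop 0] with l hl
        rw [norm_inv]
        refine inv_anti₀ hl ?_
        have h := Complex.abs_im_le_norm ((t : ℂ) + 1 / 2 + Complex.I * l)
        have e : ((t : ℂ) + 1 / 2 + Complex.I * l).im = l := by simp
        rwa [e, abs_of_pos hl] at h
      simpa using h.const_mul ((ratio t ^ (-u) - ratio t ^ u : ℝ) : ℂ)
  have hBbound : ∀ l : ℝ, 0 < l → ∀ t ∈ Set.Ioi (0 : ℝ),
      ‖(1 - ratio t ^ u) * (2 * l / ((t + 1 / 2) ^ 2 + l ^ 2))‖ ≤ 2 * weight (-u) t := by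
    intro l hl t ht
    have ht0 : 0 < t := ht
    have h1 := abs_one_sub_ratio_rpow_le (p := u) (by rw [abs_of_pos hu]; exact hu1.le) ht0
    rw [abs_of_pos hu] at h1
    have h2 : 2 * l / ((t + 1 / 2) ^ 2 + l ^ 2) ≤ 2 / (1 + t) := by
      rw [div_le_div_iff₀ (by positivity) (by positivity)]
      nlinarith [sq_nonneg (t + 1 / 2 - l)]
    have h0 := ratio_pos ht0
    rw [norm_mul, Real.norm_eq_abs, Real.norm_eq_abs,
      abs_of_nonneg (by positivity : 0 ≤ 2 * l / ((t + 1 / 2) ^ 2 + l ^ 2))]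
    calc _ ≤ ratio t ^ (-u) / (1 + t) * (2 / (1 + t)) := by gcongr
      _ = 2 * weight (-u) t := by rw [weight]; field_simp
  have hBmeas : ∀ l : ℝ, AEStronglyMeasurable
      (fun t => (1 - ratio t ^ u) * (2 * l / ((t + 1 / 2) ^ 2 + l ^ 2)))
      (volume.restrict (Set.Ioi (0 : ℝ))) := fun l =>
    Measurable.aestronglyMeasurable (by fun_prop)
  have hB : Tendsto (fun l : ℝ => ∫ t in Set.Ioi (0 : ℝ),
      (1 - ratio t ^ u) * (2 * l / ((t + 1 / 2) ^ 2 + l ^ 2))) atTop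
      (𝓝 (∫ _t in Set.Ioi (0 : ℝ), (0 : ℝ))) := by
    refine tendsto_integral_filter_of_dominated_convergence (fun t => 2 * weight (-u) t)
      (Eventually.of_forall hBmeas) ?_ (hw.const_mul 2) (Eventually.of_forall fun t => ?_)
    · filter_upwards [eventually_gt_atTop 0] with l hl
      filter_upwards [ae_restrict_mem measurableSet_Ioi] with t ht using hBbound l hl t ht
    · have h : Tendsto (fun l : ℝ => 2 * l / ((t + 1 / 2) ^ 2 + l ^ 2)) atTop (𝓝 0) := by
        refine squeeze_zero' (g := fun l : ℝ => 2 * l⁻¹) ?_ ?_ ?_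
        · filter_upwards [eventually_gt_atTop 0] with l hl
          positivity
        · filter_upwards [eventually_gt_atTop 0] with l hl
          rw [div_le_iff₀ (by positivity)]
          field_simp
          nlinarith [sq_nonneg (t + 1 / 2)]
        · simpa using tendsto_inv_atTop_zero.const_mul (2 : ℝ)
      simpa using h.const_mul (1 - ratio t ^ u)
  rw [integral_zero] at hA hB
  have hP : Tendsto (fun l : ℝ => Real.pi - 2 * Real.arctan (1 / 2 / l)) atTop (𝓝 Real.pi) := by
    have h1 : Tendsto (fun l : ℝ => 1 / 2 / l) atTop (𝓝 0) := tendsto_id.const_div_atTop _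
    have h2 := ((Real.continuous_arctan.tendsto 0).comp h1).const_mul 2
    rw [Real.arctan_zero, mul_zero] at h2
    simpa using h2.const_sub Real.pi
  have h := hA.add (((Complex.continuous_ofReal.tendsto _).comp (hP.sub hB)).mul_const (-Complex.I))
  rw [zero_add, sub_zero, mul_comm] at h
  refine h.congr' ?_
  filter_upwards [eventually_gt_atTop 0] with l hl
  obtain ⟨hpi, hpv⟩ := integral_poisson hl
  have hBi : IntegrableOn (fun t => (1 - ratio t ^ u) * (2 * l / ((t + 1 / 2) ^ 2 + l ^ 2)))
      (Set.Ioi 0) := by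
    refine (hw.const_mul 2).mono' (hBmeas l) ?_
    filter_upwards [ae_restrict_mem measurableSet_Ioi] with t ht using hBbound l hl t ht
  have hAi : IntegrableOn (fun t : ℝ =>
      ((ratio t ^ (-u) - ratio t ^ u : ℝ) : ℂ) * ((t : ℂ) + 1 / 2 + Complex.I * l)⁻¹)
      (Set.Ioi 0) := by
    refine (hw.const_mul 4).mono' (Measurable.aestronglyMeasurable (by fun_prop)) ?_
    filter_upwards [ae_restrict_mem measurableSet_Ioi] with t ht
    exact norm_cauchyKernel_fst_le hu hu1 l ht
  have hCi : IntegrableOn (fun t : ℝ => ((2 * l / ((t + 1 / 2) ^ 2 + l ^ 2)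
      - (1 - ratio t ^ u) * (2 * l / ((t + 1 / 2) ^ 2 + l ^ 2)) : ℝ) : ℂ) * -Complex.I)
      (Set.Ioi 0) := ((hpi.sub hBi).ofReal (𝕜 := ℂ)).mul_const (-Complex.I)
  simp only [Function.comp_apply]
  rw [← hpv, ← integral_sub hpi hBi, ← integral_complex_ofReal, ← integral_mul_const,
    ← integral_add hAi hCi, cauchyIntegral]
  refine setIntegral_congr_fun measurableSet_Ioi fun t ht => ?_
  rw [cauchyKernel_eq u l ht]
  push_cast
  ring

theorem cauchyIntegral_neg (u l : ℝ) :
    cauchyIntegral u (-l) = (starRingEnd ℂ) (cauchyIntegral u l) := by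
  rw [cauchyIntegral, cauchyIntegral, ← integral_conj]
  refine integral_congr_ae (Eventually.of_forall fun t => ?_)
  simp only [cauchyKernel, map_sub, map_mul, map_inv₀, map_add, Complex.conj_ofReal, Complex.conj_I,
    map_div₀, map_one, map_ofNat]
  push_cast
  ring_nf

theorem symbol_neg (u l : ℝ) : symbol u (-l) = (starRingEnd ℂ) (symbol u l) := by
  rw [symbol, symbol, ← Complex.exp_conj, mul_neg, Real.arctan_neg]
  congr 1
  simp only [map_mul, map_neg, Complex.conj_ofReal, Complex.conj_I, map_ofNat]
  push_cast
  ring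

theorem tendsto_symbol (u : ℝ) :
    Tendsto (symbol u) atTop (𝓝 (Complex.exp (-(Real.pi * u : ℝ) * Complex.I))) := by
  have h1 := (Real.tendsto_arctan_atTop.mono_right nhdsWithin_le_nhds).comp
    (tendsto_id.const_mul_atTop (two_pos (α := ℝ)))
  have h2 := (Complex.continuous_exp.tendsto _).comp
    (((Complex.continuous_ofReal.tendsto _).comp h1).const_mul (-2 * Complex.I * u))
  have e : -((Real.pi * u : ℝ) : ℂ) * Complex.I = -2 * Complex.I * u * (Real.pi / 2 : ℝ) := by
    push_cast
    ring
  rw [e]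
  exact h2

theorem symbol_neg_left_mul (u l : ℝ) : symbol (-u) l * symbol u l = 1 := by
  rw [symbol, symbol, ← Complex.exp_add, ← Complex.exp_zero]
  congr 1
  push_cast
  ring

/-- The Cauchy integral representation of the symbol. The first order equation determines
`cauchyIntegral` up to two constants, which the limits at `±∞` then fix. -/
theorem symbol_eq_cauchyIntegral {u : ℝ} (hu : 0 < u) (hu1 : u < 1) (l : ℝ) :
    symbol u l = Real.cos (Real.pi * u)
      + (Real.sin (Real.pi * u) / Real.pi : ℝ) * cauchyIntegral u l := by
  obtain ⟨E, hE⟩ : ∃ E : ℂ, ∀ l : ℝ, ((l : ℂ) ^ 2 + 1 / 4)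
      * (∫ t in Set.Ioi (0 : ℝ), cauchyKernelSq u l t) - u * cauchyIntegral u l = E :=
    ⟨_, fun l => cauchyIntegral_ode hu hu1 l⟩
  have huc : (u : ℂ) ≠ 0 := by exact_mod_cast hu.ne'
  have hder : ∀ l : ℝ,
      HasDerivAt (fun l => (cauchyIntegral u l + E / u) * symbol (-u) l) 0 l := by
    intro l
    refine (((hasDerivAt_cauchyIntegral hu hu1 l).add_const (E / u)).mul
      (hasDerivAt_symbol (-u) l)).congr_deriv ?_
    have hq := quarter_add_sq_ne_zero l
    have h := hE l
    generalize ∫ t in Set.Ioi (0 : ℝ), cauchyKernelSq u l t = S at h ⊢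
    rw [← h]
    push_cast
    generalize (l : ℂ) ^ 2 + 1 / 4 = q at hq ⊢
    field_simp
    ring
  obtain ⟨C, hC⟩ : ∃ C : ℂ, ∀ l : ℝ, (cauchyIntegral u l + E / u) * symbol (-u) l = C :=
    ⟨_, fun l => is_const_of_deriv_eq_zero (fun l => (hder l).differentiableAt)
      (fun l => (hder l).deriv) l 0⟩
  have hK : ∀ l : ℝ, cauchyIntegral u l = C * symbol u l - E / u := by
    intro l
    rw [← hC l, mul_assoc, symbol_neg_left_mul]
    ring
  have hlim1 : C * Complex.exp (-(Real.pi * u : ℝ) * Complex.I) - E / u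
      = -Complex.I * Real.pi := by
    refine tendsto_nhds_unique (((tendsto_symbol u).const_mul C).sub_const (E / u)) ?_
    exact (tendsto_cauchyIntegral hu hu1).congr hK
  have hlim2 : C * (starRingEnd ℂ) (Complex.exp (-(Real.pi * u : ℝ) * Complex.I)) - E / u
      = (starRingEnd ℂ) (-Complex.I * Real.pi) := by
    refine tendsto_nhds_unique
      (((((Complex.continuous_conj.tendsto _).comp (tendsto_symbol u))).const_mul C).sub_const
        (E / u)) ?_
    refine ((Complex.continuous_conj.tendsto _).comp (tendsto_cauchyIntegral hu hu1)).congr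
      fun l => ?_
    simp only [Function.comp_apply]
    rw [← cauchyIntegral_neg, ← symbol_neg, hK]
  have hexp : Complex.exp (-(Real.pi * u : ℝ) * Complex.I)
      = Real.cos (Real.pi * u) - Real.sin (Real.pi * u) * Complex.I := by
    rw [← Complex.ofReal_neg, Complex.exp_mul_I, ← Complex.ofReal_cos, ← Complex.ofReal_sin,
      Real.cos_neg, Real.sin_neg]
    push_cast
    ring
  rw [hexp] at hlim1 hlim2
  simp only [map_sub, map_mul, map_neg, Complex.conj_ofReal, Complex.conj_I] at hlim2
  have hsin : C * Real.sin (Real.pi * u) = Real.pi := by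
    have h : (2 * Complex.I) * (C * Real.sin (Real.pi * u)) = (2 * Complex.I) * Real.pi := by
      linear_combination hlim2 - hlim1
    exact mul_left_cancel₀ (mul_ne_zero two_ne_zero Complex.I_ne_zero) h
  have hcos : E / u = C * Real.cos (Real.pi * u) := by
    linear_combination -(1 / 2 : ℂ) * (hlim1 + hlim2)
  have hpi : (Real.pi : ℂ) ≠ 0 := by exact_mod_cast Real.pi_ne_zero
  rw [hK, hcos, Complex.ofReal_div, div_mul_eq_mul_div, ← mul_sub, ← mul_assoc,
    mul_comm _ C, hsin]
  field_simp
  ring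

/-! ### Pairing the Laplace integrals with test functions -/

theorem integrable_one_add_abs_mul (ψ : 𝓢(ℝ, ℂ)) :
    Integrable fun l : ℝ => (1 + |l|) * ‖ψ l‖ := by
  refine (ψ.integrable.norm.add (mulCoord ψ).integrable.norm).congr
    (Eventually.of_forall fun l => ?_)
  simp only [Pi.add_apply, mulCoord_apply, norm_mul, Complex.norm_real, Real.norm_eq_abs]
  ring

/-- The Laplace transform of the restriction of a Fourier transform to a half-line, as a Cauchy
integral; `s = 1` and `s = -1` give the two half-lines. -/
theorem integral_exp_mul_schwartzFourier (ψ : 𝓢(ℝ, ℂ)) (s : ℝ) {t : ℝ} (ht : 0 < t) :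
    ∫ x in Set.Ioi (0 : ℝ), (Real.exp (-(t + 1 / 2) * x) : ℂ) * schwartzFourier ψ (s * x)
      = ∫ l : ℝ, ψ l * ((t : ℂ) + 1 / 2 + Complex.I * (s * l : ℝ))⁻¹ := by
  have hτ : 0 < t + 1 / 2 := by positivity
  set F : ℝ → ℝ → ℂ := fun x l =>
    (Real.exp (-(t + 1 / 2) * x) : ℂ) * (Complex.exp (-Complex.I * (s * x : ℝ) * l) * ψ l) with hF
  have hFint : Integrable (Function.uncurry F) ((volume.restrict (Set.Ioi 0)).prod volume) := by
    refine ((integrableOn_exp_neg_mul_Ioi hτ).mul_prod ψ.integrable.norm).mono' ?_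
      (Eventually.of_forall fun z => ?_)
    · refine Continuous.aestronglyMeasurable ?_
      have := ψ.continuous
      simp only [hF, Function.uncurry_def]
      fun_prop
    · simp only [hF, Function.uncurry_def]
      rw [norm_mul, norm_mul, norm_exp_neg_I_mul, one_mul, Complex.norm_real, Real.norm_eq_abs,
        abs_of_pos (Real.exp_pos _)]
  calc ∫ x in Set.Ioi (0 : ℝ), (Real.exp (-(t + 1 / 2) * x) : ℂ) * schwartzFourier ψ (s * x)
      = ∫ x in Set.Ioi (0 : ℝ), ∫ l : ℝ, F x l := by
        refine integral_congr_ae (Eventually.of_forall fun x => ?_)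
        simp only [hF]
        rw [integral_const_mul, schwartzFourier_apply]
    _ = ∫ l : ℝ, ∫ x in Set.Ioi (0 : ℝ), F x l := integral_integral_swap hFint
    _ = _ := by
        refine integral_congr_ae (Eventually.of_forall fun l => ?_)
        set a : ℂ := -((t : ℂ) + 1 / 2 + Complex.I * (s * l : ℝ)) with ha
        have hre : a.re < 0 := by
          simp [ha]
          linarith
        have h := integral_exp_mul_complex_Ioi hre 0
        have e : ∀ x : ℝ, F x l = ψ l * Complex.exp (a * x) := fun x => by
          simp only [hF]
          rw [← mul_assoc, Complex.ofReal_exp, ← Complex.exp_add, mul_comm]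
          congr 2
          rw [ha]
          push_cast
          ring
        simp only [e]
        rw [integral_const_mul, h, Complex.ofReal_zero, mul_zero, Complex.exp_zero, ha,
          neg_div_neg_eq, one_div]

/-- The integrand of the double integral linking the Laplace integrals, integrated in `t` first,
and the Cauchy integral, integrated in `x` first. -/
noncomputable def testKernel (u : ℝ) (φ : 𝓢(ℝ, ℂ)) (t x : ℝ) : ℂ :=
  (Real.exp (-(t + 1 / 2) * x) : ℂ)
    * ((ratio t ^ (-u) : ℝ) * φ x - (ratio t ^ u : ℝ) * φ (-x))

theorem exists_schwartz_bound (φ : 𝓢(ℝ, ℂ)) :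
    ∃ M, 0 ≤ M ∧ (∀ x, ‖φ x‖ ≤ M) ∧ ∀ x, 0 < x → ‖φ x - φ (-x)‖ ≤ M * x := by
  set M₀ := SchwartzMap.seminorm ℂ 0 0 φ
  set M₁ := SchwartzMap.seminorm ℂ 0 1 φ
  have h0 : 0 ≤ M₀ := apply_nonneg _ _
  have h1 : 0 ≤ M₁ := apply_nonneg _ _
  refine ⟨M₀ + 2 * M₁, by positivity, fun x => ?_, fun x hx => ?_⟩
  · have := SchwartzMap.le_seminorm' ℂ 0 0 φ x
    simp only [pow_zero, one_mul, iteratedDeriv_zero] at this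
    linarith
  · have hd : ∀ y, ‖deriv φ y‖ ≤ M₁ := fun y => by
      have := SchwartzMap.le_seminorm' ℂ 0 1 φ y
      simpa only [pow_zero, one_mul, iteratedDeriv_one] using this
    have h2 : ‖φ x - φ (-x)‖ ≤ M₁ * ‖x - -x‖ :=
      Convex.norm_image_sub_le_of_norm_deriv_le (s := Set.univ)
        (fun y _ => φ.differentiableAt) (fun y _ => hd y) convex_univ trivial trivial
    rw [Real.norm_eq_abs, show x - -x = 2 * x by ring, abs_of_pos (by positivity)] at h2
    nlinarith [mul_nonneg h0 hx.le]

/-- The kernel is the sum of `G^{-u} (φ x - φ (-x))`, small for small `x`, and of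
`(G^{-u} - G^u) φ (-x)`, small for large `t`, both multiplied by `e^{-(t + 1/2) x}`. -/
theorem exists_norm_testKernel_le {u : ℝ} (hu : 0 < u) (hu1 : u < 1) (φ : 𝓢(ℝ, ℂ)) :
    ∃ M, 0 ≤ M ∧ ∀ t x, 0 < t → 0 < x → ‖testKernel u φ t x‖
      ≤ M * ((1 + t) * weight (-u) t) * Real.exp (-((1 + t) / 4) * x) := by
  obtain ⟨M, hM, hb, hl⟩ := exists_schwartz_bound φ
  refine ⟨6 * M, by positivity, fun t x ht hx => ?_⟩
  obtain ⟨hd0, hd1⟩ := ratio_rpow_sub_le hu hu1 ht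
  have hw := weight_nonneg (-u) ht
  have hr := ratio_pos ht
  set E := Real.exp (-((1 + t) / 4) * x) with hE
  have hE0 : 0 < E := Real.exp_pos _
  have hE1 : E ≤ 1 := Real.exp_le_one_iff.2 (by nlinarith)
  have h1 : Real.exp (-(t + 1 / 2) * x) ≤ E * E := by
    rw [hE, ← Real.exp_add]
    exact Real.exp_le_exp.2 (by nlinarith)
  have h2 : x * E ≤ 4 / (1 + t) := by
    have h3 := Real.add_one_le_exp ((1 + t) / 4 * x)
    rw [hE, neg_mul, Real.exp_neg, ← div_eq_mul_inv, div_le_div_iff₀ (Real.exp_pos _)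
      (by positivity)]
    nlinarith
  have e : (ratio t ^ (-u) : ℝ) * φ x - (ratio t ^ u : ℝ) * φ (-x)
      = (ratio t ^ (-u) : ℝ) * (φ x - φ (-x))
        + (ratio t ^ (-u) - ratio t ^ u : ℝ) * φ (-x) := by
    push_cast
    ring
  have h4 : ‖(ratio t ^ (-u) : ℝ) * φ x - (ratio t ^ u : ℝ) * φ (-x)‖
      ≤ (1 + t) ^ 2 * weight (-u) t * (M * x) + 2 * (1 + t) * weight (-u) t * M := by
    rw [e]
    refine (norm_add_le _ _).trans ?_
    rw [norm_mul, norm_mul, Complex.norm_real, Complex.norm_real, Real.norm_eq_abs,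
      Real.norm_eq_abs, abs_of_nonneg hd0, abs_of_pos (by positivity), ratio_rpow_eq_weight _ ht]
    rw [ratio_rpow_eq_weight (-u) ht] at hd1
    gcongr
    · exact hl x hx
    · exact hb _
  rw [testKernel, norm_mul, Complex.norm_real, Real.norm_eq_abs, abs_of_pos (Real.exp_pos _)]
  calc _ ≤ E * E * ((1 + t) ^ 2 * weight (-u) t * (M * x) + 2 * (1 + t) * weight (-u) t * M) := by
        gcongr
    _ = M * ((1 + t) * weight (-u) t) * E * ((1 + t) * (x * E) + 2 * E) := by ring
    _ ≤ M * ((1 + t) * weight (-u) t) * E * ((1 + t) * (4 / (1 + t)) + 2 * 1) := by gcongr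
    _ = 6 * M * ((1 + t) * weight (-u) t) * E := by field_simp; ring

theorem measurable_testKernel (u : ℝ) (φ : 𝓢(ℝ, ℂ)) :
    Measurable (Function.uncurry (testKernel u φ)) := by
  have h1 := φ.continuous.measurable
  have h2 : Measurable fun z : ℝ × ℝ => ratio z.1 ^ u :=
    (measurable_ratio_rpow u).comp measurable_fst
  have h3 : Measurable fun z : ℝ × ℝ => ratio z.1 ^ (-u) :=
    (measurable_ratio_rpow (-u)).comp measurable_fst
  unfold testKernel Function.uncurry
  fun_prop

theorem integrable_testKernel {u : ℝ} (hu : 0 < u) (hu1 : u < 1) (φ : 𝓢(ℝ, ℂ)) :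
    Integrable (Function.uncurry (testKernel u φ))
      ((volume.restrict (Set.Ioi 0)).prod (volume.restrict (Set.Ioi 0))) := by
  obtain ⟨M, hM, hb⟩ := exists_norm_testKernel_le hu hu1 φ
  have hm := measurable_testKernel u φ
  have hE : ∀ t : ℝ, 0 < t → IntegrableOn (fun x => M * ((1 + t) * weight (-u) t)
      * Real.exp (-((1 + t) / 4) * x)) (Set.Ioi 0) := fun t ht =>
    (integrableOn_exp_neg_mul_Ioi (by positivity)).const_mul _
  refine (integrable_prod_iff hm.aestronglyMeasurable).2 ⟨?_, ?_⟩
  · filter_upwards [ae_restrict_mem measurableSet_Ioi] with t ht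
    refine (hE t ht).mono' (hm.comp measurable_prodMk_left).aestronglyMeasurable ?_
    filter_upwards [ae_restrict_mem measurableSet_Ioi] with x hx
    exact hb t x ht hx
  · refine Integrable.mono' ((integrableOn_weight (p := -u) (by linarith)).const_mul (4 * M))
      hm.aestronglyMeasurable.norm.integral_prod_right' ?_
    filter_upwards [ae_restrict_mem measurableSet_Ioi] with t ht
    have ht0 : 0 < t := ht
    rw [Real.norm_eq_abs, abs_of_nonneg (integral_nonneg fun x => norm_nonneg _)]
    calc _ ≤ ∫ x in Set.Ioi (0 : ℝ), M * ((1 + t) * weight (-u) t)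
            * Real.exp (-((1 + t) / 4) * x) := by
          refine integral_mono_of_nonneg (Eventually.of_forall fun x => norm_nonneg _) (hE t ht) ?_
          filter_upwards [ae_restrict_mem measurableSet_Ioi] with x hx
          exact hb t x ht hx
      _ = 4 * M * weight (-u) t := by
          rw [integral_const_mul, integral_exp_neg_mul_Ioi (by positivity)]
          field_simp

theorem integral_testKernel_left {u : ℝ} (hu : 0 < u) (hu1 : u < 1) (φ : 𝓢(ℝ, ℂ)) {x : ℝ}
    (hx : 0 < x) :
    ∫ t in Set.Ioi (0 : ℝ), testKernel u φ t x
      = (Real.exp (-x / 2) : ℝ)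
        * (kummerI (1 - u) x * φ x - kummerI (1 + u) x * φ (-x)) := by
  have hi : ∀ p : ℝ, -1 < p → IntegrableOn (fun t =>
      ((Real.exp (-x * t) * ratio t ^ p * 1 : ℝ) : ℂ)) (Set.Ioi 0) := fun p hp =>
    (integrableOn_laplaceRatio (f := fun _ => 1) hp hx (by fun_prop) (by simp)).ofReal
  have hI : ∀ p : ℝ, ∫ t in Set.Ioi (0 : ℝ), ((Real.exp (-x * t) * ratio t ^ p * 1 : ℝ) : ℂ)
      = (laplaceRatio p (fun _ => 1) x : ℝ) := fun p => by
    rw [laplaceRatio]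
    exact integral_ofReal
  have e : ∀ t : ℝ, testKernel u φ t x
      = (Real.exp (-x / 2) : ℂ) * φ x * ((Real.exp (-x * t) * ratio t ^ (-u) * 1 : ℝ) : ℂ)
        - (Real.exp (-x / 2) : ℂ) * φ (-x) * ((Real.exp (-x * t) * ratio t ^ u * 1 : ℝ) : ℂ) := by
    intro t
    have : Real.exp (-(t + 1 / 2) * x) = Real.exp (-x / 2) * Real.exp (-x * t) := by
      rw [← Real.exp_add]
      congr 1
      ring
    rw [testKernel, this]
    push_cast
    ring
  simp only [e]
  rw [integral_sub ((hi (-u) (by linarith)).const_mul _) ((hi u (by linarith)).const_mul _),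
    integral_const_mul, integral_const_mul, hI, hI, kummerI, kummerI, sub_sub_cancel_left,
    add_sub_cancel_left]
  ring

theorem integrable_mul_inv (ψ : 𝓢(ℝ, ℂ)) (s : ℝ) {t : ℝ} (ht : 0 < t) :
    Integrable fun l : ℝ => ψ l * ((t : ℂ) + 1 / 2 + Complex.I * (s * l : ℝ))⁻¹ := by
  refine (ψ.integrable.norm.mul_const (2 / (1 + t))).mono' ?_ (Eventually.of_forall fun l => ?_)
  · exact (ψ.continuous.mul (Continuous.inv₀ (by fun_prop) fun l =>
      add_half_add_ne_zero (s * l) ht.le)).aestronglyMeasurable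
  · rw [norm_mul]
    gcongr
    exact norm_inv_le (s * l) ht

theorem integral_testKernel_right (u : ℝ) (ψ : 𝓢(ℝ, ℂ)) {t : ℝ} (ht : 0 < t) :
    ∫ x in Set.Ioi (0 : ℝ), testKernel u (schwartzFourier ψ) t x
      = ∫ l : ℝ, ψ l * cauchyKernel u l t := by
  have hi : ∀ s : ℝ, IntegrableOn (fun x : ℝ => (Real.exp (-(t + 1 / 2) * x) : ℂ)
      * schwartzFourier ψ (s * x)) (Set.Ioi 0) := fun s => by
    obtain ⟨M, hM, hb, -⟩ := exists_schwartz_bound (schwartzFourier ψ)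
    refine Integrable.mono' ((integrableOn_exp_neg_mul_Ioi
      (by positivity : 0 < t + 1 / 2)).mul_const M) ?_ (Eventually.of_forall fun x => ?_)
    · refine Continuous.aestronglyMeasurable ?_
      have := (schwartzFourier ψ).continuous
      fun_prop
    · rw [norm_mul, Complex.norm_real, Real.norm_eq_abs, abs_of_pos (Real.exp_pos _)]
      gcongr
      exact hb _
  have h1 := integral_exp_mul_schwartzFourier ψ 1 ht
  have h2 := integral_exp_mul_schwartzFourier ψ (-1) ht
  have e : ∀ x : ℝ, testKernel u (schwartzFourier ψ) t x
      = (ratio t ^ (-u) : ℝ) * ((Real.exp (-(t + 1 / 2) * x) : ℂ) * schwartzFourier ψ (1 * x))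
        - (ratio t ^ u : ℝ)
          * ((Real.exp (-(t + 1 / 2) * x) : ℂ) * schwartzFourier ψ (-1 * x)) := by
    intro x
    rw [testKernel, one_mul, neg_one_mul]
    ring
  simp only [e]
  rw [integral_sub ((hi 1).const_mul _) ((hi (-1)).const_mul _), integral_const_mul,
    integral_const_mul, h1, h2, ← integral_const_mul, ← integral_const_mul,
    ← integral_sub ((integrable_mul_inv ψ 1 ht).const_mul _)
      ((integrable_mul_inv ψ (-1) ht).const_mul _)]
  refine integral_congr_ae (Eventually.of_forall fun l => ?_)
  simp only [cauchyKernel, one_mul, neg_one_mul]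
  ring

/-- The Laplace integrals, paired with a Fourier transform, equal the Cauchy integral paired with
the original function: Fubini's theorem for `testKernel`, then for `ψ l * cauchyKernel u l t`. -/
theorem integral_kummerI_mul_schwartzFourier {u : ℝ} (hu : 0 < u) (hu1 : u < 1) (ψ : 𝓢(ℝ, ℂ)) :
    ∫ x in Set.Ioi (0 : ℝ), (Real.exp (-x / 2) : ℝ)
        * (kummerI (1 - u) x * schwartzFourier ψ x - kummerI (1 + u) x * schwartzFourier ψ (-x))
      = ∫ l : ℝ, ψ l * cauchyIntegral u l := by
  have hint : Integrable (Function.uncurry fun t l => ψ l * cauchyKernel u l t)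
      ((volume.restrict (Set.Ioi 0)).prod volume) := by
    refine (((integrableOn_weight (p := -u) (by linarith)).const_mul 8).mul_prod
      (integrable_one_add_abs_mul ψ)).mono' ?_ ?_
    · refine Measurable.aestronglyMeasurable ?_
      have h1 := ψ.continuous.measurable
      have h2 : Measurable fun z : ℝ × ℝ => ratio z.1 ^ u :=
        (measurable_ratio_rpow u).comp measurable_fst
      have h3 : Measurable fun z : ℝ × ℝ => ratio z.1 ^ (-u) :=
        (measurable_ratio_rpow (-u)).comp measurable_fst
      unfold cauchyKernel Function.uncurry
      fun_prop
    · have hae : ∀ᵐ z : ℝ × ℝ ∂((volume.restrict (Set.Ioi (0 : ℝ))).prod volume), 0 < z.1 :=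
        Measure.quasiMeasurePreserving_fst.ae (ae_restrict_mem measurableSet_Ioi)
      filter_upwards [hae] with z hz
      rw [Function.uncurry_def, norm_mul]
      have := norm_cauchyKernel_le hu hu1 z.2 hz
      calc _ ≤ ‖ψ z.2‖ * (8 * (1 + |z.2|) * weight (-u) z.1) := by gcongr
        _ = _ := by ring
  calc _ = ∫ x in Set.Ioi (0 : ℝ), ∫ t in Set.Ioi (0 : ℝ),
        testKernel u (schwartzFourier ψ) t x :=
        setIntegral_congr_fun measurableSet_Ioi fun x hx =>
          (integral_testKernel_left hu hu1 _ hx).symm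
    _ = ∫ t in Set.Ioi (0 : ℝ), ∫ x in Set.Ioi (0 : ℝ), testKernel u (schwartzFourier ψ) t x :=
        (integral_integral_swap (integrable_testKernel hu hu1 _)).symm
    _ = ∫ t in Set.Ioi (0 : ℝ), ∫ l : ℝ, ψ l * cauchyKernel u l t :=
        setIntegral_congr_fun measurableSet_Ioi fun t ht => integral_testKernel_right u ψ ht
    _ = ∫ l : ℝ, ∫ t in Set.Ioi (0 : ℝ), ψ l * cauchyKernel u l t := integral_integral_swap hint
    _ = _ := by
        refine integral_congr_ae (Eventually.of_forall fun l => ?_)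
        simp only
        rw [integral_const_mul, cauchyIntegral]

/-! ### The decomposition of `μ^{*u}` -/

/-- The value on a Schwartz function of `cos (πu) δ₀ + (sin (πu) / π) pv (1 / x) + Φ_u`. -/
noncomputable def decomp (u : ℝ) (φ : 𝓢(ℝ, ℂ)) : ℂ :=
  Real.cos (Real.pi * u) * φ 0 + (Real.sin (Real.pi * u) / Real.pi : ℝ) * pvInv φ
    + ∫ x : ℝ, (Phi u x : ℂ) * φ x

theorem integrable_Phi_mul {u : ℝ} (hu : ∀ m : ℤ, u ≠ m) (φ : 𝓢(ℝ, ℂ)) :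
    Integrable fun x : ℝ => (Phi u x : ℂ) * φ x :=
  (memLp_ofReal_Phi hu).integrable_mul (φ.memLp 2)

theorem integral_eq_integral_Ioi_add {f : ℝ → ℂ} (hf : Integrable f) :
    ∫ x, f x = ∫ x in Set.Ioi (0 : ℝ), (f x + f (-x)) := by
  rw [integral_add hf.integrableOn hf.comp_neg.integrableOn, integral_comp_neg_Ioi, neg_zero,
    add_comm, intervalIntegral.integral_Iic_add_Ioi hf.integrableOn hf.integrableOn]

/-- The decomposition for `0 < u < 1`. Here `Φ_u` is given by Laplace integrals and the symbol by a
Cauchy integral, which `integral_kummerI_mul_schwartzFourier` relates; the terms `1 / x` of `Φ_u`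
and of the principal value cancel. -/
theorem muPow_eq_decomp_of_mem_Ioo {u : ℝ} (h0 : 0 < u) (h1 : u < 1) (φ : 𝓢(ℝ, ℂ)) :
    muPow u φ = decomp u φ := by
  have hu : ∀ m : ℤ, u ≠ m := fun m h => by
    rw [h] at h0 h1
    have a0 : 0 < m := by exact_mod_cast h0
    have a1 : m < 1 := by exact_mod_cast h1
    omega
  rw [← schwartzFourier_inv φ]
  generalize schwartzFourierInv φ = ψ
  have hL : muPow u (schwartzFourier ψ) = Real.cos (Real.pi * u) * (∫ l, ψ l)
      + (Real.sin (Real.pi * u) / Real.pi : ℝ) * ∫ l : ℝ, ψ l * cauchyIntegral u l := by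
    rw [muPow_schwartzFourier, ← sub_eq_iff_eq_add', ← integral_const_mul, ← integral_const_mul,
      ← integral_sub (integrable_mul_symbol u ψ) (ψ.integrable.const_mul _)]
    refine integral_congr_ae (Eventually.of_forall fun l => ?_)
    simp only
    rw [symbol_eq_cauchyIntegral h0 h1]
    ring
  have hφ0 : schwartzFourier ψ 0 = ∫ l, ψ l := by
    rw [schwartzFourier_apply]
    simp
  have hi := integrable_Phi_mul hu (schwartzFourier ψ)
  have hi2 : IntegrableOn (fun x : ℝ => (Phi u x : ℂ) * schwartzFourier ψ x
      + (Phi u (-x) : ℂ) * schwartzFourier ψ (-x)) (Set.Ioi 0) :=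
    (hi.add hi.comp_neg).integrableOn
  rw [hL, decomp, hφ0, add_assoc]
  congr 1
  rw [integral_eq_integral_Ioi_add hi, pvInv_apply,
    ← integral_const_mul _ fun x : ℝ => (schwartzFourier ψ x - schwartzFourier ψ (-x)) / (x : ℂ),
    ← integral_add ((pv_integrable _).const_mul _) hi2,
    ← integral_kummerI_mul_schwartzFourier h0 h1, ← integral_const_mul]
  refine setIntegral_congr_fun measurableSet_Ioi fun x hx => ?_
  have hx0 : 0 < x := hx
  have hxc : (x : ℂ) ≠ 0 := by exact_mod_cast hx0.ne'
  rw [Phi_neg, Phi_of_pos _ hx0, Phi_of_pos _ hx0, sub_neg_eq_add, mul_neg, Real.sin_neg,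
    kummerV_eq_kummerI (by linarith) (by linarith) hx0,
    kummerV_eq_kummerI (by linarith) (by linarith) hx0]
  push_cast
  field_simp
  ring

/-- The reflection `φ ↦ (x ↦ φ (-x))` of Schwartz functions. -/
noncomputable def reflect : 𝓢(ℝ, ℂ) →L[ℂ] 𝓢(ℝ, ℂ) :=
  SchwartzMap.compCLMOfContinuousLinearEquiv ℂ (ContinuousLinearEquiv.neg ℝ)

theorem reflect_apply (φ : 𝓢(ℝ, ℂ)) (x : ℝ) : reflect φ x = φ (-x) := rfl

theorem reflect_schwartzFourier (ψ : 𝓢(ℝ, ℂ)) :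
    reflect (schwartzFourier ψ) = schwartzFourier (reflect ψ) := by
  ext l
  rw [reflect_apply, schwartzFourier_apply, schwartzFourier_apply, ← integral_neg_eq_self]
  refine integral_congr_ae (Eventually.of_forall fun x => ?_)
  simp only [reflect_apply]
  congr 2
  push_cast
  ring

theorem muPow_reflect (u : ℝ) (φ : 𝓢(ℝ, ℂ)) : muPow u (reflect φ) = muPow (-u) φ := by
  rw [← schwartzFourier_inv φ]
  generalize schwartzFourierInv φ = ψ
  rw [reflect_schwartzFourier, muPow_schwartzFourier, muPow_schwartzFourier,
    ← integral_neg_eq_self]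
  refine integral_congr_ae (Eventually.of_forall fun l => ?_)
  simp only [reflect_apply, neg_neg, symbol, mul_neg, Real.arctan_neg]
  push_cast
  congr 2
  ring

theorem decomp_reflect (u : ℝ) (φ : 𝓢(ℝ, ℂ)) : decomp u (reflect φ) = decomp (-u) φ := by
  have h1 : pvInv (reflect φ) = -pvInv φ := by
    rw [pvInv_apply, pvInv_apply, ← integral_neg]
    refine integral_congr_ae (Eventually.of_forall fun x => ?_)
    simp only [reflect_apply, neg_neg]
    ring
  have h2 : ∫ x : ℝ, (Phi u x : ℂ) * reflect φ x = ∫ x : ℝ, (Phi (-u) x : ℂ) * φ x := by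
    rw [← integral_neg_eq_self]
    refine integral_congr_ae (Eventually.of_forall fun x => ?_)
    simp only [reflect_apply, neg_neg, Phi_neg]
  rw [decomp, decomp, h1, h2, reflect_apply, neg_zero, mul_neg Real.pi, Real.cos_neg, Real.sin_neg]
  push_cast
  ring

/-! ### The recurrence in `u` -/

theorem sin_pi_mul_add_one (u : ℝ) :
    Real.sin (Real.pi * (u + 1)) = -Real.sin (Real.pi * u) := by
  rw [mul_add, mul_one, Real.sin_add_pi]

theorem sin_pi_mul_sub_one (u : ℝ) :
    Real.sin (Real.pi * (u - 1)) = -Real.sin (Real.pi * u) := by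
  rw [mul_sub, mul_one, Real.sin_sub_pi]

theorem Phi_recurrence_of_pos {u : ℝ} (hu : ∀ m : ℤ, u ≠ m) {x : ℝ} (hx : 0 < x) :
    x * Phi u x + Real.sin (Real.pi * u) / Real.pi
      = u * (Phi (u + 1) x + 2 * Phi u x + Phi (u - 1) x) := by
  have h := kummerV_recurrence (one_sub_ne_intCast hu) hx
  rw [Phi_of_pos _ hx, Phi_of_pos _ hx, Phi_of_pos _ hx, sin_pi_mul_add_one, sin_pi_mul_sub_one,
    show 1 - (u + 1) = 1 - u - 1 by ring, show 1 - (u - 1) = 1 - u + 1 by ring]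
  have hpi := Real.pi_ne_zero
  generalize kummerV (1 - u - 1) x = A at *
  generalize kummerV (1 - u + 1) x = B at *
  generalize kummerV (1 - u) x = V at *
  generalize Real.exp (-x / 2) = E
  field_simp
  linear_combination -(x * Real.sin (Real.pi * u) * E) * h

theorem Phi_recurrence {u : ℝ} (hu : ∀ m : ℤ, u ≠ m) {x : ℝ} (hx : x ≠ 0) :
    x * Phi u x + Real.sin (Real.pi * u) / Real.pi
      = u * (Phi (u + 1) x + 2 * Phi u x + Phi (u - 1) x) := by
  rcases lt_or_gt_of_ne hx with h | h
  · have := Phi_recurrence_of_pos (neg_ne_intCast hu) (neg_pos.2 h)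
    rw [show -u + 1 = -(u - 1) by ring, show -u - 1 = -(u + 1) by ring, ← Phi_neg, ← Phi_neg,
      ← Phi_neg, neg_neg, mul_neg, Real.sin_neg, neg_div] at this
    linear_combination -this
  · exact Phi_recurrence_of_pos hu h

theorem pvInv_mulCoord (φ : 𝓢(ℝ, ℂ)) : pvInv (mulCoord φ) = ∫ x, φ x := by
  rw [pvInv_apply, integral_eq_integral_Ioi_add φ.integrable]
  refine setIntegral_congr_fun measurableSet_Ioi fun x hx => ?_
  have hx0 : (x : ℂ) ≠ 0 := by exact_mod_cast (ne_of_gt hx)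
  simp only [mulCoord_apply]
  push_cast
  field_simp
  ring

theorem add_one_ne_intCast {u : ℝ} (hu : ∀ m : ℤ, u ≠ m) (m : ℤ) : u + 1 ≠ m := by
  intro h
  refine hu (m - 1) ?_
  push_cast
  linarith

theorem sub_one_ne_intCast {u : ℝ} (hu : ∀ m : ℤ, u ≠ m) (m : ℤ) : u - 1 ≠ m := by
  intro h
  refine hu (m + 1) ?_
  push_cast
  linarith

/-- The decomposition satisfies the same recurrence as `μ^{*u}`, see `muPow_mulCoord`. -/
theorem decomp_mulCoord {u : ℝ} (hu : ∀ m : ℤ, u ≠ m) (φ : 𝓢(ℝ, ℂ)) :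
    decomp u (mulCoord φ) = u * (decomp (u + 1) φ + 2 * decomp u φ + decomp (u - 1) φ) := by
  have i1 := integrable_Phi_mul (add_one_ne_intCast hu) φ
  have i2 := (integrable_Phi_mul hu φ).const_mul 2
  have i3 := integrable_Phi_mul (sub_one_ne_intCast hu) φ
  have i4 := integrable_Phi_mul hu (mulCoord φ)
  have h : (Real.sin (Real.pi * u) / Real.pi : ℝ) * (∫ x, φ x)
        + ∫ x : ℝ, (Phi u x : ℂ) * mulCoord φ x
      = u * ((∫ x : ℝ, (Phi (u + 1) x : ℂ) * φ x) + 2 * (∫ x : ℝ, (Phi u x : ℂ) * φ x)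
        + ∫ x : ℝ, (Phi (u - 1) x : ℂ) * φ x) := by
    have i12 : Integrable fun x : ℝ => (Phi (u + 1) x : ℂ) * φ x + 2 * ((Phi u x : ℂ) * φ x) :=
      i1.add i2
    rw [← integral_const_mul 2, ← integral_add i1 i2, ← integral_add i12 i3, ← integral_const_mul,
      ← integral_const_mul, ← integral_add (φ.integrable.const_mul _) i4]
    refine integral_congr_ae ?_
    filter_upwards [ae_ne_zero] with x hx
    have hr := congrArg (fun y : ℝ => (y : ℂ)) (Phi_recurrence hu hx)
    simp only [mulCoord_apply] at hr ⊢
    push_cast at hr ⊢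
    linear_combination φ x * hr
  have hc1 : Real.cos (Real.pi * (u + 1)) = -Real.cos (Real.pi * u) := by
    rw [mul_add, mul_one, Real.cos_add_pi]
  have hc2 : Real.cos (Real.pi * (u - 1)) = -Real.cos (Real.pi * u) := by
    rw [mul_sub, mul_one, Real.cos_sub_pi]
  simp only [decomp]
  rw [pvInv_mulCoord, mulCoord_apply, hc1, hc2, sin_pi_mul_add_one, sin_pi_mul_sub_one]
  push_cast at h ⊢
  linear_combination h

/-- The decomposition for all non-integer `u`: the recurrence carries it from `-1 < u < 1` to
every translate by an integer. -/
theorem muPow_eq_decomp {u : ℝ} (hu : ∀ m : ℤ, u ≠ m) (φ : 𝓢(ℝ, ℂ)) :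
    muPow u φ = decomp u φ := by
  have hv0 : 0 < Int.fract u := Int.fract_pos.2 (hu _)
  have hv1 : Int.fract u < 1 := Int.fract_lt_one u
  have hshift : ∀ n m : ℤ, Int.fract u + n ≠ m := by
    intro n m h
    refine hu (m - n + ⌊u⌋) ?_
    have := Int.fract_add_floor u
    push_cast
    linarith
  -- At a non-integer `w`, two of the three consecutive identities imply the third.
  have hsum : ∀ w : ℝ, (∀ m : ℤ, w ≠ m) → (∀ φ, muPow w φ = decomp w φ) → ∀ φ,
      muPow (w + 1) φ + muPow (w - 1) φ = decomp (w + 1) φ + decomp (w - 1) φ := by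
    intro w hw h φ
    have hw0 : (w : ℂ) ≠ 0 := by
      have := hw 0
      rw [Int.cast_zero] at this
      exact_mod_cast this
    have h1 := muPow_mulCoord w φ
    rw [h (mulCoord φ), decomp_mulCoord hw] at h1
    have h2 := mul_left_cancel₀ hw0 h1
    linear_combination -h2 - 2 * h φ
  have key : ∀ n : ℤ, (∀ φ, muPow (Int.fract u + n) φ = decomp (Int.fract u + n) φ) ∧
      ∀ φ, muPow (Int.fract u + n - 1) φ = decomp (Int.fract u + n - 1) φ := by
    intro n
    induction n with
    | zero =>
      simp only [Int.cast_zero, add_zero]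
      refine ⟨muPow_eq_decomp_of_mem_Ioo hv0 hv1, fun φ => ?_⟩
      rw [show Int.fract u - 1 = -(1 - Int.fract u) by ring, ← muPow_reflect, ← decomp_reflect]
      exact muPow_eq_decomp_of_mem_Ioo (by linarith) (by linarith) _
    | succ i ih =>
      rw [show Int.fract u + ((i + 1 : ℤ) : ℝ) = Int.fract u + (i : ℤ) + 1 by push_cast; ring,
        add_sub_cancel_right]
      exact ⟨fun φ => by linear_combination hsum _ (hshift i) ih.1 φ - ih.2 φ, ih.1⟩
    | pred i ih =>
      have hw := sub_one_ne_intCast (hshift (-i))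
      rw [show Int.fract u + ((-i - 1 : ℤ) : ℝ) = Int.fract u + (-i : ℤ) - 1 by push_cast; ring]
      refine ⟨ih.2, fun φ => ?_⟩
      have h := hsum _ hw ih.2 φ
      rw [sub_add_cancel] at h
      linear_combination h - ih.1 φ
  have h := (key ⌊u⌋).1 φ
  rwa [Int.fract_add_floor] at h

end JeulinYor

theorem proposition1 (u : ℝ) (hu : ∀ n : ℤ, u ≠ (n : ℝ)) :
    (∀ x : ℝ, x ≠ 0 → Summable (JeulinYor.phiTerm u x)) ∧
    (∃ hΦ : MemLp (fun x : ℝ => (JeulinYor.Phi u x : ℂ)) 2 (volume : Measure ℝ),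
      JeulinYor.muPow u
        = ((Real.cos (Real.pi * u) : ℝ) : ℂ) • TemperedDistribution.delta (0 : ℝ)
          + ((Real.sin (Real.pi * u) / Real.pi : ℝ) : ℂ) • JeulinYor.pvInv
          + Lp.toTemperedDistribution
              (hΦ.toLp (fun x : ℝ => (JeulinYor.Phi u x : ℂ)))) ∧
    JeulinYor.mulX (JeulinYor.D (JeulinYor.D (JeulinYor.muPow u)))
        + (2 : ℂ) • JeulinYor.D (JeulinYor.muPow u)
        + ((u : ℂ) • JeulinYor.muPow u
          - (1 / 4 : ℂ) • JeulinYor.mulX (JeulinYor.muPow u)) = 0 := by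
  refine ⟨fun x hx => JeulinYor.summable_phiTerm hu hx, ⟨JeulinYor.memLp_ofReal_Phi hu, ?_⟩,
    JeulinYor.muPow_ode u⟩
  ext φ
  rw [JeulinYor.muPow_eq_decomp hu φ, JeulinYor.decomp]
  change _ = ((Real.cos (Real.pi * u) : ℝ) : ℂ) • φ 0
    + ((Real.sin (Real.pi * u) / Real.pi : ℝ) : ℂ) • JeulinYor.pvInv φ
    + Lp.toTemperedDistribution ((JeulinYor.memLp_ofReal_Phi hu).toLp _) φ
  rw [Lp.toTemperedDistribution_apply]
  congr 1
  refine integral_congr_ae ?_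
  filter_upwards [(JeulinYor.memLp_ofReal_Phi hu).coeFn_toLp] with x hx
  rw [hx, smul_eq_mul, mul_comm]
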